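/- \textbf{Lemma.} Let $M$ be a smooth 6-manifold (Hausdorff, second countable, without boundary), let $t$ be the coordinate on $\mathbb R$, and give the spaces $\Omega^k(M)$ of smooth forms the $C^\infty$ topology (uniform convergence of all derivatives on compact subsets of charts). A 3-form on a 6-dimensional space is \emph{positive} if in suitable linear coordinates it is $\mathrm{Re}(dz_1\wedge dz_2\wedge dz_3)$. For such a $\rho$ there are a complex structure $J$ and a real 3-form $\hat\rho$, with $(J,\hat\rho)$ unique up to simultaneous sign, such that $\rho+i\hat\rho$ is complex trilinear for $J$. A pair $(\rho,\omega)\in\Omega^3(M)\times\Omega^2(M)$ is an \emph{$SU(3)$-structure} if at each point $\omega$ is nondegenerate, $\rho$ is positive, $\omega\wedge\rho=0$ and, for one of the two choices of $(J,\hat\rho)$, $\frac16\omega^3=\frac14\rho\wedge\hat\rho$ and $\omega(\cdot,J\cdot)$ is positive definite. A pair $(\rho,\tau)\in\Omega^3(M)\times\Omega^4(M)$ is an $SU(3)$-structure if at each point $\tau=\frac12\omega^2$ for some $\omega$ satisfying these conditions together with $\rho$. Let $\mathcal R_{SU(3)}$ be the space of $SU(3)$-structures. A 3-form (resp. 4-form)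 on a 7-dimensional space is a \emph{$G_2$ form} if in suitable linear coordinates it is $\varphi_0=dx_{123}+dx_{145}+dx_{167}+dx_{246}-dx_{257}-dx_{347}-dx_{356}$ (resp. $\psi_0=*\varphi_0$); a $G_2$ 3-form $\varphi$ induces a metric $g_\varphi$ and a cross product with $g_\varphi(u\times_\varphi v,w)=\varphi(u,v,w)$. Let $\mathcal R_{G_2}$ be the space of \emph{$G_2$-pairs}: pairs $(\rho,\omega)\in\Omega^3(M)\times\Omega^2(M)$ for which $\varphi=\rho+dt\wedge\omega$ is a $G_2$ form at each point of $\mathbb R\times M$; or, in the version with 4-forms, pairs $(\rho,\tau)\in\Omega^3(M)\times\Omega^4(M)$ for which $\psi=dt\wedge\rho+\tau$ is a $G_2$ form at each point of $\mathbb R\times M$. Then, in each of the two versions, $\mathcal R_{SU(3)}\subseteq\mathcal R_{G_2}$ and $\mathcal R_{SU(3)}$ is a deformation retract of $\mathcal R_{G_2}$: there is a continuous $F:\mathcal R_{G_2}\times[0,1]\to\mathcal R_{G_2}$ with $F(p,0)=p$ and $F(p,1)\in\mathcal R_{SU(3)}$ for all $p$, and $F(p,s)=p$ for all $s$ if $p\in\mathcal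 R_{SU(3)}$. In the version with 2-forms $F$ can moreover be chosen of the following form. For each $(\rho,\omega)\in\mathcal R_{G_2}$, with $\varphi=\rho+dt\wedge\omega$, there is a family $(n_s)_{0\le s\le1}$ of nowhere vanishing sections of $T(\mathbb R\times M)|_{\{0\}\times M}$, smooth in $(s,x)$, with $n_0=\partial_t$ and $n_1$ a $g_\varphi$-unit normal field of $\{0\}\times M$, such that $F((\rho,\omega),s)=(\rho,\omega_s)$, where $\omega_s(u,v)=g_\varphi(u,-n_s\times_\varphi v)$ for $u,v\in TM$; here $v\mapsto n_1\times_\varphi v$ is an almost complex structure on $M$. -/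

import Mathlib

open scoped Manifold unitInterval

noncomputable section

/-! ### Linear algebra of exterior forms -/

section Algebra

variable {V : Type*} [AddCommGroup V] [Module ℝ V]

/-- The wedge product of exterior forms, in the convention
`(α ∧ β) (v) = ∑ (shuffles σ), sign σ * α (v ∘ σ ∘ inl) * β (v ∘ σ ∘ inr)`,
so that `(dx ∧ dy) (∂x, ∂y) = 1`. -/
def wedge {p q : ℕ} (α : V [⋀^Fin p]→ₗ[ℝ] ℝ) (β : V [⋀^Fin q]→ₗ[ℝ] ℝ) :
    V [⋀^Fin (p + q)]→ₗ[ℝ] ℝ :=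
  ((LinearMap.mul' ℝ ℝ).compAlternatingMap (α.domCoprod β)).domDomCongr finSumFinEquiv

/-- The elementary form `dx_{i 0} ∧ ⋯ ∧ dx_{i (k-1)}` on `ℝⁿ` (coordinates numbered from `0`):
its value on `v` is the determinant of the matrix `v a (i b)`. -/
def dx {n k : ℕ} (i : Fin k → Fin n) : (Fin n → ℝ) [⋀^Fin k]→ₗ[ℝ] ℝ :=
  (Matrix.detRowAlternating (n := Fin k) (R := ℝ)).compLinearMap (LinearMap.funLeft ℝ ℝ i)

/-- The standard `G₂` 3-form on `ℝ⁷`,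
`dx₁₂₃ + dx₁₄₅ + dx₁₆₇ + dx₂₄₆ - dx₂₅₇ - dx₃₄₇ - dx₃₅₆` in coordinates numbered from `1`. -/
def stdG2Form3 : (Fin 7 → ℝ) [⋀^Fin 3]→ₗ[ℝ] ℝ :=
  dx ![0, 1, 2] + dx ![0, 3, 4] + dx ![0, 5, 6] + dx ![1, 3, 5]
    - dx ![1, 4, 6] - dx ![2, 3, 6] - dx ![2, 4, 5]

/-- The Hodge dual of `stdG2Form3` for the Euclidean metric and the standard orientation,
`dx₄₅₆₇ + dx₂₃₆₇ + dx₂₃₄₅ + dx₁₃₅₇ - dx₁₃₄₆ - dx₁₂₅₆ - dx₁₂₄₇` in coordinates numbered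
from `1`. -/
def stdG2Form4 : (Fin 7 → ℝ) [⋀^Fin 4]→ₗ[ℝ] ℝ :=
  dx ![3, 4, 5, 6] + dx ![1, 2, 5, 6] + dx ![1, 2, 3, 4] + dx ![0, 2, 4, 6]
    - dx ![0, 2, 3, 5] - dx ![0, 1, 4, 5] - dx ![0, 1, 3, 6]

/-- The cross product of `ℝ⁷ = Im 𝕆`, given by `⟨u × v, w⟩ = φ₀ (u, v, w)`. -/
def stdCross (u v : Fin 7 → ℝ) : Fin 7 → ℝ := fun i => stdG2Form3 ![u, v, Pi.single i 1]

/-- A stable 3-form with compact stabilizer `G₂` on a 7-dimensional space: a form which is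
`stdG2Form3` in suitable linear coordinates. -/
def IsG2Form3 (φ : V [⋀^Fin 3]→ₗ[ℝ] ℝ) : Prop :=
  ∃ f : V ≃ₗ[ℝ] (Fin 7 → ℝ), φ = stdG2Form3.compLinearMap (f : V →ₗ[ℝ] (Fin 7 → ℝ))

/-- A stable 4-form `ψ = *φ` of a `G₂`-structure on a 7-dimensional space: a form which is
`stdG2Form4` in suitable linear coordinates. -/
def IsG2Form4 (ψ : V [⋀^Fin 4]→ₗ[ℝ] ℝ) : Prop :=
  ∃ f : V ≃ₗ[ℝ] (Fin 7 → ℝ), ψ = stdG2Form4.compLinearMap (f : V →ₗ[ℝ] (Fin 7 → ℝ))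

open Classical in
/-- The inner product `g_φ` of a `G₂` 3-form `φ`: the Euclidean one in any coordinates in which
`φ` is `stdG2Form3` (independent of these coordinates, as `G₂ ⊆ SO(7)`). -/
def g2Metric (φ : V [⋀^Fin 3]→ₗ[ℝ] ℝ) (u v : V) : ℝ :=
  if h : IsG2Form3 φ then h.choose u ⬝ᵥ h.choose v else 0

open Classical in
/-- The cross product `u ×_φ v` of a `G₂` 3-form `φ`: the one of `ℝ⁷` in any coordinates in which
`φ` is `stdG2Form3`; it satisfies `g_φ (u ×_φ v, w) = φ (u, v, w)`. -/
def g2Cross (φ : V [⋀^Fin 3]→ₗ[ℝ] ℝ) (u v : V) : V :=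
  if h : IsG2Form3 φ then h.choose.symm (stdCross (h.choose u) (h.choose v)) else 0

/-- A stable (nondegenerate) 2-form. -/
def IsNondegenerate2 (ω : V [⋀^Fin 2]→ₗ[ℝ] ℝ) : Prop :=
  ∀ u, (∀ v, ω ![u, v] = 0) → u = 0

/-- The real part of `dz₁ ∧ dz₂ ∧ dz₃` on `ℝ⁶ = ℂ³`, `z_k = x_{2k-1} + i x_{2k}`. -/
def stdPositiveForm : (Fin 6 → ℝ) [⋀^Fin 3]→ₗ[ℝ] ℝ :=
  dx ![0, 2, 4] - dx ![0, 3, 5] - dx ![1, 2, 5] - dx ![1, 3, 4]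

/-- A positive 3-form on a 6-dimensional space (stable, of the type with stabilizer `SL(3, ℂ)`):
a form which is `Re (dz₁ ∧ dz₂ ∧ dz₃)` in suitable linear coordinates. -/
def IsPositive3 (ρ : V [⋀^Fin 3]→ₗ[ℝ] ℝ) : Prop :=
  ∃ f : V ≃ₗ[ℝ] (Fin 6 → ℝ), ρ = stdPositiveForm.compLinearMap (f : V →ₗ[ℝ] (Fin 6 → ℝ))

/-- `J` is a complex structure such that `Ω = ρ + i ρ'` is complex trilinear for `J`,
that is `Ω (J u, v, w) = i Ω (u, v, w)`. For a positive form `ρ` such a pair `(J, ρ')` exists and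
is unique up to replacing it by `(-J, -ρ')`; then `ρ'` is the Hitchin dual of `ρ`, the sign
being the choice of an orientation. -/
structure IsHitchinDual (ρ : V [⋀^Fin 3]→ₗ[ℝ] ℝ) (J : V →ₗ[ℝ] V) (ρ' : V [⋀^Fin 3]→ₗ[ℝ] ℝ) :
    Prop where
  sq : ∀ v, J (J v) = -v
  re : ∀ u v w, ρ ![J u, v, w] = -ρ' ![u, v, w]
  im : ∀ u v w, ρ' ![J u, v, w] = ρ ![u, v, w]

/-- `(ρ, ω)` is an `SU(3)`-structure on the 6-dimensional space `V`: `ω` is stable, `ρ` is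
positive, `ω ∧ ρ = 0`, `ω³ / 6 = (ρ ∧ ρ̂) / 4`, and the symmetric form `ω (·, J ·)` is positive
definite (otherwise the stabilizer could be `SU(1, 2)`). -/
def IsSU3 (ρ : V [⋀^Fin 3]→ₗ[ℝ] ℝ) (ω : V [⋀^Fin 2]→ₗ[ℝ] ℝ) : Prop :=
  IsNondegenerate2 ω ∧ IsPositive3 ρ ∧ wedge ω ρ = 0 ∧
    ∃ (J : V →ₗ[ℝ] V) (ρ' : V [⋀^Fin 3]→ₗ[ℝ] ℝ), IsHitchinDual ρ J ρ' ∧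
      (1 / 6 : ℝ) • (wedge (wedge ω ω) ω : V [⋀^Fin 6]→ₗ[ℝ] ℝ) = (1 / 4 : ℝ) • wedge ρ ρ' ∧
      ∀ v, v ≠ 0 → 0 < ω ![v, J v]

/-- `(ρ, τ)`, with `τ` a 4-form, is an `SU(3)`-structure: `τ = ω² / 2` for a 2-form `ω` such that
`(ρ, ω)` is an `SU(3)`-structure. -/
def IsSU3' (ρ : V [⋀^Fin 3]→ₗ[ℝ] ℝ) (τ : V [⋀^Fin 4]→ₗ[ℝ] ℝ) : Prop :=
  ∃ ω : V [⋀^Fin 2]→ₗ[ℝ] ℝ, τ = (1 / 2 : ℝ) • wedge ω ω ∧ IsSU3 ρ ω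

/-- The 1-form `dt` on `ℝ × V`. -/
def dt : (ℝ × V) [⋀^Fin 1]→ₗ[ℝ] ℝ :=
  AlternatingMap.ofSubsingleton ℝ (ℝ × V) ℝ (0 : Fin 1) (LinearMap.fst ℝ ℝ V)

/-- The pullback of a form to `ℝ × V` by the projection to `V`. -/
def cylPullback {k : ℕ} (α : V [⋀^Fin k]→ₗ[ℝ] ℝ) : (ℝ × V) [⋀^Fin k]→ₗ[ℝ] ℝ :=
  α.compLinearMap (LinearMap.snd ℝ ℝ V)

/-- The 3-form `φ = ρ + dt ∧ ω` on `ℝ × V`. -/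
def cylForm3 (ρ : V [⋀^Fin 3]→ₗ[ℝ] ℝ) (ω : V [⋀^Fin 2]→ₗ[ℝ] ℝ) : (ℝ × V) [⋀^Fin 3]→ₗ[ℝ] ℝ :=
  cylPullback ρ + wedge dt (cylPullback ω)

/-- The 4-form `ψ = dt ∧ ρ + τ` on `ℝ × V`. -/
def cylForm4 (ρ : V [⋀^Fin 3]→ₗ[ℝ] ℝ) (τ : V [⋀^Fin 4]→ₗ[ℝ] ℝ) : (ℝ × V) [⋀^Fin 4]→ₗ[ℝ] ℝ :=
  wedge dt (cylPullback ρ) + cylPullback τ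

end Algebra

/-! ### Smooth forms on a 6-manifold and the `C^∞` topology -/

open scoped ContDiff

section Forms

variable (M : Type*) [TopologicalSpace M] [ChartedSpace (EuclideanSpace ℝ (Fin 6)) M]

variable {M} in
/-- The local representation, in a chart `e`, of a family `α` of alternating forms on the tangent
spaces of `M`: the pullback of `α` by `e⁻¹`. -/
def localRep {k : ℕ} (α : ∀ x : M, (TangentSpace (𝓡 6) x) [⋀^Fin k]→L[ℝ] ℝ)
    (e : OpenPartialHomeomorph M (EuclideanSpace ℝ (Fin 6))) (y : EuclideanSpace ℝ (Fin 6)) :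
    (EuclideanSpace ℝ (Fin 6)) [⋀^Fin k]→L[ℝ] ℝ :=
  (α (e.symm y)).compContinuousLinearMap (mfderiv (𝓡 6) (𝓡 6) e.symm y)

/-- The space `Ω^k(M)` of smooth differential `k`-forms on `M`. -/
structure SmoothForm (k : ℕ) where
  /-- The value at a point. -/
  toFun : ∀ x : M, (TangentSpace (𝓡 6) x) [⋀^Fin k]→L[ℝ] ℝ
  /-- All local representations are smooth. -/
  smooth : ∀ e ∈ atlas (EuclideanSpace ℝ (Fin 6)) M, ContDiffOn ℝ ∞ (localRep toFun e) e.target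

variable {M} in
/-- The value of a form at a point, as an algebraic alternating map. -/
def SmoothForm.at {k : ℕ} (α : SmoothForm M k) (x : M) :
    (TangentSpace (𝓡 6) x) [⋀^Fin k]→ₗ[ℝ] ℝ :=
  (α.toFun x).toAlternatingMap

/-- The `C^∞` topology: uniform convergence on compact subsets of charts of the local
representations and of all their derivatives. -/
instance SmoothForm.instTopologicalSpace (k : ℕ) : TopologicalSpace (SmoothForm M k) :=
  ⨅ e ∈ atlas (EuclideanSpace ℝ (Fin 6)) M, ⨅ j : ℕ,
    TopologicalSpace.induced
      (fun α : SmoothForm M k =>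
        UniformOnFun.ofFun {K : Set (EuclideanSpace ℝ (Fin 6)) | IsCompact K ∧ K ⊆ e.target}
          (iteratedFDerivWithin ℝ j (localRep α.toFun e) e.target))
      inferInstance

/-- The set `R_{G₂}` of `G₂`-pairs `(ρ, ω)`: `φ = ρ + dt ∧ ω` is a `G₂`-structure on `ℝ × M`. -/
def G2Pairs : Set (SmoothForm M 3 × SmoothForm M 2) :=
  {p | ∀ q : ℝ × M, IsG2Form3 (cylForm3 (p.1.at q.2) (p.2.at q.2))}

/-- The set `R_{SU(3)}` of `SU(3)`-structures `(ρ, ω)`. -/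
def SU3Pairs : Set (SmoothForm M 3 × SmoothForm M 2) :=
  {p | ∀ x : M, IsSU3 (p.1.at x) (p.2.at x)}

/-- The set `R_{G₂}` of `G₂`-pairs `(ρ, τ)` with `τ` a 4-form: `ψ = dt ∧ ρ + τ` is the 4-form of
a `G₂`-structure at each point of `ℝ × M`. -/
def G2Pairs' : Set (SmoothForm M 3 × SmoothForm M 4) :=
  {p | ∀ q : ℝ × M, IsG2Form4 (cylForm4 (p.1.at q.2) (p.2.at q.2))}

/-- The set `R_{SU(3)}` of `SU(3)`-structures `(ρ, τ)` with `τ` a 4-form. -/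
def SU3Pairs' : Set (SmoothForm M 3 × SmoothForm M 4) :=
  {p | ∀ x : M, IsSU3' (p.1.at x) (p.2.at x)}

end Forms

/-- `F` is a (strong) deformation retraction of the space `R` onto its subspace `A`. -/
structure IsDeformationRetraction {X : Type*} [TopologicalSpace X] (A R : Set X)
    (F : C(R × I, R)) : Prop where
  subset : A ⊆ R
  zero : ∀ p : R, F (p, 0) = p
  one_mem : ∀ p : R, (F (p, 1) : X) ∈ A
  fixed : ∀ (p : R) (s : I), (p : X) ∈ A → F (p, s) = p

/-- `n s`, `0 ≤ s ≤ 1`, is a family of nowhere vanishing vector fields along `{0} × M` in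
`ℝ × M`, smooth in `(s, x)`, from `∂_t` to a `g_φ`-unit normal field of `{0} × M`, where `φ` is a
family of `G₂` 3-forms on the spaces `ℝ × T_x M`. -/
structure IsNormalIsotopy {M : Type*} [TopologicalSpace M]
    [ChartedSpace (EuclideanSpace ℝ (Fin 6)) M] [IsManifold (𝓡 6) ∞ M]
    (φ : ∀ x : M, (ℝ × TangentSpace (𝓡 6) x) [⋀^Fin 3]→ₗ[ℝ] ℝ)
    (n : ℝ → ∀ x : M, ℝ × TangentSpace (𝓡 6) x) : Prop where
  smooth_fst : ContMDiff (𝓘(ℝ, ℝ).prod (𝓡 6)) 𝓘(ℝ, ℝ) ∞ (fun q : ℝ × M => (n q.1 q.2).1)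
  smooth_snd : ContMDiff (𝓘(ℝ, ℝ).prod (𝓡 6)) (𝓡 6).tangent ∞
    (fun q : ℝ × M => (⟨q.2, (n q.1 q.2).2⟩ : TangentBundle (𝓡 6) M))
  ne_zero : ∀ (s : I) (x : M), n s x ≠ 0
  zero : ∀ x, n 0 x = (1, 0)
  unit : ∀ x, g2Metric (φ x) (n 1 x) (n 1 x) = 1
  normal : ∀ (x : M) (v : TangentSpace (𝓡 6) x), g2Metric (φ x) (n 1 x) (0, v) = 0

end

open scoped ContDiff

/-! Fix a point and let `V` be its tangent space. For `m = (c, Y)` in `ℝ × V`, the contraction of `φ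
= ρ + dt ∧ ω` with `m`, restricted to `V`, is `c ω + Y ⌟ ρ`. The linear map that fixes `V` and sends
`∂_t` to `m` pulls `φ` back to `ρ + dt ∧ (c ω + Y ⌟ ρ)` (`cylForm3_shear`), so replacing `ω` by this
contraction preserves `G₂`-pairs whenever `c ≠ 0`. If `m` is the unit normal `n = (a, X)` of `V`
with `a > 0`, the new pair is an `SU(3)`-structure. Hence the segment `n_s = (1 - s) ∂_t + s n`
gives the retraction: its `dt`-component `(1 - s) + s a` stays positive. For `ψ = dt ∧ ρ + τ` the
same shear keeps `τ` and replaces `ρ` by `a ρ + X ⌟ τ` (`cylForm4_shear`).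

That `n` yields an `SU(3)`-structure rests on the transitivity of `G₂` on the unit sphere of `ℝ⁷`
(`exists_stdG2_isometry`): there are coordinates in which `n` is the first basis vector and `V =
ℂ³`, and there `φ₀ = Re Ω + dt ∧ ω₀` and `ψ₀ = ω₀² / 2 - dt ∧ Im Ω`, with `Ω = dz₁ ∧ dz₂ ∧ dz₃`.
Transitivity and the normal form of an `SU(3)`-structure (`IsSU3.exists_frame`) both come from a
complex Gram–Schmidt process (`exists_unitary_frame`).

Conversely, the vector `(a, X)` with `a > 0` is determined by the condition that the new pair be an
`SU(3)`-structure, through an explicit formula (`normal_formula`, `normal_formula'`). The equation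
`ω ∧ ρ = 0`, or `(v ⌟ ρ) ∧ τ = 0` for 4-forms, is linear and gives `X / a`; the volume normalization
gives a power of `a`. This has three consequences. The vector depends smoothly on the pair of forms.
It is natural under linear isomorphisms, hence globally defined on `M`. It equals `∂_t` when the
pair already is an `SU(3)`-structure, so those pairs stay fixed.

Continuity for the `C^∞` topology holds for every smooth natural operator
(`IsNaturalOperator.continuous_form`). A map into the space of forms is continuous iff in each chart
all derivatives are jointly continuous in parameter and point (`continuous_smoothForm_iff`), and the
chain rule preserves this property (`JointlyContDiffOn.comp_contDiffAt`). -/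

/-! ### The wedge product -/

section WedgeBasics

variable {V W : Type*} [AddCommGroup V] [Module ℝ V] [AddCommGroup W] [Module ℝ W]

/-- The wedge product as a bilinear map. -/
noncomputable def wedgeBilin (V : Type*) [AddCommGroup V] [Module ℝ V] (p q : ℕ) :
    V [⋀^Fin p]→ₗ[ℝ] ℝ →ₗ[ℝ] V [⋀^Fin q]→ₗ[ℝ] ℝ →ₗ[ℝ] V [⋀^Fin (p + q)]→ₗ[ℝ] ℝ :=
  LinearMap.mk₂ ℝ wedge
    (fun a b c => by
      simp only [wedge, ← AlternatingMap.domCoprod'_apply, TensorProduct.add_tmul, map_add]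
      ext v; simp)
    (fun r a b => by
      simp only [wedge, ← AlternatingMap.domCoprod'_apply, ← TensorProduct.smul_tmul', map_smul]
      ext v; simp)
    (fun a b c => by
      simp only [wedge, ← AlternatingMap.domCoprod'_apply, TensorProduct.tmul_add, map_add]
      ext v; simp)
    (fun r a b => by
      simp only [wedge, ← AlternatingMap.domCoprod'_apply, TensorProduct.tmul_smul, map_smul]
      ext v; simp)

theorem wedgeBilin_apply {p q : ℕ} (α : V [⋀^Fin p]→ₗ[ℝ] ℝ) (β : V [⋀^Fin q]→ₗ[ℝ] ℝ) :
    wedgeBilin V p q α β = wedge α β := rfl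

theorem wedge_add_left {p q : ℕ} (α α' : V [⋀^Fin p]→ₗ[ℝ] ℝ) (β : V [⋀^Fin q]→ₗ[ℝ] ℝ) :
    wedge (α + α') β = wedge α β + wedge α' β := (wedgeBilin V p q).map_add₂ α α' β

theorem wedge_sub_left {p q : ℕ} (α α' : V [⋀^Fin p]→ₗ[ℝ] ℝ) (β : V [⋀^Fin q]→ₗ[ℝ] ℝ) :
    wedge (α - α') β = wedge α β - wedge α' β := (wedgeBilin V p q).map_sub₂ α α' β

theorem wedge_neg_left {p q : ℕ} (α : V [⋀^Fin p]→ₗ[ℝ] ℝ) (β : V [⋀^Fin q]→ₗ[ℝ] ℝ) :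
    wedge (-α) β = -wedge α β := (wedgeBilin V p q).map_neg₂ α β

theorem wedge_smul_left {p q : ℕ} (r : ℝ) (α : V [⋀^Fin p]→ₗ[ℝ] ℝ) (β : V [⋀^Fin q]→ₗ[ℝ] ℝ) :
    wedge (r • α) β = r • wedge α β := (wedgeBilin V p q).map_smul₂ r α β

theorem wedge_add_right {p q : ℕ} (α : V [⋀^Fin p]→ₗ[ℝ] ℝ) (β β' : V [⋀^Fin q]→ₗ[ℝ] ℝ) :
    wedge α (β + β') = wedge α β + wedge α β' := map_add (wedgeBilin V p q α) β β'

theorem wedge_sub_right {p q : ℕ} (α : V [⋀^Fin p]→ₗ[ℝ] ℝ) (β β' : V [⋀^Fin q]→ₗ[ℝ] ℝ) :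
    wedge α (β - β') = wedge α β - wedge α β' := map_sub (wedgeBilin V p q α) β β'

theorem wedge_smul_right {p q : ℕ} (r : ℝ) (α : V [⋀^Fin p]→ₗ[ℝ] ℝ) (β : V [⋀^Fin q]→ₗ[ℝ] ℝ) :
    wedge α (r • β) = r • wedge α β := map_smul (wedgeBilin V p q α) r β

theorem wedge_zero_left {p q : ℕ} (β : V [⋀^Fin q]→ₗ[ℝ] ℝ) :
    wedge (0 : V [⋀^Fin p]→ₗ[ℝ] ℝ) β = 0 := (wedgeBilin V p q).map_zero₂ β

theorem wedge_apply_eq_sum {p q : ℕ} (α : V [⋀^Fin p]→ₗ[ℝ] ℝ) (β : V [⋀^Fin q]→ₗ[ℝ] ℝ)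
    (v : Fin (p + q) → V) :
    wedge α β v = ∑ g : Equiv.Perm.ModSumCongr (Fin p) (Fin q),
      LinearMap.mul' ℝ ℝ (AlternatingMap.domCoprod.summand α β g (v ∘ finSumFinEquiv)) := by
  simp only [wedge, AlternatingMap.domDomCongr_apply, LinearMap.compAlternatingMap_apply,
    AlternatingMap.domCoprod_apply, sum_apply, map_sum]

theorem wedge_summand {p q : ℕ} (α : V [⋀^Fin p]→ₗ[ℝ] ℝ) (β : V [⋀^Fin q]→ₗ[ℝ] ℝ)
    (v : Fin p ⊕ Fin q → V) (g : Equiv.Perm (Fin p ⊕ Fin q)) :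
    LinearMap.mul' ℝ ℝ (AlternatingMap.domCoprod.summand α β (Quotient.mk'' g) v) =
      ((Equiv.Perm.sign g : ℤ) : ℝ) *
        (α (fun i => v (g (Sum.inl i))) * β (fun i => v (g (Sum.inr i)))) := by
  rw [AlternatingMap.domCoprod.summand_mk'']
  rw [smul_apply, Units.smul_def, map_zsmul, zsmul_eq_mul]
  rfl

theorem wedge_compLinearMap {p q : ℕ} (α : V [⋀^Fin p]→ₗ[ℝ] ℝ) (β : V [⋀^Fin q]→ₗ[ℝ] ℝ)
    (f : W →ₗ[ℝ] V) :
    wedge (α.compLinearMap f) (β.compLinearMap f) = (wedge α β).compLinearMap f := by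
  ext v
  rw [AlternatingMap.compLinearMap_apply, wedge_apply_eq_sum, wedge_apply_eq_sum]
  refine Finset.sum_congr rfl fun g _ => ?_
  induction g using Quotient.inductionOn' with | _ g
  rw [wedge_summand, wedge_summand]
  rfl

/-- The wedge product of a 1-form with a `k`-form. -/
theorem wedge_one_apply {k : ℕ} (α : V [⋀^Fin 1]→ₗ[ℝ] ℝ) (β : V [⋀^Fin k]→ₗ[ℝ] ℝ)
    (v : Fin (1 + k) → V) :
    wedge α β v = ∑ i : Fin (k + 1), (-1 : ℝ) ^ (i : ℕ) *
      (α (fun _ => v (Fin.cast (add_comm k 1) i)) *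
        β (fun j => v (Fin.cast (add_comm k 1) (i.succAbove j)))) := by
  rw [wedge_apply_eq_sum]
  let e : Fin 1 ⊕ Fin k ≃ Fin (k + 1) := finSumFinEquiv.trans (finCongr (add_comm 1 k))
  have he0 : e (Sum.inl 0) = 0 := by ext; simp [e]
  have he1 : ∀ j, e (Sum.inr j) = j.succ := fun j => by ext; simp [e]
  have hv : ∀ x, finSumFinEquiv x = Fin.cast (add_comm k 1) (e x) := fun x => by ext; simp [e]
  -- A coset of `S₁ × S_k` is determined by the image of the single left index. The representative
  -- used here is the cycle that brings position `i` to the front and keeps the other positions in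
  -- order; its sign is `(-1) ^ i`.
  let τ : Fin (k + 1) → Equiv.Perm (Fin 1 ⊕ Fin k) := fun i => e.symm.permCongr i.cycleRange.symm
  have hτ0 : ∀ i, e (τ i (Sum.inl 0)) = i := fun i => by simp [τ, he0]
  have hτ1 : ∀ i j, e (τ i (Sum.inr j)) = i.succAbove j := fun i j => by simp [τ, he1]
  have hbij : Function.Bijective
      (fun i => (Quotient.mk'' (τ i) : Equiv.Perm.ModSumCongr (Fin 1) (Fin k))) := by
    constructor
    · intro i j hij
      have h := QuotientGroup.leftRel_apply.mp (Quotient.exact' hij)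
      obtain ⟨⟨a, b⟩, h⟩ := h
      have h1 : τ j = τ i * Equiv.Perm.sumCongrHom _ _ (a, b) := by rw [h]; group
      rw [← hτ0 i, ← hτ0 j, h1]
      simp [Subsingleton.elim a 1]
    · intro g
      induction g using Quotient.inductionOn' with | _ g
      refine ⟨e (g (Sum.inl 0)), Quotient.sound' (QuotientGroup.leftRel_apply.mpr ?_)⟩
      refine Equiv.Perm.mem_sumCongrHom_range_of_perm_mapsTo_inl ?_
      rintro _ ⟨i, rfl⟩
      refine ⟨0, ?_⟩
      rw [Subsingleton.elim i 0, Equiv.Perm.mul_apply, eq_comm, Equiv.Perm.inv_eq_iff_eq]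
      exact e.injective (hτ0 _).symm
  refine (Fintype.sum_bijective _ hbij _ _ fun i => ?_).symm
  rw [wedge_summand]
  congr 1
  · simp [τ, Fin.sign_cycleRange]
  · congr 2
    · ext j
      rw [Function.comp_apply, hv, Subsingleton.elim j 0, hτ0]
    · ext j
      rw [Function.comp_apply, hv, hτ1]

theorem dx_apply {n k : ℕ} (i : Fin k → Fin n) (v : Fin k → Fin n → ℝ) :
    dx i v = Matrix.det (Matrix.of fun a b => v a (i b)) := rfl

/-- In this form `wedge_dx` follows from the compatibility of `domCoprod` with alternatization,
without a sum over shuffles. -/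
theorem dx_eq_alternatization {n k : ℕ} (i : Fin k → Fin n) :
    dx i = MultilinearMap.alternatization
      ((MultilinearMap.mkPiAlgebra ℝ (Fin k) ℝ).compLinearMap
        (fun a => (LinearMap.proj (i a) : (Fin n → ℝ) →ₗ[ℝ] ℝ))) := by
  ext v
  rw [dx_apply, Matrix.det_apply, MultilinearMap.alternatization_apply]
  rfl

theorem wedge_dx {n p q : ℕ} (i : Fin p → Fin n) (j : Fin q → Fin n) :
    wedge (dx i) (dx j) = dx (Fin.append i j) := by
  rw [wedge, dx_eq_alternatization i, dx_eq_alternatization j,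
    ← MultilinearMap.domCoprod_alternization, ← LinearMap.compMultilinearMap_alternatization,
    dx_eq_alternatization]
  ext v
  rw [AlternatingMap.domDomCongr_apply, MultilinearMap.alternatization_apply,
    MultilinearMap.alternatization_apply, ← (Equiv.permCongr finSumFinEquiv).sum_comp]
  refine Finset.sum_congr rfl fun g _ => ?_
  rw [Equiv.Perm.sign_permCongr]
  congr 1
  simp [MultilinearMap.domCoprod_apply, ← finSumFinEquiv.prod_comp]

theorem interior_dx_three {n : ℕ} (a b c : Fin n) (X : Fin n → ℝ) :
    (dx ![a, b, c]).curryLeft X = X a • dx ![b, c] - X b • dx ![a, c] + X c • dx ![a, b] := by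
  ext v
  simp [dx_apply, Matrix.det_fin_three, Matrix.det_fin_two]
  ring

theorem dx_three_apply {n : ℕ} (a b c : Fin n) (u v w : Fin n → ℝ) :
    dx ![a, b, c] ![u, v, w] = u a * (v b * w c - v c * w b) - u b * (v a * w c - v c * w a)
      + u c * (v a * w b - v b * w a) := by
  simp [dx_apply, Matrix.det_fin_three]
  ring

theorem dx_two_apply {n : ℕ} (a b : Fin n) (u v : Fin n → ℝ) :
    dx ![a, b] ![u, v] = u a * v b - u b * v a := by
  simp [dx_apply, Matrix.det_fin_two]

theorem dx_four_apply {n : ℕ} (a b c d : Fin n) (u v w z : Fin n → ℝ) :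
    dx ![a, b, c, d] ![u, v, w, z] =
      u a * dx ![b, c, d] ![v, w, z] - u b * dx ![a, c, d] ![v, w, z]
      + u c * dx ![a, b, d] ![v, w, z] - u d * dx ![a, b, c] ![v, w, z] := by
  simp [dx_apply, Matrix.det_succ_row_zero,
    Fin.sum_univ_succ, Fin.succAbove]
  ring

theorem interior_dx_four {n : ℕ} (a b c d : Fin n) (X : Fin n → ℝ) :
    (dx ![a, b, c, d]).curryLeft X =
      X a • dx ![b, c, d] - X b • dx ![a, c, d] + X c • dx ![a, b, d] - X d • dx ![a, b, c] := by
  ext v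
  obtain ⟨u, w, z, rfl⟩ : ∃ u w z, v = ![u, w, z] :=
    ⟨v 0, v 1, v 2, by ext i; fin_cases i <;> rfl⟩
  rw [AlternatingMap.curryLeft_apply_apply, dx_four_apply]
  simp

/-- The sign of a permutation of `Fin 6`, as a product over inversions; `0` for other maps. -/
def signSix (i : Fin 6 → Fin 6) : ℤ :=
  ∏ b, ∏ a ∈ Finset.univ.filter (· < b), Int.sign ((i b : ℤ) - i a)

theorem dx_eq_zero {n k : ℕ} (i : Fin k → Fin n) (h : ¬Function.Injective i) : dx i = 0 := by
  ext v
  simp only [Function.Injective, not_forall] at h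
  obtain ⟨a, b, hab, hne⟩ := h
  exact Matrix.det_zero_of_column_eq hne fun c => by simp [hab]

/-- A 6-form on `ℝ⁶` is determined by one number, and on monomials that number is an integer product
which `decide` evaluates. The identities for the standard `SU(3)`-structure are checked this way. -/
theorem dx_six_basis (i : Fin 6 → Fin 6) :
    dx i (fun a => Pi.single a 1) = (signSix i : ℝ) := by
  by_cases h : Function.Injective i
  · let g : Equiv.Perm (Fin 6) := Equiv.ofBijective i (Finite.injective_iff_bijective.mp h)
    have h1 : signSix i = Equiv.Perm.sign g := by
      rw [Equiv.Perm.sign_eq_prod_prod_Iio, signSix]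
      push_cast
      refine Finset.prod_congr rfl fun b _ => Finset.prod_congr ?_ fun a ha => ?_
      · ext; simp
      · have hne : i a ≠ i b := fun h' => (Finset.mem_Iio.mp ha).ne (h h')
        rcases lt_or_gt_of_ne hne with h' | h'
        · have : g a < g b := h'
          rw [if_pos this]
          exact Int.sign_eq_one_of_pos (by omega)
        · have : ¬ g a < g b := not_lt.mpr h'.le
          rw [if_neg this]
          exact Int.sign_eq_neg_one_of_neg (by omega)
    rw [h1, dx_apply, ← Matrix.det_permutation g, ← Matrix.det_transpose]
    congr 1
    ext a b
    simp [Equiv.toPEquiv_apply, PEquiv.toMatrix_apply, Pi.single_apply, g, eq_comm]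
  · rw [dx_eq_zero i h]
    simp only [Function.Injective, not_forall] at h
    obtain ⟨a, b, hab, hne⟩ := h
    wlog hlt : a < b generalizing a b
    · exact this b a hab.symm (Ne.symm hne) (lt_of_le_of_ne (not_lt.mp hlt) (Ne.symm hne))
    have : signSix i = 0 := Finset.prod_eq_zero (Finset.mem_univ b)
      (Finset.prod_eq_zero (Finset.mem_filter.mpr ⟨Finset.mem_univ a, hlt⟩) (by simp [hab]))
    simp [this]

/-- The value of a 6-form on `ℝ⁶` at the standard basis. -/
def stdTop : ((Fin 6 → ℝ) [⋀^Fin 6]→ₗ[ℝ] ℝ) →ₗ[ℝ] ℝ where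
  toFun α := α (fun a => Pi.single a 1)
  map_add' _ _ := rfl
  map_smul' _ _ := rfl

theorem stdTop_apply (α : (Fin 6 → ℝ) [⋀^Fin 6]→ₗ[ℝ] ℝ) :
    stdTop α = α (fun a => Pi.single a 1) := rfl

theorem stdTop_dx_one (i : Fin 6 → Fin 6) (h : signSix i = 1) : stdTop (dx i) = 1 := by
  rw [stdTop_apply, dx_six_basis, h, Int.cast_one]

theorem stdTop_dx_neg_one (i : Fin 6 → Fin 6) (h : signSix i = -1) : stdTop (dx i) = -1 := by
  rw [stdTop_apply, dx_six_basis, h]; simp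

end WedgeBasics

/-! ### The standard `SU(3)`-structure on `ℝ⁶` -/

section Standard

/-- The standard Kähler form `dx₁ ∧ dy₁ + dx₂ ∧ dy₂ + dx₃ ∧ dy₃` on `ℝ⁶ = ℂ³`. -/
noncomputable def stdKahlerForm : (Fin 6 → ℝ) [⋀^Fin 2]→ₗ[ℝ] ℝ :=
  dx ![0, 1] + dx ![2, 3] + dx ![4, 5]

/-- Half the square of the standard Kähler form. -/
noncomputable def stdKahlerSquare : (Fin 6 → ℝ) [⋀^Fin 4]→ₗ[ℝ] ℝ :=
  dx ![0, 1, 2, 3] + dx ![0, 1, 4, 5] + dx ![2, 3, 4, 5]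

/-- The imaginary part of `dz₁ ∧ dz₂ ∧ dz₃` on `ℝ⁶ = ℂ³`. -/
noncomputable def stdPositiveDual : (Fin 6 → ℝ) [⋀^Fin 3]→ₗ[ℝ] ℝ :=
  dx ![0, 2, 5] + dx ![0, 3, 4] + dx ![1, 2, 4] - dx ![1, 3, 5]

/-- The standard complex structure on `ℝ⁶ = ℂ³`. -/
noncomputable def stdComplex : (Fin 6 → ℝ) →ₗ[ℝ] (Fin 6 → ℝ) where
  toFun v := ![-v 1, v 0, -v 3, v 2, -v 5, v 4]
  map_add' u v := by ext i; fin_cases i <;> simp <;> ring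
  map_smul' r v := by ext i; fin_cases i <;> simp

theorem stdComplex_apply (v : Fin 6 → ℝ) :
    stdComplex v = ![-v 1, v 0, -v 3, v 2, -v 5, v 4] := rfl

theorem form_two_ext {V : Type*} [AddCommGroup V] [Module ℝ V] {α β : V [⋀^Fin 2]→ₗ[ℝ] ℝ}
    (h : ∀ u v, α ![u, v] = β ![u, v]) : α = β := by
  ext v
  rw [show v = ![v 0, v 1] by ext i; fin_cases i <;> rfl]
  exact h _ _

theorem form_three_ext {V : Type*} [AddCommGroup V] [Module ℝ V] {α β : V [⋀^Fin 3]→ₗ[ℝ] ℝ}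
    (h : ∀ u v w, α ![u, v, w] = β ![u, v, w]) : α = β := by
  ext v
  rw [show v = ![v 0, v 1, v 2] by ext i; fin_cases i <;> rfl]
  exact h _ _ _

theorem form_four_ext {V : Type*} [AddCommGroup V] [Module ℝ V] {α β : V [⋀^Fin 4]→ₗ[ℝ] ℝ}
    (h : ∀ u v w z, α ![u, v, w, z] = β ![u, v, w, z]) : α = β := by
  ext v
  rw [show v = ![v 0, v 1, v 2, v 3] by ext i; fin_cases i <;> rfl]
  exact h _ _ _ _

theorem form_six_ext {α β : (Fin 6 → ℝ) [⋀^Fin 6]→ₗ[ℝ] ℝ}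
    (h : stdTop α = stdTop β) : α = β := by
  rw [stdTop_apply, stdTop_apply] at h
  have hb : ⇑(Pi.basisFun ℝ (Fin 6)) = fun a => Pi.single a 1 := by ext; simp
  rw [AlternatingMap.eq_smul_basis_det (Pi.basisFun ℝ (Fin 6)) α,
    AlternatingMap.eq_smul_basis_det (Pi.basisFun ℝ (Fin 6)) β, hb, h]

/-- Each monomial of `Re Ω` contains one coordinate from every complex line, each monomial of the
Kähler form both coordinates of one line, so every product repeats an index. -/
theorem wedge_stdKahlerForm_stdPositiveForm : wedge stdKahlerForm stdPositiveForm = 0 := by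
  simp (decide := true) only [stdKahlerForm, stdPositiveForm, wedge_add_left, wedge_sub_right,
    wedge_dx, dx_eq_zero, sub_zero, add_zero]

theorem isHitchinDual_std : IsHitchinDual stdPositiveForm stdComplex stdPositiveDual where
  sq v := by ext i; fin_cases i <;> simp [stdComplex_apply]
  re u v w := by
    simp [stdPositiveForm, stdPositiveDual, dx_three_apply, stdComplex_apply]
    ring
  im u v w := by
    simp [stdPositiveForm, stdPositiveDual, dx_three_apply, stdComplex_apply]
    ring

theorem stdTop_wedge_stdPositiveForm_stdPositiveDual :
    stdTop (wedge stdPositiveForm stdPositiveDual) = 4 := by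
  simp (decide := true) only [stdPositiveDual, stdPositiveForm, wedge_sub_right,
    wedge_sub_left, wedge_add_right, map_add, map_sub, map_neg,
    wedge_dx, dx_eq_zero, sub_zero, zero_sub,
    stdTop_dx_neg_one]
  norm_num

theorem wedge_dx_two_two {n : ℕ} (i j k l : Fin n) :
    wedge (dx ![i, j]) (dx ![k, l]) = dx ![i, j, k, l] := by
  rw [wedge_dx]
  congr 1
  ext a
  fin_cases a <;> rfl

theorem dx_four_swap {n : ℕ} (i j k l : Fin n) : dx ![k, l, i, j] = dx ![i, j, k, l] := by
  refine form_four_ext fun u v w z => ?_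
  rw [dx_four_apply, dx_four_apply]
  simp only [dx_three_apply]
  ring

theorem wedge_stdKahlerForm_self :
    (1 / 2 : ℝ) • wedge stdKahlerForm stdKahlerForm = stdKahlerSquare := by
  simp only [stdKahlerForm, wedge_add_left, wedge_add_right, wedge_dx_two_two]
  rw [dx_four_swap 0 1 2 3, dx_four_swap 0 1 4 5, dx_four_swap 2 3 4 5,
    dx_eq_zero ![0, 1, 0, 1] (by decide), dx_eq_zero ![2, 3, 2, 3] (by decide),
    dx_eq_zero ![4, 5, 4, 5] (by decide), stdKahlerSquare]
  module

theorem stdTop_wedge_stdKahlerForm_cube :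
    stdTop (wedge (wedge stdKahlerForm stdKahlerForm) stdKahlerForm) = 6 := by
  simp (decide := true) only [stdKahlerForm, wedge_add_left, wedge_add_right, map_add, 
    wedge_dx, dx_eq_zero, add_zero, zero_add, stdTop_dx_one]
  norm_num

theorem interior_stdPositiveForm (v : Fin 6 → ℝ) :
    stdPositiveForm.curryLeft v = (v 0 • dx ![2, 4] - v 2 • dx ![0, 4] + v 4 • dx ![0, 2])
      - (v 0 • dx ![3, 5] - v 3 • dx ![0, 5] + v 5 • dx ![0, 3])
      - (v 1 • dx ![2, 5] - v 2 • dx ![1, 5] + v 5 • dx ![1, 2])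
      - (v 1 • dx ![3, 4] - v 3 • dx ![1, 4] + v 4 • dx ![1, 3]) := by
  rw [← interior_dx_three, ← interior_dx_three, ← interior_dx_three, ← interior_dx_three]
  ext; simp [stdPositiveForm]

/-- Hitchin's observation: under `Λ⁵ ≅ V ⊗ Λ⁶`, the map `v ↦ (v ⌟ ρ) ∧ ρ` is a multiple of the
complex structure, which is thereby recovered from `ρ` alone. -/
theorem stdTop_wedge_interior_stdPositiveForm (v : Fin 6 → ℝ) (k : Fin 6) :
    stdTop (wedge (wedge (stdPositiveForm.curryLeft v) stdPositiveForm) (dx ![k])) =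
      2 * stdComplex v k := by
  rw [interior_stdPositiveForm, stdPositiveForm, stdComplex_apply]
  simp (decide := true) only [wedge_add_left, wedge_sub_right, wedge_sub_left, wedge_smul_left,
    wedge_dx, dx_eq_zero, sub_zero, add_zero, zero_sub, zero_add, smul_zero,
    wedge_neg_left, map_sub, map_neg, map_smul]
  fin_cases k <;>
  · simp (decide := true) only [Fin.zero_eta, Fin.mk_one, Fin.reduceFinMk, dx_eq_zero, map_zero,
      smul_zero, sub_zero, zero_sub, stdTop_dx_one, stdTop_dx_neg_one]
    simp
    try ring

/-- A matter of type: `v ⌟ Re Ω` has type `(2,0) + (0,2)` and the square of the Kähler form type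
`(2,2)`. This linear condition replaces `ω ∧ ρ = 0` in the version with 4-forms. -/
theorem stdTop_wedge_interior_stdPositiveForm_stdKahlerSquare (v : Fin 6 → ℝ) :
    stdTop (wedge (stdPositiveForm.curryLeft v) stdKahlerSquare) = 0 := by
  rw [interior_stdPositiveForm, stdKahlerSquare]
  simp (decide := true) only [wedge_add_left, wedge_add_right, wedge_sub_left, wedge_smul_left,
    wedge_dx, dx_eq_zero, sub_zero, add_zero, smul_zero, map_zero]

/-- The contraction is `ω(v, w) ω - (v ⌟ ω) ∧ (w ⌟ ω)`; wedged with `ω² / 2` the two terms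
contribute `3 ω(v, w)` and `-ω(v, w)`. The point is that a nondegenerate form is obtained from `τ`
alone. -/
theorem stdTop_wedge_interior_stdKahlerSquare (v w : Fin 6 → ℝ) :
    stdTop (wedge ((stdKahlerSquare.curryLeft v).curryLeft w) stdKahlerSquare) =
      2 * stdKahlerForm ![v, w] := by
  have h : (stdKahlerSquare.curryLeft v).curryLeft w = 
      ((v 0 • (dx ![1, 2, 3]).curryLeft w - v 1 • (dx ![0, 2, 3]).curryLeft w + 
        v 2 • (dx ![0, 1, 3]).curryLeft w - v 3 • (dx ![0, 1, 2]).curryLeft w)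
      + (v 0 • (dx ![1, 4, 5]).curryLeft w - v 1 • (dx ![0, 4, 5]).curryLeft w +
        v 4 • (dx ![0, 1, 5]).curryLeft w - v 5 • (dx ![0, 1, 4]).curryLeft w))
      + (v 2 • (dx ![3, 4, 5]).curryLeft w - v 3 • (dx ![2, 4, 5]).curryLeft w +
        v 4 • (dx ![2, 3, 5]).curryLeft w - v 5 • (dx ![2, 3, 4]).curryLeft w) := by
    have h1 : stdKahlerSquare.curryLeft v = (dx ![0, 1, 2, 3]).curryLeft v
      + (dx ![0, 1, 4, 5]).curryLeft v + (dx ![2, 3, 4, 5]).curryLeft v := rfl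
    rw [h1, interior_dx_four, interior_dx_four, interior_dx_four]
    rfl
  rw [h, stdKahlerSquare, stdKahlerForm]
  simp (decide := true) only [interior_dx_three, wedge_add_left, wedge_add_right, wedge_sub_left,
    wedge_smul_left, wedge_dx, dx_eq_zero, sub_zero, add_zero, zero_add, smul_zero,
    stdTop_dx_one,
    map_add, map_sub, map_smul]
  simp [dx_two_apply]
  ring


/-- A 2-form as a bilinear map. -/
def formTwoLin {V : Type*} [AddCommGroup V] [Module ℝ V] :
    V [⋀^Fin 2]→ₗ[ℝ] ℝ →ₗ[ℝ] V →ₗ[ℝ] V →ₗ[ℝ] ℝ where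
  toFun α := LinearMap.mk₂ ℝ (fun u v => ((α.curryLeft u).curryLeft v) ![])
    (fun _ _ _ => by simp) (fun _ _ _ => by simp) (fun _ _ _ => by rw [map_add]; rfl)
    (fun _ _ _ => by rw [map_smul]; rfl)
  map_add' _ _ := rfl
  map_smul' _ _ := rfl

/-- A 3-form as a trilinear map. -/
def formThreeLin {V : Type*} [AddCommGroup V] [Module ℝ V] (ρ : V [⋀^Fin 3]→ₗ[ℝ] ℝ) :
    V →ₗ[ℝ] V →ₗ[ℝ] V →ₗ[ℝ] ℝ :=
  formTwoLin ∘ₗ ρ.curryLeft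

theorem formTwoLin_apply {V : Type*} [AddCommGroup V] [Module ℝ V] (α : V [⋀^Fin 2]→ₗ[ℝ] ℝ)
    (u v : V) : formTwoLin α u v = α ![u, v] := rfl

theorem formThreeLin_apply {V : Type*} [AddCommGroup V] [Module ℝ V] (ρ : V [⋀^Fin 3]→ₗ[ℝ] ℝ)
    (u v w : V) : formThreeLin ρ u v w = ρ ![u, v, w] := rfl

theorem form_two_swap {V : Type*} [AddCommGroup V] [Module ℝ V] (α : V [⋀^Fin 2]→ₗ[ℝ] ℝ)
    (u v : V) : α ![v, u] = -α ![u, v] := by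
  have h := α.map_swap ![u, v] (show (0 : Fin 2) ≠ 1 by decide)
  rw [← h]
  congr 1
  ext i
  fin_cases i <;> rfl

theorem form_two_self {V : Type*} [AddCommGroup V] [Module ℝ V] (α : V [⋀^Fin 2]→ₗ[ℝ] ℝ)
    (u : V) : α ![u, u] = 0 :=
  α.map_eq_zero_of_eq ![u, u] (show ![u, u] 0 = ![u, u] 1 from rfl) (by decide)

/-- A 2-form on `ℝ⁶` in coordinates. -/
theorem form_two_eq_sum (α : (Fin 6 → ℝ) [⋀^Fin 2]→ₗ[ℝ] ℝ) :
    α = (1 / 2 : ℝ) • ∑ i, ∑ j, α ![Pi.single i 1, Pi.single j 1] • dx ![i, j] := by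
  refine form_two_ext fun u v => ?_
  have hu : ∀ u : Fin 6 → ℝ, u = ∑ i, u i • Pi.single i (1 : ℝ) := fun u => by
    ext; simp [Pi.single_apply]
  have h : α ![u, v] = ∑ i, ∑ j, α ![Pi.single i 1, Pi.single j 1] * (u i * v j) := by
    rw [← formTwoLin_apply]
    conv_lhs => rw [hu u, hu v]
    simp only [map_sum, map_smul, LinearMap.sum_apply, LinearMap.smul_apply, formTwoLin_apply,
      smul_eq_mul, Finset.mul_sum]
    rw [Finset.sum_comm]
    refine Finset.sum_congr rfl fun i _ => Finset.sum_congr rfl fun j _ => by ring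
  -- The same expansion with the roles of `u` and `v` exchanged; adding the two produces the
  -- monomials `dx ![i, j]`, each pair counted twice, whence the factor `1 / 2`.
  have h' : α ![u, v] = -∑ i, ∑ j, α ![Pi.single i 1, Pi.single j 1] * (u j * v i) := by
    rw [h, Finset.sum_comm, ← Finset.sum_neg_distrib]
    refine Finset.sum_congr rfl fun i _ => ?_
    rw [← Finset.sum_neg_distrib]
    refine Finset.sum_congr rfl fun j _ => ?_
    rw [form_two_swap]
    ring
  have h2 : (∑ i, ∑ j, α ![Pi.single i 1, Pi.single j 1] • dx ![i, j] :
      (Fin 6 → ℝ) [⋀^Fin 2]→ₗ[ℝ] ℝ) ![u, v] = α ![u, v] + α ![u, v] := by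
    nth_rw 1 [h]
    rw [h', ← sub_eq_add_neg, ← Finset.sum_sub_distrib]
    rw [← formTwoLin_apply]
    simp only [map_sum, map_smul, LinearMap.sum_apply, LinearMap.smul_apply, formTwoLin_apply,
      dx_two_apply, ← Finset.sum_sub_distrib, smul_eq_mul, mul_sub]
  rw [AlternatingMap.smul_apply, h2, smul_eq_mul]
  ring

/-- Wedging with `Re Ω` is injective on forms of type `(2,0) + (0,2)`. The six coefficients of the
5-form `α ∧ Re Ω` are the six real components of that part of `α`, so their vanishing leaves a form
of type `(1,1)`. -/
theorem form_two_type_one_one {α : (Fin 6 → ℝ) [⋀^Fin 2]→ₗ[ℝ] ℝ}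
    (h : wedge α stdPositiveForm = 0) (u v : Fin 6 → ℝ) :
    α ![stdComplex u, stdComplex v] = α ![u, v] := by
  have h2 : ∀ k, stdTop (wedge (wedge α stdPositiveForm) (dx ![k])) = 0 := fun k => by
    rw [h, wedge_zero_left]; exact map_zero stdTop
  have hswap := fun i j => form_two_swap α (Pi.single i 1) (Pi.single j 1)
  have hself := fun i => form_two_self α (Pi.single i 1)
  have hα := form_two_eq_sum α
  generalize hA : (fun i j => α ![Pi.single i 1, Pi.single j 1]) = A at *
  have hA' : ∀ i j, α ![Pi.single i 1, Pi.single j 1] = A i j := fun i j => by rw [← hA]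
  simp only [hA', Fin.sum_univ_six] at hα hswap hself
  rw [hα] at h2 ⊢
  simp only [hself, hswap 0 1, hswap 0 2, hswap 0 3, hswap 0 4, hswap 0 5, 
    hswap 1 2, hswap 1 3, hswap 1 4, hswap 1 5, hswap 2 3, hswap 2 4, hswap 2 5, hswap 3 4, 
    hswap 3 5, hswap 4 5, zero_smul, zero_add, add_zero] at h2 ⊢
  simp (decide := true) only [stdPositiveForm, wedge_add_left, wedge_sub_right, wedge_smul_left,
    wedge_dx, dx_eq_zero, add_zero, zero_add, smul_zero,
    wedge_sub_left, map_add, map_sub, map_smul] at h2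
  have h0 := h2 0
  have h1 := h2 1
  have h22 := h2 2
  have h3 := h2 3
  have h4 := h2 4
  have h5 := h2 5
  simp (decide := true) only [dx_eq_zero, map_zero,
      stdTop_dx_one, stdTop_dx_neg_one, smul_eq_mul] at h0 h1 h22 h3 h4 h5
  have e0 : A 3 4 = -A 2 5 := by linarith
  have e1 : A 3 5 = A 2 4 := by linarith
  have e2 : A 1 4 = -A 0 5 := by linarith
  have e3 : A 1 5 = A 0 4 := by linarith
  have e4 : A 1 2 = -A 0 3 := by linarith
  have e5 : A 1 3 = A 0 2 := by linarith
  simp [dx_two_apply, stdComplex_apply, e0, e1, e2, e3, e4, e5]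
  ring

end Standard

/-! ### Unitary frames -/

section Frames

variable {V : Type*} [AddCommGroup V] [Module ℝ V]

theorem compLinearMap_two {W : Type*} [AddCommGroup W] [Module ℝ W] (α : V [⋀^Fin 2]→ₗ[ℝ] ℝ)
    (f : W →ₗ[ℝ] V) (u v : W) : α.compLinearMap f ![u, v] = α ![f u, f v] := by
  rw [AlternatingMap.compLinearMap_apply]
  congr 1
  ext i
  fin_cases i <;> rfl

theorem compLinearMap_three {W : Type*} [AddCommGroup W] [Module ℝ W] (α : V [⋀^Fin 3]→ₗ[ℝ] ℝ)
    (f : W →ₗ[ℝ] V) (u v w : W) : α.compLinearMap f ![u, v, w] = α ![f u, f v, f w] := by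
  rw [AlternatingMap.compLinearMap_apply]
  congr 1
  ext i
  fin_cases i <;> rfl

theorem compLinearMap_four {W : Type*} [AddCommGroup W] [Module ℝ W] (α : V [⋀^Fin 4]→ₗ[ℝ] ℝ)
    (f : W →ₗ[ℝ] V) (u v w z : W) :
    α.compLinearMap f ![u, v, w, z] = α ![f u, f v, f w, f z] := by
  rw [AlternatingMap.compLinearMap_apply]
  congr 1
  ext i
  fin_cases i <;> rfl

theorem stdKahlerForm_apply (u v : Fin 6 → ℝ) :
    stdKahlerForm ![u, v] = -∑ i, u i * stdComplex v i := by
  simp [Fin.sum_univ_six, stdComplex_apply, stdKahlerForm, dx_two_apply]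
  ring

theorem stdPositiveForm_complex (u v w : Fin 6 → ℝ) :
    stdPositiveForm ![stdComplex u, v, w] = stdPositiveForm ![u, stdComplex v, w] := by
  simp [stdPositiveForm, dx_three_apply, stdComplex_apply]
  ring

theorem form_three_swap_left (ρ : V [⋀^Fin 3]→ₗ[ℝ] ℝ) (u v w : V) :
    ρ ![v, u, w] = -ρ ![u, v, w] := by
  have h := ρ.map_swap ![u, v, w] (show (0 : Fin 3) ≠ 1 by decide)
  rw [← h]
  congr 1
  ext i
  fin_cases i <;> rfl

theorem form_three_swap_right (ρ : V [⋀^Fin 3]→ₗ[ℝ] ℝ) (u v w : V) :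
    ρ ![u, w, v] = -ρ ![u, v, w] := by
  have h := ρ.map_swap ![u, v, w] (show (1 : Fin 3) ≠ 2 by decide)
  rw [← h]
  congr 1
  ext i
  fin_cases i <;> rfl

theorem form_three_self_left (ρ : V [⋀^Fin 3]→ₗ[ℝ] ℝ) (u w : V) : ρ ![u, u, w] = 0 := by
  linarith [form_three_swap_left ρ u u w]

theorem form_three_self_right (ρ : V [⋀^Fin 3]→ₗ[ℝ] ℝ) (u w : V) : ρ ![w, u, u] = 0 := by
  linarith [form_three_swap_right ρ w u u]

theorem form_three_neg_right (ρ : V [⋀^Fin 3]→ₗ[ℝ] ℝ) (u v w : V) :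
    ρ ![u, v, -w] = -ρ ![u, v, w] := map_neg (formThreeLin ρ u v) w

theorem form_three_neg_mid (ρ : V [⋀^Fin 3]→ₗ[ℝ] ℝ) (u v w : V) :
    ρ ![u, -v, w] = -ρ ![u, v, w] := by
  rw [form_three_swap_right, form_three_neg_right, form_three_swap_right, neg_neg]

theorem form_three_rotate (ρ : V [⋀^Fin 3]→ₗ[ℝ] ℝ) (u v w : V) :
    ρ ![v, w, u] = ρ ![u, v, w] := by
  rw [form_three_swap_right, form_three_swap_left, neg_neg]

/-- A 3-form which is the real part of a complex trilinear form is determined by one value of the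
latter. -/
theorem form_three_eq_zero_of_complex (b : Module.Basis (Fin 6) ℝ V) (J : V →ₗ[ℝ] V)
    (hJ : ∀ v, J (J v) = -v) (h1 : b 1 = J (b 0)) (h3 : b 3 = J (b 2)) (h5 : b 5 = J (b 4))
    (D : V [⋀^Fin 3]→ₗ[ℝ] ℝ) (hD : ∀ u v w, D ![J u, v, w] = D ![u, J v, w])
    (h : D ![b 0, b 2, b 4] = 0) (h' : D ![b 0, b 2, b 5] = 0) : D = 0 := by
  have hD2 : ∀ u v w, D ![u, J v, w] = D ![u, v, J w] := fun u v w => by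
    rw [← form_three_rotate D u (J v) w, ← form_three_rotate D u v (J w), hD]
  have z1 : ∀ u w, D ![u, w, u] = 0 := fun u w => by
    rw [form_three_swap_right, form_three_self_left, neg_zero]
  -- `D (w, u, J u)` is unchanged when `J` moves to the other argument, but alternation changes its
  -- sign.
  have z2 : ∀ u w, D ![w, u, J u] = 0 := fun u w => by
    linarith [form_three_swap_right D w u (J u), hD2 w u u]
  have z3 : ∀ u w, D ![u, w, J u] = 0 := fun u w => by
    rw [form_three_swap_left, z2, neg_zero]
  rw [h5] at h'
  have p1 : ∀ w, D ![b 2, b 0, w] = - D ![b 0, b 2, w] := fun w => form_three_swap_left _ _ _ _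
  have p2 : D ![b 0, b 4, b 2] = 0 := by rw [form_three_swap_right, h, neg_zero]
  have p3 : D ![b 0, b 4, J (b 2)] = 0 := by rw [← hD2, form_three_swap_right, h', neg_zero]
  have p4 : ∀ w, D ![b 4, b 0, w] = - D ![b 0, b 4, w] := fun w => form_three_swap_left _ _ _ _
  have p5 : D ![b 2, b 4, b 0] = 0 := by rw [form_three_swap_right, p1, h, neg_zero, neg_zero]
  have p6 : D ![b 2, b 4, J (b 0)] = 0 := by
    rw [← hD2, form_three_swap_right, p1, h', neg_zero, neg_zero]
  have p7 : ∀ w, D ![b 4, b 2, w] = - D ![b 2, b 4, w] := fun w => form_three_swap_left _ _ _ _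
  have : formThreeLin D = 0 := by
    refine b.ext fun i => b.ext fun j => b.ext fun k => ?_
    rw [formThreeLin_apply]
    fin_cases i <;> fin_cases j <;> fin_cases k <;>
      simp [h1, h3, h5, hD, hD2, hJ, form_three_neg_right, form_three_neg_mid, z1, z2, z3, form_three_self_left, 
        form_three_self_right, h, h', p1, p2, p3, p4, p5, p6, p7]
  exact form_three_ext fun u v w => by rw [← formThreeLin_apply, this]; rfl

/-- One step of Gram–Schmidt: fewer linear conditions than dimensions leave a nonzero vector to
normalize. -/
theorem exists_unit_in_ker [FiniteDimensional ℝ V] (h : V →ₗ[ℝ] V →ₗ[ℝ] ℝ)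
    (hpos : ∀ v, v ≠ 0 → 0 < h v v) {m : ℕ} (L : V →ₗ[ℝ] (Fin m → ℝ))
    (hm : m < Module.finrank ℝ V) : ∃ e, L e = 0 ∧ h e e = 1 := by
  have hk := LinearMap.ker_ne_bot_of_finrank_lt (f := L) (by simpa using hm)
  obtain ⟨e, he, hne⟩ := Submodule.exists_mem_ne_zero_of_ne_bot hk
  refine ⟨(Real.sqrt (h e e))⁻¹ • e, by rw [map_smul, LinearMap.mem_ker.mp he, smul_zero], ?_⟩
  simp only [map_smul, LinearMap.smul_apply, smul_eq_mul]
  have := hpos e hne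
  rw [← mul_assoc, ← mul_inv, Real.mul_self_sqrt this.le, inv_mul_cancel₀ this.ne']

/-- A hermitian vector space of complex dimension 3 with a real part of a complex volume form has
a unitary frame in which the latter is a multiple of the standard one. -/
theorem exists_unitary_frame (hV : Module.finrank ℝ V = 6) (ρ : V [⋀^Fin 3]→ₗ[ℝ] ℝ)
    (η : V [⋀^Fin 2]→ₗ[ℝ] ℝ) (J : V →ₗ[ℝ] V) (hJ : ∀ v, J (J v) = -v)
    (hω : ∀ u v, η ![J u, J v] = η ![u, v]) (hpos : ∀ v, v ≠ 0 → 0 < η ![v, J v])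
    (hρ : ∀ u v w, ρ ![J u, v, w] = ρ ![u, J v, w]) :
    ∃ (f : V ≃ₗ[ℝ] (Fin 6 → ℝ)) (r : ℝ), 0 ≤ r ∧
      η = stdKahlerForm.compLinearMap (f : V →ₗ[ℝ] (Fin 6 → ℝ)) ∧
      ρ = r • stdPositiveForm.compLinearMap (f : V →ₗ[ℝ] (Fin 6 → ℝ)) ∧
      ∀ v, f (J v) = stdComplex (f v) := by
  have : FiniteDimensional ℝ V := FiniteDimensional.of_finrank_pos (by omega)
  -- The real part of the hermitian metric: symmetric and `J`-invariant because `η` has type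
  -- `(1,1)`. Each new vector is taken orthogonal to the previous ones and to their images under
  -- `J`.
  let h : V →ₗ[ℝ] V →ₗ[ℝ] ℝ := (formTwoLin η).compl₂ J
  have hh : ∀ u v, h u v = η ![u, J v] := fun _ _ => rfl
  have hωn : ∀ u v, η ![u, -v] = -η ![u, v] := fun u v => map_neg (formTwoLin η u) v
  have hsymm : ∀ u v, h v u = h u v := fun u v => by
    rw [hh, hh, ← hω, hJ, hωn, form_two_swap, neg_neg]
  have hJh : ∀ u v, h (J u) (J v) = h u v := fun u v => by rw [hh, hh, hω]
  have hJ' : ∀ u v, h u (J v) = -h (J u) v := fun u v => by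
    rw [hh, hh, hω, hJ, hωn]
  have hJself : ∀ u, h u (J u) = 0 := fun u => by
    linarith [hJ' u u, hsymm u (J u)]
  have hJself' : ∀ u, h (J u) u = 0 := fun u => by rw [hsymm, hJself]
  obtain ⟨e0, -, h00⟩ := exists_unit_in_ker h hpos (0 : V →ₗ[ℝ] (Fin 0 → ℝ)) (by omega)
  obtain ⟨e2, hL2, h22⟩ := exists_unit_in_ker h hpos
    (LinearMap.pi ![h e0, h (J e0)]) (by omega)
  have h02 : h e0 e2 = 0 := congrFun hL2 0
  have h12 : h (J e0) e2 = 0 := congrFun hL2 1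
  obtain ⟨e, hL4, hee⟩ := exists_unit_in_ker h hpos
    (LinearMap.pi ![h e0, h (J e0), h e2, h (J e2)]) (by omega)
  have h0e : h e0 e = 0 := congrFun hL4 0
  have h1e : h (J e0) e = 0 := congrFun hL4 1
  have h2e : h e2 e = 0 := congrFun hL4 2
  have h3e : h (J e2) e = 0 := congrFun hL4 3
  -- The phase of the third vector: with `p + i q` built from the values of `ρ` on `e` and `J e`,
  -- the unit complex number `x + i y` is `(p + i q) / |p + i q|`, and `e4 = x e + y J e` makes the
  -- value `r = |p + i q|` real and nonnegative. If `p = q = 0`, no rotation is needed and `r = 0`.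
  obtain ⟨x, y, r, hr, hxy, hx, hy⟩ : ∃ x y r : ℝ, 0 ≤ r ∧ x * x + y * y = 1 ∧
      x * ρ ![e0, e2, e] + y * ρ ![e0, e2, J e] = r ∧
      x * ρ ![e0, e2, J e] - y * ρ ![e0, e2, e] = 0 := by
    set p := ρ ![e0, e2, e]
    set q := ρ ![e0, e2, J e]
    by_cases h0 : p * p + q * q = 0
    · have hp : p = 0 := by nlinarith [mul_self_nonneg p, mul_self_nonneg q]
      have hq : q = 0 := by nlinarith [mul_self_nonneg p, mul_self_nonneg q]
      exact ⟨1, 0, 0, le_rfl, by norm_num, by simp [hp], by simp [hq]⟩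
    · have hs : 0 < p * p + q * q :=
        lt_of_le_of_ne (by nlinarith [mul_self_nonneg p, mul_self_nonneg q]) (Ne.symm h0)
      have hs' := Real.mul_self_sqrt hs.le
      have hne := (Real.sqrt_pos.mpr hs).ne'
      refine ⟨p / √(p * p + q * q), q / √(p * p + q * q), √(p * p + q * q), Real.sqrt_nonneg _,
        ?_, ?_, ?_⟩
      · rw [div_mul_div_comm, div_mul_div_comm, ← add_div, hs', div_self hs.ne']
      · rw [div_mul_eq_mul_div, div_mul_eq_mul_div, ← add_div, div_eq_iff hne, hs']
      · ring
  obtain ⟨e4, he4⟩ : ∃ e4, e4 = x • e + y • J e := ⟨_, rfl⟩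
  have hJe4 : J e4 = x • J e - y • e := by
    rw [he4, map_add, map_smul, map_smul, hJ, smul_neg, sub_eq_add_neg]
  have h0J : h e0 (J e) = 0 := by rw [hJ', h1e, neg_zero]
  have h2J : h e2 (J e) = 0 := by rw [hJ', h3e, neg_zero]
  have h1J : h (J e0) (J e) = 0 := by rw [hJh, h0e]
  have h3J : h (J e2) (J e) = 0 := by rw [hJh, h2e]
  have h04 : h e0 e4 = 0 := by simp [he4, h0e, h0J]
  have h24 : h e2 e4 = 0 := by simp [he4, h2e, h2J]
  have h14 : h (J e0) e4 = 0 := by simp [he4, h1e, h1J]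
  have h34 : h (J e2) e4 = 0 := by simp [he4, h3e, h3J]
  have h44 : h e4 e4 = 1 := by
    simp only [he4, map_add, map_smul, LinearMap.add_apply, LinearMap.smul_apply, smul_eq_mul, hee,
      hJself, hsymm e (J e), hJh]
    linarith
  let b' : Fin 6 → V := ![e0, J e0, e2, J e2, e4, J e4]
  have hb' : ∀ i j, h (b' i) (b' j) = if i = j then 1 else 0 := by
    have s1 := hsymm e0 e2
    have s2 := hsymm (J e0) e2
    have s3 := hsymm e0 e4
    have s4 := hsymm (J e0) e4
    have s5 := hsymm e2 e4
    have s6 := hsymm (J e2) e4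
    have s7 := hsymm e2 (J e0)
    intro i j
    fin_cases i <;> fin_cases j <;>
      simp [b', h00, h22, h44, h02, h12, h04, h24, h14, h34, hJh, hJself, hJself', hJ', s1, s3, s5,
        hsymm _ (J e2), hsymm _ (J e4)]
  have hli : LinearIndependent ℝ b' := by
    rw [Fintype.linearIndependent_iff]
    intro g hg i
    have := congrArg (h (b' i)) hg
    simpa [hb'] using this
  let b := basisOfLinearIndependentOfCardEqFinrank hli (by simp [hV])
  have hb : ⇑b = b' := coe_basisOfLinearIndependentOfCardEqFinrank hli _
  have hfJ : ∀ v, b.equivFun (J v) = stdComplex (b.equivFun v) := by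
    intro v
    suffices h : b.equivFun.toLinearMap ∘ₗ J = stdComplex ∘ₗ b.equivFun.toLinearMap from
      LinearMap.congr_fun h v
    refine b.ext fun i => ?_
    have hs : ∀ i, b.equivFun (b' i) = Pi.single i 1 := fun i => by
      rw [← hb]; ext j; simp [Pi.single_apply, eq_comm]
    have s0 : b.equivFun e0 = Pi.single 0 1 := hs 0
    have s1 : b.equivFun (J e0) = Pi.single 1 1 := hs 1
    have s2 : b.equivFun e2 = Pi.single 2 1 := hs 2
    have s3 : b.equivFun (J e2) = Pi.single 3 1 := hs 3
    have s4 : b.equivFun e4 = Pi.single 4 1 := hs 4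
    have s5 : b.equivFun (J e4) = Pi.single 5 1 := hs 5
    rw [LinearMap.comp_apply, LinearMap.comp_apply, hb, LinearEquiv.coe_coe, hs, stdComplex_apply]
    fin_cases i <;> simp only [b', Fin.zero_eta, Fin.mk_one, Fin.reduceFinMk, Matrix.cons_val,
      Matrix.cons_val_zero, Matrix.cons_val_one, hJ, map_neg, s0, s1, s2, s3, s4, s5] <;>
      (ext j; fin_cases j <;> simp)
  have hhf : ∀ u v, h u v = ∑ i, b.equivFun u i * b.equivFun v i := by
    intro u v
    conv_lhs => rw [← b.sum_equivFun u, ← b.sum_equivFun v]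
    simp [hb, hb', LinearMap.sum_apply]
    exact Finset.sum_congr rfl fun _ _ => mul_comm _ _
  refine ⟨b.equivFun, r, hr, form_two_ext fun u v => ?_, ?_, hfJ⟩
  · have : η ![u, v] = -h u (J v) := by rw [hh, hJ, hωn, neg_neg]
    rw [this, hhf, hfJ, compLinearMap_two]
    exact (stdKahlerForm_apply _ _).symm
  · have hs : ∀ i, b.equivFun (b i) = Pi.single i 1 := fun i => by
      ext j; simp [Pi.single_apply, eq_comm]
    have t1 : ρ ![e0, e2, e4] = r := by
      rw [← hx, he4, ← formThreeLin_apply, map_add, map_smul, map_smul]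
      rfl
    have t2 : ρ ![e0, e2, J e4] = 0 := by
      rw [← hy, hJe4, ← formThreeLin_apply, map_sub, map_smul, map_smul]
      rfl
    have h0 : b 0 = e0 := by rw [hb]; rfl
    have h2 : b 2 = e2 := by rw [hb]; rfl
    have h4 : b 4 = e4 := by rw [hb]; rfl
    have h5 : b 5 = J e4 := by rw [hb]; rfl
    have hcomp : ∀ u v w, (r • stdPositiveForm.compLinearMap (b.equivFun : V →ₗ[ℝ] (Fin 6 → ℝ)))
        ![u, v, w] = r * stdPositiveForm ![b.equivFun u, b.equivFun v, b.equivFun w] := by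
      intro u v w
      rw [AlternatingMap.smul_apply, compLinearMap_three, smul_eq_mul]
      rfl
    refine sub_eq_zero.mp (form_three_eq_zero_of_complex b J hJ (by rw [hb]; rfl)
      (by rw [hb]; rfl) (by rw [hb]; rfl) _ (fun u v w => ?_) ?_ ?_)
    · rw [AlternatingMap.sub_apply, AlternatingMap.sub_apply, hcomp, hcomp, hfJ, hfJ,
        stdPositiveForm_complex, hρ]
    · rw [AlternatingMap.sub_apply, hcomp, hs, hs, hs, h0, h2, h4, t1]
      simp [stdPositiveForm, dx_three_apply]
    · rw [AlternatingMap.sub_apply, hcomp, hs, hs, hs, h0, h2, h5, t2]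
      simp [stdPositiveForm, dx_three_apply]

/-- A linear map with respect to which `stdPositiveForm` is symmetric is multiplication by a complex
number. -/
theorem exists_eq_smul_add_smul_stdComplex (M : (Fin 6 → ℝ) →ₗ[ℝ] (Fin 6 → ℝ))
    (h : ∀ u v w, stdPositiveForm ![M u, v, w] = stdPositiveForm ![u, M v, w]) :
    ∃ a b : ℝ, ∀ v, M v = a • v + b • stdComplex v := by
  have H := fun i j k : Fin 6 => h (Pi.single i 1) (Pi.single j 1) (Pi.single k 1)
  -- A subset of the basis equations that suffices. Those with a repeated index say `ρ (M e_i, e_i,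
  -- ·) = 0`, so `M e_i` lies in the complex line of `e_i`; the others force the same complex factor
  -- on all lines.
  have H0 := fun k => H 0 0 k
  have H1 := fun k => H 1 1 k
  have H2 := fun k => H 2 2 k
  have H3 := fun k => H 3 3 k
  have H4 := fun k => H 4 4 k
  have H5 := fun k => H 5 5 k
  have G1 := H 0 2 4
  have G2 := H 0 2 5
  have G3 := H 0 3 4
  have G4 := H 1 2 4
  have G5 := H 0 3 5
  have G6 := H 1 2 5
  have K1 := H 2 4 0
  have K2 := H 2 4 1
  have K3 := H 2 5 0
  have K5 := H 2 5 1
  simp [stdPositiveForm, dx_three_apply, Fin.forall_fin_succ, Pi.single_apply]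
    at H0 H1 H2 H3 H4 H5 G1 G2 G3 G4 G5 G6 K1 K2 K3 K5
  obtain ⟨a, ha⟩ : ∃ a, a = M (Pi.single 0 1) 0 := ⟨_, rfl⟩
  obtain ⟨b, hb⟩ : ∃ b, b = M (Pi.single 0 1) 1 := ⟨_, rfl⟩
  refine ⟨a, b, fun v => ?_⟩
  suffices h : M = a • LinearMap.id + b • stdComplex by rw [h]; rfl
  refine (Pi.basisFun ℝ (Fin 6)).ext fun i => ?_
  ext j
  simp only [Pi.basisFun_apply, LinearMap.add_apply, LinearMap.smul_apply, LinearMap.id_apply,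
    stdComplex_apply, Pi.add_apply, Pi.smul_apply, smul_eq_mul]
  clear h H
  fin_cases i <;> fin_cases j <;> simp <;> linarith

/-- The only complex numbers with square `-1` are `± i`. This is the uniqueness of `J` up to sign
for a positive form. -/
theorem eq_stdComplex_or_neg (M : (Fin 6 → ℝ) →ₗ[ℝ] (Fin 6 → ℝ)) (hM : ∀ v, M (M v) = -v)
    (h : ∀ u v w, stdPositiveForm ![M u, v, w] = stdPositiveForm ![u, M v, w]) :
    M = stdComplex ∨ M = -stdComplex := by
  obtain ⟨a, b, hMab⟩ := exists_eq_smul_add_smul_stdComplex M h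
  have h0 : stdComplex (Pi.single 0 1) = Pi.single 1 1 := by
    ext i; fin_cases i <;> simp [stdComplex_apply]
  have h1 := hM (Pi.single 0 1)
  rw [hMab, hMab, map_add, map_smul, map_smul, isHitchinDual_std.sq, h0] at h1
  have e0 := congrFun h1 0
  have e1 := congrFun h1 1
  simp only [Pi.add_apply, Pi.smul_apply, Pi.neg_apply, Pi.single_eq_same, smul_eq_mul,
    Pi.single_eq_of_ne (show (0 : Fin 6) ≠ 1 by decide),
    Pi.single_eq_of_ne (show (1 : Fin 6) ≠ 0 by decide)] at e0 e1
  have ha0 : a = 0 := by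
    rcases mul_eq_zero.mp (show a * b = 0 by linarith) with h | h
    · exact h
    · rw [h] at e0
      nlinarith [mul_self_nonneg a]
  rw [ha0] at e0
  rcases mul_eq_zero.mp (show (b - 1) * (b + 1) = 0 by linarith) with h | h
  · left
    refine LinearMap.ext fun v => ?_
    rw [hMab, ha0, sub_eq_zero.mp h, zero_smul, zero_add, one_smul]
  · right
    refine LinearMap.ext fun v => ?_
    rw [hMab, ha0, eq_neg_of_add_eq_zero_left h, zero_smul, zero_add, neg_smul, one_smul]
    rfl

theorem volume_stdKahlerForm :
    (1 / 6 : ℝ) • wedge (wedge stdKahlerForm stdKahlerForm) stdKahlerForm =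
      (1 / 4 : ℝ) • wedge stdPositiveForm stdPositiveDual := by
  refine form_six_ext ?_
  have h1 := stdTop_wedge_stdKahlerForm_cube
  have h2 := stdTop_wedge_stdPositiveForm_stdPositiveDual
  rw [map_smul, map_smul]
  refine (congrArg _ h1).trans (Eq.trans ?_ (congrArg _ h2).symm)
  norm_num

theorem compLinearMap_comp_symm {W : Type*} [AddCommGroup W] [Module ℝ W] {k : ℕ}
    (α : W [⋀^Fin k]→ₗ[ℝ] ℝ) (f : V ≃ₗ[ℝ] W) :
    (α.compLinearMap (f : V →ₗ[ℝ] W)).compLinearMap (f.symm : W →ₗ[ℝ] V) = α := by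
  ext v
  simp

theorem smul_eq_smul_of_compLinearMap {W : Type*} [AddCommGroup W] [Module ℝ W] {a b : ℝ}
    {α β : W [⋀^Fin 6]→ₗ[ℝ] ℝ} {α' β' : V [⋀^Fin 6]→ₗ[ℝ] ℝ} (f : V →ₗ[ℝ] W)
    (hα : α' = α.compLinearMap f) (hβ : β' = β.compLinearMap f) (h : a • α = b • β) :
    a • α' = b • β' := by
  rw [hα, hβ]
  exact congrArg (fun α => AlternatingMap.compLinearMap α f) h

theorem mul_stdTop_eq_of_smul_eq_smul {a b : ℝ} {α β : (Fin 6 → ℝ) [⋀^Fin 6]→ₗ[ℝ] ℝ}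
    {α' β' : V [⋀^Fin 6]→ₗ[ℝ] ℝ} (f : V ≃ₗ[ℝ] (Fin 6 → ℝ))
    (hα : α' = α.compLinearMap (f : V →ₗ[ℝ] (Fin 6 → ℝ)))
    (hβ : β' = β.compLinearMap (f : V →ₗ[ℝ] (Fin 6 → ℝ))) (h : a • α' = b • β') :
    a * stdTop α = b * stdTop β := by
  have h2 : ∀ α : (Fin 6 → ℝ) [⋀^Fin 6]→ₗ[ℝ] ℝ,
      (α.compLinearMap (f : V →ₗ[ℝ] (Fin 6 → ℝ))) (fun i => f.symm (Pi.single i 1)) = stdTop α :=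
    fun α => by simp [stdTop_apply]
  rw [← h2, ← h2, ← hα, ← hβ]
  exact DFunLike.congr_fun h _

theorem wedge_cube_compLinearMap {W : Type*} [AddCommGroup W] [Module ℝ W]
    {η : W [⋀^Fin 2]→ₗ[ℝ] ℝ} {ω' : V [⋀^Fin 2]→ₗ[ℝ] ℝ} {f : V →ₗ[ℝ] W}
    (h : ω' = η.compLinearMap f) :
    wedge (wedge ω' ω') ω' = (wedge (wedge η η) η).compLinearMap f := by
  rw [h, wedge_compLinearMap, wedge_compLinearMap]

theorem wedge_eq_compLinearMap {W : Type*} [AddCommGroup W] [Module ℝ W] {p q : ℕ}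
    {α : W [⋀^Fin p]→ₗ[ℝ] ℝ} {β : W [⋀^Fin q]→ₗ[ℝ] ℝ} {α' : V [⋀^Fin p]→ₗ[ℝ] ℝ}
    {β' : V [⋀^Fin q]→ₗ[ℝ] ℝ} {f : V →ₗ[ℝ] W}
    (hα : α' = α.compLinearMap f) (hβ : β' = β.compLinearMap f) :
    wedge α' β' = (wedge α β).compLinearMap f := by
  rw [hα, hβ, wedge_compLinearMap]

theorem isSU3_of_frame {ρ : V [⋀^Fin 3]→ₗ[ℝ] ℝ} {η : V [⋀^Fin 2]→ₗ[ℝ] ℝ}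
    (f : V ≃ₗ[ℝ] (Fin 6 → ℝ))
    (hρ : ρ = stdPositiveForm.compLinearMap (f : V →ₗ[ℝ] (Fin 6 → ℝ)))
    (hω : η = stdKahlerForm.compLinearMap (f : V →ₗ[ℝ] (Fin 6 → ℝ))) : IsSU3 ρ η := by
  obtain ⟨ρ', hρ'⟩ : ∃ ρ', ρ' = stdPositiveDual.compLinearMap (f : V →ₗ[ℝ] (Fin 6 → ℝ)) := ⟨_, rfl⟩
  have hpos : ∀ v, v ≠ 0 → 0 < η ![v, f.symm (stdComplex (f v))] := by
    intro v hv
    rw [hω, compLinearMap_two, stdKahlerForm_apply]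
    simp only [LinearEquiv.coe_coe, LinearEquiv.apply_symm_apply, isHitchinDual_std.sq, Pi.neg_apply,
      mul_neg, Finset.sum_neg_distrib, neg_neg]
    obtain ⟨i, hi⟩ := Function.ne_iff.mp ((map_ne_zero_iff f f.injective).mpr hv)
    exact Finset.sum_pos' (fun _ _ => mul_self_nonneg _)
      ⟨i, Finset.mem_univ _, mul_self_pos.mpr hi⟩
  refine ⟨fun u hu => ?_, ⟨f, hρ⟩, ?_, f.symm.toLinearMap ∘ₗ stdComplex ∘ₗ f.toLinearMap,
    ρ', ⟨fun v => ?_, fun u v w => ?_, fun u v w => ?_⟩, ?_, hpos⟩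
  -- Nondegeneracy follows from positivity: pair `u` with `J u`.
  · by_contra h
    exact (hpos u h).ne' (hu _)
  · rw [hω, hρ, wedge_compLinearMap, wedge_stdKahlerForm_stdPositiveForm]
    rfl
  · simp [isHitchinDual_std.sq]
  · rw [hρ, hρ']
    simp only [compLinearMap_three, LinearMap.comp_apply, LinearEquiv.coe_coe,
      LinearEquiv.apply_symm_apply, isHitchinDual_std.re]
  · rw [hρ, hρ']
    simp only [compLinearMap_three, LinearMap.comp_apply, LinearEquiv.coe_coe,
      LinearEquiv.apply_symm_apply, isHitchinDual_std.im]
  · have h1 := wedge_cube_compLinearMap hω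
    have h2 := wedge_eq_compLinearMap hρ hρ'
    exact smul_eq_smul_of_compLinearMap _ h1 h2 volume_stdKahlerForm

/-- An `SU(3)`-structure is the standard one in suitable coordinates. -/
theorem IsSU3.exists_frame {ρ : V [⋀^Fin 3]→ₗ[ℝ] ℝ} {η : V [⋀^Fin 2]→ₗ[ℝ] ℝ} (h : IsSU3 ρ η) :
    ∃ f : V ≃ₗ[ℝ] (Fin 6 → ℝ), ρ = stdPositiveForm.compLinearMap (f : V →ₗ[ℝ] (Fin 6 → ℝ)) ∧
      η = stdKahlerForm.compLinearMap (f : V →ₗ[ℝ] (Fin 6 → ℝ)) := by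
  obtain ⟨-, ⟨g, hg⟩, hw, J, ρ', hJ, hvol, hpos⟩ := h
  have hV : Module.finrank ℝ V = 6 := by rw [g.finrank_eq]; simp
  have hρ : ∀ u v w, ρ ![J u, v, w] = ρ ![u, J v, w] := fun u v w => by
    rw [hJ.re, form_three_swap_left _ (J v), hJ.re, form_three_swap_left _ u, neg_neg]
  -- In coordinates where `ρ` is standard, `J` is plus or minus the standard structure. The `(1,1)`
  -- condition given by `ω ∧ ρ = 0` does not see the sign.
  have hω : ∀ u v, η ![J u, J v] = η ![u, v] := by
    have key := eq_stdComplex_or_neg (g.toLinearMap ∘ₗ J ∘ₗ g.symm.toLinearMap)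
      (fun v => by simp [hJ.sq]) (fun u v w => by
        have := hρ (g.symm u) (g.symm v) (g.symm w)
        rw [hg] at this
        simp only [compLinearMap_three, LinearEquiv.coe_coe, LinearEquiv.apply_symm_apply] at this
        simpa using this)
    have hw' : wedge (η.compLinearMap (g.symm : (Fin 6 → ℝ) →ₗ[ℝ] V)) stdPositiveForm = 0 := by
      have := congrArg (fun α => AlternatingMap.compLinearMap α (g.symm : (Fin 6 → ℝ) →ₗ[ℝ] V)) hw
      rwa [← wedge_compLinearMap, hg, compLinearMap_comp_symm] at this
    have h1 := form_two_type_one_one hw'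
    have h2 : ∀ u v, η ![g.symm (stdComplex (g u)), g.symm (stdComplex (g v))] = η ![u, v] := by
      intro u v
      have := h1 (g u) (g v)
      simpa only [compLinearMap_two, LinearEquiv.coe_coe, LinearEquiv.symm_apply_apply] using this
    intro u v
    rcases key with key | key
    · have hJu : ∀ u, J u = g.symm (stdComplex (g u)) := fun u => by rw [← key]; simp
      rw [hJu, hJu, h2]
    · have hJu : ∀ u, J u = -g.symm (stdComplex (g u)) := fun u => by
        rw [← map_neg, ← LinearMap.neg_apply, ← key]; simp
      rw [hJu, hJu, ← formTwoLin_apply, map_neg, map_neg, LinearMap.neg_apply, neg_neg,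
        formTwoLin_apply, h2]
  obtain ⟨f, r, hr, hωf, hρf, hfJ⟩ := exists_unitary_frame hV ρ η J hJ.sq hω hpos hρ
  have hρ' : ρ' = r • stdPositiveDual.compLinearMap (f : V →ₗ[ℝ] (Fin 6 → ℝ)) := by
    refine form_three_ext fun u v w => ?_
    have := hJ.re u v w
    rw [hρf, AlternatingMap.smul_apply, compLinearMap_three] at this
    rw [AlternatingMap.smul_apply, compLinearMap_three, ← neg_eq_iff_eq_neg.mpr this]
    simp only [LinearEquiv.coe_coe, hfJ, isHitchinDual_std.re]
    simp
  -- In the unitary frame both `ρ` and its dual are `r` times the standard forms, so `ω³ / 6 = ρ ∧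
  -- ρ' / 4` reads `1 = r²`.
  have hr2 : r * r = 1 := by
    have k1 := wedge_cube_compLinearMap hωf
    have e1 : ρ = (r • stdPositiveForm).compLinearMap (f : V →ₗ[ℝ] (Fin 6 → ℝ)) := hρf
    have e2 : ρ' = (r • stdPositiveDual).compLinearMap (f : V →ₗ[ℝ] (Fin 6 → ℝ)) := hρ'
    have k2 := wedge_eq_compLinearMap e1 e2
    have h := mul_stdTop_eq_of_smul_eq_smul f k1 k2 hvol
    have h5 : stdTop (wedge (r • stdPositiveForm) (r • stdPositiveDual)) = r * (r * 4) := by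
      rw [wedge_smul_left, wedge_smul_right, map_smul, map_smul,
        stdTop_wedge_stdPositiveForm_stdPositiveDual]
      rfl
    generalize stdTop (wedge (r • stdPositiveForm) (r • stdPositiveDual)) = y at h h5
    have h1 := stdTop_wedge_stdKahlerForm_cube
    generalize stdTop (wedge (wedge stdKahlerForm stdKahlerForm) stdKahlerForm) = x at h h1
    subst h1 h5
    linarith
  have hr1 : r = 1 := by nlinarith
  exact ⟨f, by rw [hρf, hr1, one_smul], hωf⟩

end Frames

/-! ### The cross product of `ℝ⁷` -/

section CrossProduct

theorem stdG2Form3_apply (u v w : Fin 7 → ℝ) : stdG2Form3 ![u, v, w] =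
    dx ![0, 1, 2] ![u, v, w] + dx ![0, 3, 4] ![u, v, w] + dx ![0, 5, 6] ![u, v, w]
      + dx ![1, 3, 5] ![u, v, w] - dx ![1, 4, 6] ![u, v, w] - dx ![2, 3, 6] ![u, v, w]
      - dx ![2, 4, 5] ![u, v, w] := rfl

theorem stdG2Form4_apply (u v w z : Fin 7 → ℝ) : stdG2Form4 ![u, v, w, z] =
    dx ![3, 4, 5, 6] ![u, v, w, z] + dx ![1, 2, 5, 6] ![u, v, w, z]
      + dx ![1, 2, 3, 4] ![u, v, w, z] + dx ![0, 2, 4, 6] ![u, v, w, z]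
      - dx ![0, 2, 3, 5] ![u, v, w, z] - dx ![0, 1, 4, 5] ![u, v, w, z]
      - dx ![0, 1, 3, 6] ![u, v, w, z] := rfl

theorem stdCross_eq (u v : Fin 7 → ℝ) : stdCross u v =
    ![u 1 * v 2 - u 2 * v 1 + (u 3 * v 4 - u 4 * v 3) + (u 5 * v 6 - u 6 * v 5),
      u 2 * v 0 - u 0 * v 2 + (u 3 * v 5 - u 5 * v 3) - (u 4 * v 6 - u 6 * v 4),
      u 0 * v 1 - u 1 * v 0 - (u 3 * v 6 - u 6 * v 3) - (u 4 * v 5 - u 5 * v 4),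
      u 4 * v 0 - u 0 * v 4 + (u 5 * v 1 - u 1 * v 5) - (u 6 * v 2 - u 2 * v 6),
      u 0 * v 3 - u 3 * v 0 - (u 6 * v 1 - u 1 * v 6) - (u 5 * v 2 - u 2 * v 5),
      u 6 * v 0 - u 0 * v 6 + (u 1 * v 3 - u 3 * v 1) - (u 2 * v 4 - u 4 * v 2),
      u 0 * v 5 - u 5 * v 0 - (u 1 * v 4 - u 4 * v 1) - (u 2 * v 3 - u 3 * v 2)] := by
  ext i
  rw [stdCross, stdG2Form3_apply]
  fin_cases i <;> simp [dx_three_apply] <;> ring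

theorem dotProduct_seven (u v : Fin 7 → ℝ) : u ⬝ᵥ v = u 0 * v 0 + u 1 * v 1 + u 2 * v 2 + u 3 * v 3
    + u 4 * v 4 + u 5 * v 5 + u 6 * v 6 := by
  simp [dotProduct, Fin.sum_univ_seven]

theorem stdCross_dotProduct (u v w : Fin 7 → ℝ) :
    stdCross u v ⬝ᵥ w = stdG2Form3 ![u, v, w] := by
  rw [dotProduct_seven, stdCross_eq, stdG2Form3_apply]
  simp only [dx_three_apply, Matrix.cons_val]
  ring

theorem stdCross_stdCross (u v : Fin 7 → ℝ) :
    stdCross u (stdCross u v) = -(u ⬝ᵥ u) • v + (u ⬝ᵥ v) • u := by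
  rw [dotProduct_seven, dotProduct_seven, stdCross_eq, stdCross_eq]
  ext i
  fin_cases i <;> simp [Matrix.cons_val] <;> ring

theorem stdCross_dotProduct_self (u v : Fin 7 → ℝ) :
    stdCross u v ⬝ᵥ stdCross u v = (u ⬝ᵥ u) * (v ⬝ᵥ v) - (u ⬝ᵥ v) ^ 2 := by
  simp only [dotProduct_seven, stdCross_eq, Matrix.cons_val]
  ring

/-- The right side vanishes for `u`, `v`, `w` orthogonal to `n`. Hence on the orthogonal complement
of a unit vector `n` the form is the real part of a trilinear form complex for `n × ·`, as
`exists_unitary_frame` requires. -/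
theorem stdG2Form3_stdCross (n u v w : Fin 7 → ℝ) :
    stdG2Form3 ![stdCross n u, v, w] - stdG2Form3 ![u, stdCross n v, w] =
      -2 * (u ⬝ᵥ v) * (n ⬝ᵥ w) + (u ⬝ᵥ n) * (v ⬝ᵥ w) + (v ⬝ᵥ n) * (u ⬝ᵥ w) := by
  simp only [stdG2Form3_apply, dx_three_apply, dotProduct_seven, stdCross_eq, Matrix.cons_val]
  ring

/-- With `ψ₀` expressed by metric and cross product, isometries preserving `φ₀` preserve `ψ₀` as
well (`stdG2Form4_eq_of_isometry`). -/
theorem stdG2Form4_eq_stdCross (u v w z : Fin 7 → ℝ) : stdG2Form4 ![u, v, w, z] =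
    stdCross u v ⬝ᵥ stdCross w z - (u ⬝ᵥ w) * (v ⬝ᵥ z) + (u ⬝ᵥ z) * (v ⬝ᵥ w) := by
  simp only [stdG2Form4_apply, dx_four_apply, dx_three_apply, dotProduct_seven, stdCross_eq,
    Matrix.cons_val]
  ring

/-- The isomorphism of `ℝ × ℝ⁶` with `ℝ⁷`. -/
def consSeven : (ℝ × (Fin 6 → ℝ)) ≃ₗ[ℝ] (Fin 7 → ℝ) := Fin.consLinearEquiv ℝ (fun _ => ℝ)

theorem consSeven_apply (p : ℝ × (Fin 6 → ℝ)) :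
    consSeven p = ![p.1, p.2 0, p.2 1, p.2 2, p.2 3, p.2 4, p.2 5] := by
  ext i; fin_cases i <;> rfl

theorem stdG2Form3_consSeven (p q r : ℝ × (Fin 6 → ℝ)) :
    stdG2Form3 ![consSeven p, consSeven q, consSeven r] =
      stdPositiveForm ![p.2, q.2, r.2] + p.1 * stdKahlerForm ![q.2, r.2]
        - q.1 * stdKahlerForm ![p.2, r.2] + r.1 * stdKahlerForm ![p.2, q.2] := by
  simp only [consSeven_apply, stdG2Form3_apply, stdPositiveForm, stdKahlerForm,
    AlternatingMap.add_apply, AlternatingMap.sub_apply, dx_three_apply, dx_two_apply,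
    Matrix.cons_val]
  ring

/-- The 3-form that appears here is `-Im Ω`, not `Re Ω`. In the version with 4-forms this is
corrected by a rotation of the first complex coordinate (`rotateFirst`). -/
theorem stdG2Form4_consSeven (p q r s : ℝ × (Fin 6 → ℝ)) :
    stdG2Form4 ![consSeven p, consSeven q, consSeven r, consSeven s] =
      stdKahlerSquare ![p.2, q.2, r.2, s.2] - (p.1 * stdPositiveDual ![q.2, r.2, s.2]
        - q.1 * stdPositiveDual ![p.2, r.2, s.2] + r.1 * stdPositiveDual ![p.2, q.2, s.2]
        - s.1 * stdPositiveDual ![p.2, q.2, r.2]) := by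
  simp only [consSeven_apply, stdG2Form4_apply, stdPositiveDual, stdKahlerSquare,
    AlternatingMap.add_apply, AlternatingMap.sub_apply, dx_four_apply, dx_three_apply,
    Matrix.cons_val]
  ring

end CrossProduct

/-! ### Evaluation of the cylinder forms on `ℝ × V` -/

section Cylinder

variable {V : Type*} [AddCommGroup V] [Module ℝ V]

theorem dt_apply (p : ℝ × V) : dt (fun _ : Fin 1 => p) = p.1 := rfl

theorem cylForm3_apply (ρ : V [⋀^Fin 3]→ₗ[ℝ] ℝ) (η : V [⋀^Fin 2]→ₗ[ℝ] ℝ) (p q r : ℝ × V) :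
    cylForm3 ρ η ![p, q, r] =
      ρ ![p.2, q.2, r.2] + p.1 * η ![q.2, r.2] - q.1 * η ![p.2, r.2] + r.1 * η ![p.2, q.2] := by
  have h : wedge dt (cylPullback η) ![p, q, r] = ∑ i : Fin 3, (-1 : ℝ) ^ (i : ℕ) *
      (![p, q, r] i).1 * ![η ![q.2, r.2], η ![p.2, r.2], η ![p.2, q.2]] i := by
    refine (wedge_one_apply _ _ _).trans (Finset.sum_congr rfl fun i _ => ?_)
    rw [mul_assoc]
    congr 1
    fin_cases i <;>
    · rw [dt_apply]
      congr 1
      rw [cylPullback, AlternatingMap.compLinearMap_apply]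
      congr 1
      ext j
      fin_cases j <;> rfl
  rw [cylForm3, AlternatingMap.add_apply, cylPullback, compLinearMap_three]
  refine (congrArg _ h).trans ?_
  rw [Fin.sum_univ_three]
  simp
  ring

theorem cylForm4_apply (ρ : V [⋀^Fin 3]→ₗ[ℝ] ℝ) (τ : V [⋀^Fin 4]→ₗ[ℝ] ℝ) (p q r s : ℝ × V) :
    cylForm4 ρ τ ![p, q, r, s] = τ ![p.2, q.2, r.2, s.2] +
      (p.1 * ρ ![q.2, r.2, s.2] - q.1 * ρ ![p.2, r.2, s.2] + r.1 * ρ ![p.2, q.2, s.2]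
        - s.1 * ρ ![p.2, q.2, r.2]) := by
  have h : wedge dt (cylPullback ρ) ![p, q, r, s] = ∑ i : Fin 4, (-1 : ℝ) ^ (i : ℕ) *
      (![p, q, r, s] i).1 * ![ρ ![q.2, r.2, s.2], ρ ![p.2, r.2, s.2], ρ ![p.2, q.2, s.2],
        ρ ![p.2, q.2, r.2]] i := by
    refine (wedge_one_apply _ _ _).trans (Finset.sum_congr rfl fun i _ => ?_)
    rw [mul_assoc]
    congr 1
    fin_cases i <;>
    · rw [dt_apply]
      congr 1
      rw [cylPullback, AlternatingMap.compLinearMap_apply]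
      congr 1
      ext j
      fin_cases j <;> rfl
  rw [cylForm4, AlternatingMap.add_apply]
  have h2 : cylPullback τ ![p, q, r, s] = τ ![p.2, q.2, r.2, s.2] := compLinearMap_four _ _ _ _ _ _
  refine (congrArg₂ (· + ·) h h2).trans ?_
  rw [Fin.sum_univ_four]
  simp
  ring

end Cylinder

/-! ### Transitivity of `G₂` on the unit sphere -/

section Transitivity

/-- `stdCross` as a bilinear map. -/
def stdCrossLin : (Fin 7 → ℝ) →ₗ[ℝ] (Fin 7 → ℝ) →ₗ[ℝ] (Fin 7 → ℝ) :=
  LinearMap.mk₂ ℝ stdCross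
    (fun u u' v => by
      simp only [stdCross_eq]; ext i; fin_cases i <;> simp <;> ring)
    (fun r u v => by
      simp only [stdCross_eq]; ext i; fin_cases i <;> simp <;> ring)
    (fun u v v' => by
      simp only [stdCross_eq]; ext i; fin_cases i <;> simp <;> ring)
    (fun r u v => by
      simp only [stdCross_eq]; ext i; fin_cases i <;> simp <;> ring)

theorem dotProduct_stdCross_left (u v : Fin 7 → ℝ) : u ⬝ᵥ stdCross u v = 0 := by
  rw [dotProduct_comm, stdCross_dotProduct, form_three_swap_right, form_three_self_left, neg_zero]

/-- The group `G₂` acts transitively on the unit sphere of `ℝ⁷`. -/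
theorem exists_stdG2_isometry (n : Fin 7 → ℝ) (hn : n ⬝ᵥ n = 1) :
    ∃ G : (Fin 7 → ℝ) ≃ₗ[ℝ] (Fin 7 → ℝ), G n = consSeven (1, 0) ∧
      (∀ u v, G u ⬝ᵥ G v = u ⬝ᵥ v) ∧
      ∀ u v w, stdG2Form3 ![G u, G v, G w] = stdG2Form3 ![u, v, w] := by
  let ℓ : (Fin 7 → ℝ) →ₗ[ℝ] ℝ := dotProductBilin ℝ ℝ n
  have hℓ : ∀ v, ℓ v = n ⬝ᵥ v := fun v => rfl
  let V := LinearMap.ker ℓ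
  have hmem : ∀ v : V, n ⬝ᵥ (v : Fin 7 → ℝ) = 0 := fun v => v.2
  have hmem' : ∀ v : V, (v : Fin 7 → ℝ) ⬝ᵥ n = 0 := fun v => by rw [dotProduct_comm, hmem]
  have hV : Module.finrank ℝ V = 6 := by
    have h1 := LinearMap.finrank_range_add_finrank_ker ℓ
    have h2 : LinearMap.range ℓ = ⊤ := LinearMap.range_eq_top.mpr fun r => ⟨r • n, by
      rw [map_smul, hℓ, hn, smul_eq_mul, mul_one]⟩
    rw [h2, finrank_top, Module.finrank_self, Module.finrank_fin_fun] at h1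
    change Module.finrank ℝ (LinearMap.ker ℓ) = 6
    omega
  -- On the orthogonal complement `V` of `n`, the cross product with `n` is a complex structure, `n
  -- ⌟ φ₀` is its Kähler form for the Euclidean metric, and `φ₀` restricts to the real part of a
  -- complex volume form.
  let J : V →ₗ[ℝ] V := (stdCrossLin n).restrict fun v _ => dotProduct_stdCross_left n v
  have hJ : ∀ v : V, (J v : Fin 7 → ℝ) = stdCross n v := fun v => rfl
  let η : V [⋀^Fin 2]→ₗ[ℝ] ℝ := (stdG2Form3.curryLeft n).compLinearMap V.subtype
  have hω : ∀ u v : V, η ![u, v] = stdG2Form3 ![n, u, v] := fun u v => compLinearMap_two _ _ _ _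
  let ρ : V [⋀^Fin 3]→ₗ[ℝ] ℝ := stdG2Form3.compLinearMap V.subtype
  have hρ : ∀ u v w : V, ρ ![u, v, w] = stdG2Form3 ![(u : Fin 7 → ℝ), v, w] :=
    fun u v w => compLinearMap_three _ _ _ _ _
  have hJJ : ∀ v, J (J v) = -v := fun v => Subtype.ext <| by
    rw [hJ, hJ, stdCross_stdCross, hn, hmem]
    simp
  have hωJ : ∀ u v, η ![u, J v] = (u : Fin 7 → ℝ) ⬝ᵥ v := fun u v => by
    rw [hω, hJ, form_three_swap_right, ← stdCross_dotProduct, stdCross_stdCross, hn, hmem]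
    simp [dotProduct_comm]
  have hωn : ∀ u v, η ![u, -v] = -η ![u, v] := fun u v => map_neg (formTwoLin η u) v
  obtain ⟨f, r, hr, hωf, hρf, hfJ⟩ := exists_unitary_frame hV ρ η J hJJ
    (fun u v => by
      rw [hωJ, hJ, stdCross_dotProduct, hω])
    (fun v hv => by
      rw [hωJ]
      have hne : (v : Fin 7 → ℝ) ⬝ᵥ v ≠ 0 := fun h =>
        hv (Subtype.ext (dotProduct_self_eq_zero.mp h))
      exact lt_of_le_of_ne (Finset.sum_nonneg fun i _ => mul_self_nonneg _) hne.symm)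
    (fun u v w => by
      have := stdG2Form3_stdCross n u v w
      rw [hmem, hmem', hmem'] at this
      rw [hρ, hρ, hJ, hJ]
      linarith)
  have hdot : ∀ u v : V, f u ⬝ᵥ f v = (u : Fin 7 → ℝ) ⬝ᵥ v := fun u v => by
    rw [← hωJ, hωf, compLinearMap_two, stdKahlerForm_apply]
    simp only [LinearEquiv.coe_coe, hfJ, isHitchinDual_std.sq]
    simp [dotProduct]
  have hdot' : ∀ i j, (f.symm (Pi.single i 1) : Fin 7 → ℝ) ⬝ᵥ f.symm (Pi.single j 1) =
      (Pi.single i 1 : Fin 6 → ℝ) ⬝ᵥ Pi.single j 1 := fun i j => by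
    rw [← hdot, LinearEquiv.apply_symm_apply, LinearEquiv.apply_symm_apply]
  -- The vectors `u`, `v`, `w` correspond to the real basis of `ℂ³`. Since `ω(u, v) = 0`, the
  -- product `u × v` lies in `V`, and its pairing with `x` is `r` times that of `w`. As `|u × v| =
  -- 1`, this gives `r² = 1`.
  have hr1 : r = 1 := by
    let u := f.symm (Pi.single 0 1)
    let v := f.symm (Pi.single 2 1)
    let w := f.symm (Pi.single 4 1)
    have hc : n ⬝ᵥ stdCross u v = 0 := by
      rw [dotProduct_comm, stdCross_dotProduct, ← form_three_rotate, ← form_three_rotate, ← hω, hωf,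
        compLinearMap_two]
      simp [u, v, stdKahlerForm, dx_two_apply]
    let c : V := ⟨stdCross u v, hc⟩
    have hcx : ∀ x : V, (c : Fin 7 → ℝ) ⬝ᵥ x = r * ((w : Fin 7 → ℝ) ⬝ᵥ x) := fun x => by
      rw [← hdot w x, stdCross_dotProduct, ← hρ, hρf, AlternatingMap.smul_apply, compLinearMap_three]
      simp [u, v, w, stdPositiveForm, dx_three_apply]
    have h1 : (c : Fin 7 → ℝ) ⬝ᵥ c = 1 := by
      rw [stdCross_dotProduct_self, hdot', hdot', hdot']
      simp
    rw [hcx, dotProduct_comm, hcx, hdot'] at h1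
    simp at h1
    nlinarith
  let P : (Fin 7 → ℝ) →ₗ[ℝ] V := (LinearMap.id - ℓ.smulRight n).codRestrict V fun v => by
    change ℓ (v - ℓ v • n) = 0
    rw [map_sub, map_smul, hℓ n, hn, smul_eq_mul, mul_one, sub_self]
  have hP : ∀ v, v = ℓ v • n + (P v : Fin 7 → ℝ) := fun v => by
    change v = ℓ v • n + (v - ℓ v • n)
    abel
  -- The orthogonal sum of `n ↦ e₀` and the unitary frame on `V`.
  let G₀ : (Fin 7 → ℝ) →ₗ[ℝ] (Fin 7 → ℝ) := consSeven.toLinearMap ∘ₗ ℓ.prod (f.toLinearMap ∘ₗ P)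
  have hG₀ : ∀ v, G₀ v = consSeven (ℓ v, f (P v)) := fun v => rfl
  have hiso : ∀ u v, G₀ u ⬝ᵥ G₀ v = u ⬝ᵥ v := fun u v => by
    have h1 : ∀ p q, consSeven p ⬝ᵥ consSeven q = p.1 * q.1 + p.2 ⬝ᵥ q.2 := fun p q => by
      rw [dotProduct_seven]
      simp [consSeven_apply, dotProduct, Fin.sum_univ_six]
      ring
    rw [hG₀, hG₀, h1, hdot]
    conv_rhs => rw [hP u, hP v]
    simp only [add_dotProduct, dotProduct_add, smul_dotProduct, dotProduct_smul, hn, hmem, hmem',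
      smul_eq_mul]
    ring
  have hinj : Function.Injective G₀ := (injective_iff_map_eq_zero G₀).mpr fun v hv => by
    rw [← dotProduct_self_eq_zero, ← hiso, hv, zero_dotProduct]
  refine ⟨LinearEquiv.ofInjectiveEndo G₀ hinj, ?_, hiso, fun u v w => ?_⟩
  · have h1 : ℓ n = 1 := hn
    have h2 : P n = 0 := Subtype.ext (by change n - ℓ n • n = 0; rw [h1, one_smul, sub_self])
    change G₀ n = _
    rw [hG₀, h1, h2, map_zero]
  · change stdG2Form3 ![G₀ u, G₀ v, G₀ w] = _
    have hω' : ∀ u v : V, stdG2Form3 ![n, u, v] = stdKahlerForm ![f u, f v] := fun u v => by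
      rw [← hω, hωf, compLinearMap_two]; rfl
    have hρ' : ∀ u v w : V, stdG2Form3 ![(u : Fin 7 → ℝ), v, w] =
        stdPositiveForm ![f u, f v, f w] := fun u v w => by
      rw [← hρ, hρf, hr1, one_smul, compLinearMap_three]; rfl
    rw [hG₀, hG₀, hG₀, stdG2Form3_consSeven, ← hω', ← hω', ← hω', ← hρ']
    conv_rhs => rw [hP u, hP v, hP w]
    simp only [← formThreeLin_apply, map_add, map_smul, LinearMap.add_apply, LinearMap.smul_apply,
      smul_eq_mul]
    have z : ∀ x, stdG2Form3 ![n, x, n] = 0 := fun x => by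
      rw [form_three_swap_right, form_three_self_left, neg_zero]
    simp only [formThreeLin_apply, form_three_self_left, z,
      form_three_swap_left _ n (P u : Fin 7 → ℝ), form_three_rotate _ n (P u : Fin 7 → ℝ)]
    ring

/-- The cross product is determined by the metric and the 3-form: the difference of the two sides is
orthogonal to every `G w`. -/
theorem stdCross_eq_of_isometry (G : (Fin 7 → ℝ) ≃ₗ[ℝ] (Fin 7 → ℝ))
    (h : ∀ u v, G u ⬝ᵥ G v = u ⬝ᵥ v)
    (h3 : ∀ u v w, stdG2Form3 ![G u, G v, G w] = stdG2Form3 ![u, v, w]) (u v : Fin 7 → ℝ) :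
    stdCross (G u) (G v) = G (stdCross u v) := by
  rw [← sub_eq_zero, ← dotProduct_self_eq_zero]
  obtain ⟨w, hw⟩ := G.surjective (stdCross (G u) (G v) - G (stdCross u v))
  nth_rw 2 [← hw]
  rw [sub_dotProduct, stdCross_dotProduct, h, stdCross_dotProduct, h3, sub_self]

theorem stdG2Form4_eq_of_isometry (G : (Fin 7 → ℝ) ≃ₗ[ℝ] (Fin 7 → ℝ))
    (h : ∀ u v, G u ⬝ᵥ G v = u ⬝ᵥ v)
    (h3 : ∀ u v w, stdG2Form3 ![G u, G v, G w] = stdG2Form3 ![u, v, w]) (u v w z : Fin 7 → ℝ) :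
    stdG2Form4 ![G u, G v, G w, G z] = stdG2Form4 ![u, v, w, z] := by
  simp only [stdG2Form4_eq_stdCross, stdCross_eq_of_isometry G h h3, h]

end Transitivity

/-! ### Coordinates adapted to a hyperplane -/

section Adapted

variable {V : Type*} [AddCommGroup V] [Module ℝ V]

/-- Coordinates adapted to a hyperplane of a 7-dimensional space with a `G₂`-structure: there is a
unit normal vector `n`, and coordinates in which the structure is the standard one and `n` is the
first basis vector. -/
theorem exists_adapted_coordinates (f : (ℝ × V) ≃ₗ[ℝ] (Fin 7 → ℝ)) :
    ∃ (n : ℝ × V) (g : V ≃ₗ[ℝ] (Fin 6 → ℝ)) (F : (ℝ × V) ≃ₗ[ℝ] (Fin 7 → ℝ)),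
      0 < n.1 ∧ f n ⬝ᵥ f n = 1 ∧ (∀ v, f n ⬝ᵥ f (0, v) = 0) ∧
      F n = consSeven (1, 0) ∧ (∀ v, F (0, v) = consSeven (0, g v)) ∧
      (∀ u v w, stdG2Form3 ![F u, F v, F w] = stdG2Form3 ![f u, f v, f w]) ∧
      (∀ u v w z, stdG2Form4 ![F u, F v, F w, F z] = stdG2Form4 ![f u, f v, f w, f z]) := by
  let ℓ : (Fin 7 → ℝ) →ₗ[ℝ] ℝ := LinearMap.fst ℝ ℝ V ∘ₗ f.symm.toLinearMap
  -- The Euclidean gradient of the coordinate `t`, read in the coordinates `f`. It is orthogonal to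
  -- the image of `{0} × V`, and `c / |c|` has `t`-component `|c| > 0`, which fixes the sign of the
  -- normal.
  let c : Fin 7 → ℝ := fun i => ℓ (Pi.single i 1)
  have hc : ∀ v, c ⬝ᵥ v = ℓ v := fun v => by
    have hv : v = ∑ i, v i • Pi.single i (1 : ℝ) := by
      ext; simp [Pi.single_apply]
    conv_rhs => rw [hv]
    simp only [map_sum, map_smul, smul_eq_mul, dotProduct, c]
    exact Finset.sum_congr rfl fun i _ => mul_comm _ _
  have hc0 : c ⬝ᵥ c ≠ 0 := fun h => by
    rw [dotProduct_self_eq_zero] at h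
    have : ℓ (f (1, 0)) = 1 := by simp [ℓ]
    rw [← hc, h, zero_dotProduct] at this
    exact zero_ne_one this
  have hcpos : 0 < c ⬝ᵥ c :=
    lt_of_le_of_ne (Finset.sum_nonneg fun i _ => mul_self_nonneg _) hc0.symm
  have hs := Real.mul_self_sqrt hcpos.le
  have hspos := Real.sqrt_pos.mpr hcpos
  set s := √(c ⬝ᵥ c)
  let n : ℝ × V := f.symm (s⁻¹ • c)
  have hfn : f n = s⁻¹ • c := f.apply_symm_apply _
  have hn1 : n.1 = s := by
    change ℓ (s⁻¹ • c) = s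
    rw [map_smul, ← hc, ← hs, smul_eq_mul, ← mul_assoc, inv_mul_cancel₀ hspos.ne', one_mul]
  have hnn : f n ⬝ᵥ f n = 1 := by
    rw [hfn, smul_dotProduct, dotProduct_smul, ← hs, smul_eq_mul, smul_eq_mul]
    field_simp
  have hnv : ∀ v, f n ⬝ᵥ f (0, v) = 0 := fun v => by
    rw [hfn, smul_dotProduct, hc]
    simp [ℓ]
  obtain ⟨G, hGn, hG, hG3⟩ := exists_stdG2_isometry (f n) hnn
  have hGv : ∀ v, G (f (0, v)) = consSeven (0, (consSeven.symm (G (f (0, v)))).2) := fun v => by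
    have h1 : (consSeven.symm (G (f (0, v)))).1 = 0 := by
      have h2 := hG (f n) (f (0, v))
      rw [hnv, hGn, ← consSeven.apply_symm_apply (G (f (0, v)))] at h2
      generalize consSeven.symm (G (f (0, v))) = p at *
      rw [dotProduct_seven] at h2
      simpa [consSeven_apply] using h2
    have h3 : (0, (consSeven.symm (G (f (0, v)))).2) = consSeven.symm (G (f (0, v))) :=
      Prod.ext h1.symm rfl
    rw [h3, LinearEquiv.apply_symm_apply]
  let g₀ : V →ₗ[ℝ] (Fin 6 → ℝ) := LinearMap.snd ℝ ℝ _ ∘ₗ consSeven.symm.toLinearMap ∘ₗ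
    G.toLinearMap ∘ₗ f.toLinearMap ∘ₗ LinearMap.inr ℝ ℝ V
  have hg₀ : ∀ v, g₀ v = (consSeven.symm (G (f (0, v)))).2 := fun v => rfl
  have hinj : Function.Injective g₀ := (injective_iff_map_eq_zero g₀).mpr fun v hv => by
    have h1 := hGv v
    rw [← hg₀, hv] at h1
    have h2 : consSeven ((0, 0) : ℝ × (Fin 6 → ℝ)) = 0 := map_zero consSeven
    rw [h2, map_eq_zero_iff G G.injective, map_eq_zero_iff f f.injective] at h1
    exact congrArg Prod.snd h1
  have : FiniteDimensional ℝ (ℝ × V) := FiniteDimensional.of_injective f.toLinearMap f.injective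
  have : FiniteDimensional ℝ V :=
    FiniteDimensional.of_injective (LinearMap.inr ℝ ℝ V) LinearMap.inr_injective
  have hdim : Module.finrank ℝ V = Module.finrank ℝ (Fin 6 → ℝ) := by
    have := f.finrank_eq
    rw [Module.finrank_prod, Module.finrank_self, Module.finrank_fin_fun] at this
    rw [Module.finrank_fin_fun]
    omega
  refine ⟨n, LinearEquiv.ofInjectiveOfFinrankEq g₀ hinj hdim, f.trans G, hn1 ▸ hspos, hnn, hnv, hGn, hGv,
    fun u v w => hG3 _ _ _, fun u v w z => stdG2Form4_eq_of_isometry G hG hG3 _ _ _ _⟩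

end Adapted

/-! ### Shears, inclusion of `SU(3)`-structures, and the induced `SU(3)`-structure -/

section Pointwise

variable {V : Type*} [AddCommGroup V] [Module ℝ V]

theorem curryLeft_three_apply (ρ : V [⋀^Fin 3]→ₗ[ℝ] ℝ) (x u v : V) :
    ρ.curryLeft x ![u, v] = ρ ![x, u, v] := rfl

theorem curryLeft_four_apply (τ : V [⋀^Fin 4]→ₗ[ℝ] ℝ) (x u v w : V) :
    τ.curryLeft x ![u, v, w] = τ ![x, u, v, w] := rfl

/-- The shear `(t, v) ↦ (t a, t X + v)` of `ℝ × V`. -/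
def shear (a : ℝ) (X : V) : (ℝ × V) →ₗ[ℝ] (ℝ × V) where
  toFun p := (p.1 * a, p.1 • X + p.2)
  map_add' p q := by ext <;> simp [add_mul, add_smul]; abel
  map_smul' r p := by ext <;> simp [mul_assoc, mul_smul]

theorem shear_apply (a : ℝ) (X : V) (p : ℝ × V) : shear a X p = (p.1 * a, p.1 • X + p.2) := rfl

/-- A shear with `a ≠ 0` is invertible. -/
noncomputable def shearEquiv (a : ℝ) (ha : a ≠ 0) (X : V) : (ℝ × V) ≃ₗ[ℝ] (ℝ × V) :=
  LinearEquiv.ofLinearMap (shear a X) (shear a⁻¹ (-(a⁻¹ • X)))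
    (LinearMap.ext fun p => by
      simp only [LinearMap.comp_apply, shear_apply, LinearMap.id_apply]
      ext
      · field_simp
      · simp [mul_smul])
    (LinearMap.ext fun p => by
      simp only [LinearMap.comp_apply, shear_apply, LinearMap.id_apply]
      ext
      · field_simp
      · simp [smul_smul, ha])

theorem form_three_smul_add (ρ : V [⋀^Fin 3]→ₗ[ℝ] ℝ) (a b c : ℝ) (x u v w : V) :
    ρ ![a • x + u, b • x + v, c • x + w] =
      ρ ![u, v, w] + a * ρ ![x, v, w] - b * ρ ![x, u, w] + c * ρ ![x, u, v] := by
  have h : ∀ u v w, ρ ![u, v, w] = formThreeLin ρ u v w := fun u v w => (formThreeLin_apply ..).symm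
  have e1 : ρ ![x, x, w] = 0 := form_three_self_left ..
  have e2 : ρ ![x, x, v] = 0 := form_three_self_left ..
  have e3 : ρ ![x, x, x] = 0 := form_three_self_left ..
  have e4 : ρ ![u, x, x] = 0 := form_three_self_right ..
  have e5 : ρ ![x, v, x] = 0 := by rw [form_three_swap_right, e2, neg_zero]
  have e6 : ρ ![u, x, w] = -ρ ![x, u, w] := form_three_swap_left ..
  have e7 : ρ ![u, v, x] = ρ ![x, u, v] := form_three_rotate ..
  rw [h] at e1 e2 e3 e4 e5 e6 e7
  simp only [h] at *
  simp only [map_add, map_smul, LinearMap.add_apply, LinearMap.smul_apply, smul_eq_mul, e1, e3,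
    e4, e5, e6, e7]
  ring

theorem form_four_smul_add (τ : V [⋀^Fin 4]→ₗ[ℝ] ℝ) (a b c d : ℝ) (x u v w z : V) :
    τ ![a • x + u, b • x + v, c • x + w, d • x + z] =
      τ ![u, v, w, z] + a * τ ![x, v, w, z] - b * τ ![x, u, w, z] + c * τ ![x, u, v, z]
        - d * τ ![x, u, v, w] := by
  have h0 : ∀ v w, τ ![x, x, v, w] = 0 := fun v w =>
    τ.map_eq_zero_of_eq _ (i := 0) (j := 1) rfl (by decide)
  have h1 : ∀ v w, τ ![u, x, v, w] = -τ ![x, u, v, w] := fun v w => by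
    have h := τ.map_swap ![x, u, v, w] (show (0 : Fin 4) ≠ 1 by decide)
    rw [← h]
    congr 1
    ext i
    fin_cases i <;> rfl
  rw [← curryLeft_four_apply, map_add, map_smul, AlternatingMap.add_apply,
    AlternatingMap.smul_apply, form_three_smul_add, form_three_smul_add]
  simp only [curryLeft_four_apply, h0, h1, smul_eq_mul]
  ring

/-- The shear fixes `V` and sends `∂_t` to `(a, X)`. So the restriction of the form to `V` is kept,
and its contraction with `∂_t` becomes that with `(a, X)`. -/
theorem cylForm3_shear (ρ : V [⋀^Fin 3]→ₗ[ℝ] ℝ) (η : V [⋀^Fin 2]→ₗ[ℝ] ℝ) (a : ℝ) (X : V) :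
    (cylForm3 ρ η).compLinearMap (shear a X) = cylForm3 ρ (a • η + ρ.curryLeft X) := by
  have h0 : ∀ v, η ![X, v] = formTwoLin η X v := fun v => (formTwoLin_apply ..).symm
  refine form_three_ext fun p q r => ?_
  have hω : ∀ (a b : ℝ) u v, η ![a • X + u, b • X + v] = η ![u, v] + a * η ![X, v] - b * η ![X, u] :=
    fun a b u v => by
      have e1 := form_two_swap η X u
      have e2 := form_two_self η X
      simp only [← formTwoLin_apply] at *
      simp only [map_add, map_smul, LinearMap.add_apply, LinearMap.smul_apply, smul_eq_mul, e1, e2]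
      ring
  rw [compLinearMap_three, cylForm3_apply, cylForm3_apply]
  simp only [shear_apply, form_three_smul_add, hω, AlternatingMap.add_apply,
    AlternatingMap.smul_apply, curryLeft_three_apply, smul_eq_mul]
  ring

/-- As for 3-forms, with `τ` now the restriction to `V` and `ρ` the contraction with `∂_t`. -/
theorem cylForm4_shear (ρ : V [⋀^Fin 3]→ₗ[ℝ] ℝ) (τ : V [⋀^Fin 4]→ₗ[ℝ] ℝ) (a : ℝ) (X : V) :
    (cylForm4 ρ τ).compLinearMap (shear a X) = cylForm4 (a • ρ + τ.curryLeft X) τ := by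
  refine form_four_ext fun p q r s => ?_
  rw [compLinearMap_four, cylForm4_apply, cylForm4_apply]
  simp only [shear_apply, form_four_smul_add, form_three_smul_add, AlternatingMap.add_apply,
    AlternatingMap.smul_apply, curryLeft_four_apply, smul_eq_mul]
  ring

theorem IsG2Form3.compLinearMap {W : Type*} [AddCommGroup W] [Module ℝ W]
    {φ : V [⋀^Fin 3]→ₗ[ℝ] ℝ} (h : IsG2Form3 φ) (e : W ≃ₗ[ℝ] V) :
    IsG2Form3 (φ.compLinearMap (e : W →ₗ[ℝ] V)) := by
  obtain ⟨f, rfl⟩ := h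
  exact ⟨e.trans f, rfl⟩

theorem IsG2Form4.compLinearMap {W : Type*} [AddCommGroup W] [Module ℝ W]
    {ψ : V [⋀^Fin 4]→ₗ[ℝ] ℝ} (h : IsG2Form4 ψ) (e : W ≃ₗ[ℝ] V) :
    IsG2Form4 (ψ.compLinearMap (e : W →ₗ[ℝ] V)) := by
  obtain ⟨f, rfl⟩ := h
  exact ⟨e.trans f, rfl⟩

theorem isG2Form3_of_frame {ρ : V [⋀^Fin 3]→ₗ[ℝ] ℝ} {η : V [⋀^Fin 2]→ₗ[ℝ] ℝ}
    (f : V ≃ₗ[ℝ] (Fin 6 → ℝ))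
    (hρ : ρ = stdPositiveForm.compLinearMap (f : V →ₗ[ℝ] (Fin 6 → ℝ)))
    (hω : η = stdKahlerForm.compLinearMap (f : V →ₗ[ℝ] (Fin 6 → ℝ))) :
    IsG2Form3 (cylForm3 ρ η) := by
  refine ⟨((LinearEquiv.refl ℝ ℝ).prodCongr f).trans consSeven, form_three_ext fun p q r => ?_⟩
  rw [compLinearMap_three]
  simp only [LinearEquiv.coe_coe, LinearEquiv.trans_apply, stdG2Form3_consSeven, cylForm3_apply, hρ,
    hω, compLinearMap_two, compLinearMap_three]
  rfl

/-- Multiplication of the first complex coordinate of `ℝ⁶ = ℂ³` by `i`. -/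
def rotateFirst : (Fin 6 → ℝ) ≃ₗ[ℝ] (Fin 6 → ℝ) :=
  LinearEquiv.ofLinearMap
    { toFun := fun v => ![-v 1, v 0, v 2, v 3, v 4, v 5]
      map_add' := fun u v => by ext i; fin_cases i <;> simp; ring
      map_smul' := fun r v => by ext i; fin_cases i <;> simp }
    { toFun := fun v => ![v 1, -v 0, v 2, v 3, v 4, v 5]
      map_add' := fun u v => by ext i; fin_cases i <;> simp; ring
      map_smul' := fun r v => by ext i; fin_cases i <;> simp }
    (LinearMap.ext fun v => by ext i; fin_cases i <;> simp)
    (LinearMap.ext fun v => by ext i; fin_cases i <;> simp)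

theorem rotateFirst_apply (v : Fin 6 → ℝ) :
    rotateFirst v = ![-v 1, v 0, v 2, v 3, v 4, v 5] := rfl

/-- Multiplying `z₁` by `i` multiplies `Ω` by `i`, and the real part of `i Ω` is `-Im Ω`. The Kähler
form does not change. -/
theorem stdPositiveForm_rotateFirst (u v w : Fin 6 → ℝ) :
    stdPositiveForm ![rotateFirst u, rotateFirst v, rotateFirst w] = -stdPositiveDual ![u, v, w] := by
  simp only [stdPositiveForm, stdPositiveDual, rotateFirst_apply, AlternatingMap.add_apply,
    AlternatingMap.sub_apply, dx_three_apply, Matrix.cons_val]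
  ring

theorem stdPositiveDual_rotateFirst (u v w : Fin 6 → ℝ) :
    stdPositiveDual ![rotateFirst u, rotateFirst v, rotateFirst w] = stdPositiveForm ![u, v, w] := by
  simp only [stdPositiveForm, stdPositiveDual, rotateFirst_apply, AlternatingMap.add_apply,
    AlternatingMap.sub_apply, dx_three_apply, Matrix.cons_val]
  ring

theorem stdKahlerSquare_rotateFirst (u v w z : Fin 6 → ℝ) :
    stdKahlerSquare ![rotateFirst u, rotateFirst v, rotateFirst w, rotateFirst z] =
      stdKahlerSquare ![u, v, w, z] := by
  simp only [stdKahlerSquare, rotateFirst_apply, AlternatingMap.add_apply,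
    dx_four_apply, dx_three_apply, Matrix.cons_val]
  ring

theorem isG2Form4_of_frame {ρ : V [⋀^Fin 3]→ₗ[ℝ] ℝ} {τ : V [⋀^Fin 4]→ₗ[ℝ] ℝ}
    (f : V ≃ₗ[ℝ] (Fin 6 → ℝ))
    (hρ : ρ = stdPositiveForm.compLinearMap (f : V →ₗ[ℝ] (Fin 6 → ℝ)))
    (hτ : τ = stdKahlerSquare.compLinearMap (f : V →ₗ[ℝ] (Fin 6 → ℝ))) :
    IsG2Form4 (cylForm4 ρ τ) := by
  -- Three quarter turns: they multiply `Ω` by `-i`, and `-Im (-i Ω) = Re Ω`, which matches the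
  -- 3-form part `-Im Ω` of `ψ₀`.
  let g := (f.trans rotateFirst).trans (rotateFirst.trans rotateFirst)
  have hρ' : ∀ u v w, ρ ![u, v, w] = -stdPositiveDual ![g u, g v, g w] := fun u v w => by
    simp only [g, LinearEquiv.trans_apply, stdPositiveDual_rotateFirst, stdPositiveForm_rotateFirst,
      hρ, compLinearMap_three, neg_neg]
    rfl
  have hτ' : ∀ u v w z, τ ![u, v, w, z] = stdKahlerSquare ![g u, g v, g w, g z] := fun u v w z => by
    simp only [g, LinearEquiv.trans_apply, stdKahlerSquare_rotateFirst, hτ, compLinearMap_four]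
    rfl
  refine ⟨((LinearEquiv.refl ℝ ℝ).prodCongr g).trans consSeven, form_four_ext fun p q r s => ?_⟩
  rw [compLinearMap_four]
  simp only [LinearEquiv.coe_coe, LinearEquiv.trans_apply, stdG2Form4_consSeven, cylForm4_apply,
    hρ', hτ']
  simp only [LinearEquiv.prodCongr_apply, LinearEquiv.refl_apply]
  ring

theorem IsSU3'.exists_frame {ρ : V [⋀^Fin 3]→ₗ[ℝ] ℝ} {τ : V [⋀^Fin 4]→ₗ[ℝ] ℝ} (h : IsSU3' ρ τ) :
    ∃ f : V ≃ₗ[ℝ] (Fin 6 → ℝ), ρ = stdPositiveForm.compLinearMap (f : V →ₗ[ℝ] (Fin 6 → ℝ)) ∧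
      τ = stdKahlerSquare.compLinearMap (f : V →ₗ[ℝ] (Fin 6 → ℝ)) := by
  obtain ⟨η, hτ, h⟩ := h
  obtain ⟨f, hρ, hω⟩ := h.exists_frame
  refine ⟨f, hρ, ?_⟩
  rw [hτ, wedge_eq_compLinearMap hω hω, ← wedge_stdKahlerForm_self]
  rfl

theorem isSU3'_of_frame {ρ : V [⋀^Fin 3]→ₗ[ℝ] ℝ} {τ : V [⋀^Fin 4]→ₗ[ℝ] ℝ}
    (f : V ≃ₗ[ℝ] (Fin 6 → ℝ))
    (hρ : ρ = stdPositiveForm.compLinearMap (f : V →ₗ[ℝ] (Fin 6 → ℝ)))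
    (hτ : τ = stdKahlerSquare.compLinearMap (f : V →ₗ[ℝ] (Fin 6 → ℝ))) : IsSU3' ρ τ := by
  obtain ⟨η, hω⟩ : ∃ η, η = stdKahlerForm.compLinearMap (f : V →ₗ[ℝ] (Fin 6 → ℝ)) := ⟨_, rfl⟩
  refine ⟨η, ?_, isSU3_of_frame f hρ hω⟩
  rw [hτ, wedge_eq_compLinearMap hω hω, ← wedge_stdKahlerForm_self]
  rfl

theorem IsSU3.isG2Form3 {ρ : V [⋀^Fin 3]→ₗ[ℝ] ℝ} {η : V [⋀^Fin 2]→ₗ[ℝ] ℝ} (h : IsSU3 ρ η) :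
    IsG2Form3 (cylForm3 ρ η) := by
  obtain ⟨f, hρ, hω⟩ := h.exists_frame
  exact isG2Form3_of_frame f hρ hω

theorem IsSU3'.isG2Form4 {ρ : V [⋀^Fin 3]→ₗ[ℝ] ℝ} {τ : V [⋀^Fin 4]→ₗ[ℝ] ℝ} (h : IsSU3' ρ τ) :
    IsG2Form4 (cylForm4 ρ τ) := by
  obtain ⟨f, hρ, hω⟩ := h.exists_frame
  exact isG2Form4_of_frame f hρ hω

/-- The unit normal of the hyperplane `{0} × V` for a `G₂` 3-form on `ℝ × V`. -/
theorem exists_unit_normal {ρ : V [⋀^Fin 3]→ₗ[ℝ] ℝ} {η : V [⋀^Fin 2]→ₗ[ℝ] ℝ}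
    (f : (ℝ × V) ≃ₗ[ℝ] (Fin 7 → ℝ))
    (hf : cylForm3 ρ η = stdG2Form3.compLinearMap (f : (ℝ × V) →ₗ[ℝ] (Fin 7 → ℝ))) :
    ∃ n : ℝ × V, 0 < n.1 ∧ f n ⬝ᵥ f n = 1 ∧ (∀ v, f n ⬝ᵥ f (0, v) = 0) ∧
      IsSU3 ρ (n.1 • η + ρ.curryLeft n.2) := by
  obtain ⟨n, g, F, hn, hnn, hnv, hFn, hFv, h3, -⟩ := exists_adapted_coordinates f
  have key : ∀ p q r, cylForm3 ρ η ![p, q, r] = stdG2Form3 ![F p, F q, F r] := fun p q r => by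
    rw [hf, compLinearMap_three, h3]; rfl
  refine ⟨n, hn, hnn, hnv, isSU3_of_frame g (form_three_ext fun u v w => ?_)
    (form_two_ext fun u v => ?_)⟩
  · have := key (0, u) (0, v) (0, w)
    simp only [cylForm3_apply, hFv, stdG2Form3_consSeven] at this
    rw [compLinearMap_three]
    simpa only [zero_mul, sub_zero, add_zero, LinearEquiv.coe_coe] using this
  -- In the adapted coordinates `n` is the first basis vector, so contracting `φ₀` with it and
  -- restricting to `V` leaves the Kähler form.
  · have := key n (0, u) (0, v)
    simp only [cylForm3_apply, hFv, hFn, stdG2Form3_consSeven] at this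
    rw [AlternatingMap.add_apply, AlternatingMap.smul_apply, compLinearMap_two,
      curryLeft_three_apply]
    have h0 : stdPositiveForm ![0, g u, g v] = 0 := stdPositiveForm.map_coord_zero (i := 0) rfl
    simp only [h0, zero_mul, sub_zero, add_zero, zero_add, one_mul] at this
    simp only [smul_eq_mul, LinearEquiv.coe_coe]
    linarith

/-- In adapted coordinates the contraction of `ψ₀` with the normal is `-Im Ω`, which becomes `Re Ω`
after one quarter turn of the frame. -/
theorem IsG2Form4.exists_normal {ρ : V [⋀^Fin 3]→ₗ[ℝ] ℝ} {τ : V [⋀^Fin 4]→ₗ[ℝ] ℝ}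
    (h : IsG2Form4 (cylForm4 ρ τ)) :
    ∃ n : ℝ × V, 0 < n.1 ∧ IsSU3' (n.1 • ρ + τ.curryLeft n.2) τ := by
  obtain ⟨f, hf⟩ := h
  obtain ⟨n, g, F, hn, -, -, hFn, hFv, -, h4⟩ := exists_adapted_coordinates f
  have key : ∀ p q r s, cylForm4 ρ τ ![p, q, r, s] = stdG2Form4 ![F p, F q, F r, F s] :=
    fun p q r s => by rw [hf, compLinearMap_four, h4]; rfl
  refine ⟨n, hn, isSU3'_of_frame (g.trans rotateFirst) (form_three_ext fun u v w => ?_)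
    (form_four_ext fun u v w z => ?_)⟩
  · have := key n (0, u) (0, v) (0, w)
    simp only [cylForm4_apply, hFv, hFn, stdG2Form4_consSeven] at this
    rw [AlternatingMap.add_apply, AlternatingMap.smul_apply, compLinearMap_three,
      curryLeft_four_apply]
    simp only [LinearEquiv.coe_coe, LinearEquiv.trans_apply, stdPositiveForm_rotateFirst]
    have h0 : stdKahlerSquare ![0, g u, g v, g w] = 0 :=
      stdKahlerSquare.map_coord_zero (i := 0) rfl
    simp [h0] at this
    simp
    linarith
  · have := key (0, u) (0, v) (0, w) (0, z)
    simp only [cylForm4_apply, hFv, stdG2Form4_consSeven] at this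
    simp only [compLinearMap_four, LinearEquiv.coe_coe, LinearEquiv.trans_apply,
      stdKahlerSquare_rotateFirst]
    simpa using this

end Pointwise

/-! ### The unit normal in terms of the `G₂` metric and cross product -/

section Metric

variable {V : Type*} [AddCommGroup V] [Module ℝ V]

/-- `g (u, -m × v) = -φ (m, v, u) = φ (m, u, v)`: the right side is the contraction of `φ` with `m`,
restricted to `V`. Metric and cross product use the same chosen coordinates, so their independence
of the choice is not needed. -/
theorem g2Metric_g2Cross (ρ : V [⋀^Fin 3]→ₗ[ℝ] ℝ) (η : V [⋀^Fin 2]→ₗ[ℝ] ℝ)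
    (h : IsG2Form3 (cylForm3 ρ η)) (m : ℝ × V) (u v : V) :
    g2Metric (cylForm3 ρ η) (0, u) (-g2Cross (cylForm3 ρ η) m (0, v)) =
      m.1 * η ![u, v] + ρ ![m.2, u, v] := by
  have key : ∀ p q r, cylForm3 ρ η ![p, q, r] =
      stdG2Form3 ![h.choose p, h.choose q, h.choose r] := fun p q r => by
    conv_lhs => rw [h.choose_spec, compLinearMap_three]
    rfl
  rw [g2Metric, g2Cross, dif_pos h, dif_pos h, map_neg, LinearEquiv.apply_symm_apply,
    dotProduct_neg, dotProduct_comm, stdCross_dotProduct, ← key, ← form_three_swap_right,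
    cylForm3_apply]
  simp only [zero_mul, sub_zero, add_zero]
  ring

/-- The `G₂` geometry of the hyperplane `{0} × V`: its unit normal `n`, the complex structure
`n × ·`, and the induced `SU(3)`-structure. -/
theorem IsG2Form3.exists_normal {ρ : V [⋀^Fin 3]→ₗ[ℝ] ℝ} {η : V [⋀^Fin 2]→ₗ[ℝ] ℝ}
    (h : IsG2Form3 (cylForm3 ρ η)) :
    ∃ n : ℝ × V, 0 < n.1 ∧ IsSU3 ρ (n.1 • η + ρ.curryLeft n.2) ∧
      g2Metric (cylForm3 ρ η) n n = 1 ∧ (∀ v, g2Metric (cylForm3 ρ η) n (0, v) = 0) ∧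
      ∃ J : V →ₗ[ℝ] V, (∀ v, J (J v) = -v) ∧
        ∀ v, g2Cross (cylForm3 ρ η) n (0, v) = (0, J v) := by
  obtain ⟨n, hn, hnn, hnv, hSU⟩ := exists_unit_normal h.choose h.choose_spec
  have hm : ∀ u v, g2Metric (cylForm3 ρ η) u v = h.choose u ⬝ᵥ h.choose v := fun u v => by
    rw [g2Metric, dif_pos h]
  have hc : ∀ v, g2Cross (cylForm3 ρ η) n v =
      h.choose.symm (stdCross (h.choose n) (h.choose v)) := fun v => by rw [g2Cross, dif_pos h]
  refine ⟨n, hn, hSU, by rw [hm, hnn], fun v => by rw [hm, hnv], ?_⟩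
  generalize h.choose = f at *
  -- The orthogonal complement of `n` is contained in `{0} × V`; in particular `n × v` is tangent to
  -- `V`.
  have hort : ∀ p, f n ⬝ᵥ f p = 0 → p.1 = 0 := fun p hp => by
    have h1 : p = (p.1 / n.1) • n + (0, p.2 - (p.1 / n.1) • n.2) := by
      ext
      · simp [hn.ne']
      · simp
    rw [h1, map_add, map_smul, dotProduct_add, dotProduct_smul, hnn, hnv, smul_eq_mul, mul_one,
      add_zero, div_eq_zero_iff] at hp
    exact hp.resolve_right hn.ne'
  let J : V →ₗ[ℝ] V := LinearMap.snd ℝ ℝ V ∘ₗ f.symm.toLinearMap ∘ₗ stdCrossLin (f n) ∘ₗ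
    f.toLinearMap ∘ₗ LinearMap.inr ℝ ℝ V
  have hJ : ∀ v, f.symm (stdCross (f n) (f (0, v))) = (0, J v) := fun v =>
    Prod.ext (hort _ (by rw [LinearEquiv.apply_symm_apply, dotProduct_stdCross_left])) rfl
  refine ⟨J, fun v => ?_, fun v => by rw [hc, hJ]⟩
  have h1 : ((0 : ℝ), J (J v)) = (0, -v) := by
    rw [← hJ, ← hJ, LinearEquiv.apply_symm_apply, stdCross_stdCross, hnn, hnv, zero_smul, add_zero,
      neg_one_smul, ← map_neg, LinearEquiv.symm_apply_apply]
    simp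
  exact congrArg Prod.snd h1

end Metric

/-! ### Explicit formulas for the normal vector -/

section Formula

variable {V : Type*} [AddCommGroup V] [Module ℝ V]

/-- The linear form `ℓ` as an exterior form of degree one. -/
noncomputable def covector (ℓ : V →ₗ[ℝ] ℝ) : V [⋀^Fin 1]→ₗ[ℝ] ℝ :=
  AlternatingMap.ofSubsingleton ℝ V ℝ (0 : Fin 1) ℓ

/-- The value of a form of top degree at a basis. -/
noncomputable def topValue (b : Module.Basis (Fin 6) ℝ V) : (V [⋀^Fin 6]→ₗ[ℝ] ℝ) →ₗ[ℝ] ℝ where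
  toFun α := α b
  map_add' _ _ := rfl
  map_smul' _ _ := rfl

/-- The determinant of a linear isomorphism with `ℝ⁶` in a basis. -/
noncomputable def frameDet (b : Module.Basis (Fin 6) ℝ V) (f : V ≃ₗ[ℝ] (Fin 6 → ℝ)) : ℝ :=
  (Pi.basisFun ℝ (Fin 6)).det (f ∘ b)

theorem frameDet_ne_zero (b : Module.Basis (Fin 6) ℝ V) (f : V ≃ₗ[ℝ] (Fin 6 → ℝ)) :
    frameDet b f ≠ 0 := by
  have h := (Pi.basisFun ℝ (Fin 6)).isUnit_det (b.map f)
  exact h.ne_zero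

/-- The basis `b` trivializes `Λ⁶`. Every quantity below is then a standard number times a power of
`frameDet b f`, and the final formulas combine them so that this determinant cancels. -/
theorem topValue_eq (b : Module.Basis (Fin 6) ℝ V) (f : V ≃ₗ[ℝ] (Fin 6 → ℝ))
    {α' : V [⋀^Fin 6]→ₗ[ℝ] ℝ} {α : (Fin 6 → ℝ) [⋀^Fin 6]→ₗ[ℝ] ℝ}
    (h : α' = α.compLinearMap (f : V →ₗ[ℝ] (Fin 6 → ℝ))) :
    topValue b α' = frameDet b f * stdTop α := by
  have h1 : α = stdTop α • (Pi.basisFun ℝ (Fin 6)).det := by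
    have := α.eq_smul_basis_det (Pi.basisFun ℝ (Fin 6))
    rw [stdTop_apply]
    convert this using 3
    ext i
    simp
  rw [h]
  conv_lhs => rw [h1]
  exact mul_comm _ _

theorem covector_apply (ℓ : V →ₗ[ℝ] ℝ) (v : Fin 1 → V) : covector ℓ v = ℓ (v 0) := rfl

theorem alternating_sum_apply {ι κ : Type*} (s : Finset ι) (α : ι → V [⋀^κ]→ₗ[ℝ] ℝ) (v : κ → V) :
    (∑ i ∈ s, α i) v = ∑ i ∈ s, α i v := by
  classical
  induction s using Finset.induction_on with
  | empty => simp
  | insert i s hi h => rw [Finset.sum_insert hi, Finset.sum_insert hi, AlternatingMap.add_apply, h]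

theorem covector_eq_sum (ℓ : (Fin 6 → ℝ) →ₗ[ℝ] ℝ) :
    covector ℓ = ∑ k, ℓ (Pi.single k 1) • dx ![k] := by
  ext v
  have hv : v 0 = ∑ k, v 0 k • Pi.single k (1 : ℝ) := by ext; simp [Pi.single_apply]
  rw [covector_apply, hv, map_sum, alternating_sum_apply]
  refine Finset.sum_congr rfl fun k _ => ?_
  rw [map_smul, AlternatingMap.smul_apply, smul_eq_mul, smul_eq_mul, mul_comm]
  congr 1
  exact (Matrix.det_unique (fun i : Fin 1 => LinearMap.funLeft ℝ ℝ ![k] (v i))).symm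

theorem stdTop_wedge_covector (v : Fin 6 → ℝ) (ℓ : (Fin 6 → ℝ) →ₗ[ℝ] ℝ) :
    stdTop (wedge (wedge (stdPositiveForm.curryLeft v) stdPositiveForm) (covector ℓ)) =
      2 * ℓ (stdComplex v) := by
  have h : ∀ k, stdTop (wedge (wedge (stdPositiveForm.curryLeft v) stdPositiveForm)
      (ℓ (Pi.single k 1) • dx ![k])) = 2 * (stdComplex v k * ℓ (Pi.single k 1)) := fun k => by
    rw [wedge_smul_right, map_smul, stdTop_wedge_interior_stdPositiveForm, smul_eq_mul]
    ring
  have hv : stdComplex v = ∑ k, stdComplex v k • Pi.single k (1 : ℝ) := by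
    ext; simp [Pi.single_apply]
  conv_rhs => rw [hv]
  rw [covector_eq_sum, ← wedgeBilin_apply, map_sum, map_sum, map_sum, Finset.mul_sum]
  refine Finset.sum_congr rfl fun k _ => ?_
  rw [map_smul ℓ, smul_eq_mul, ← h, wedgeBilin_apply]

/-- Hitchin's endomorphism of a 3-form, polarized. -/
noncomputable def hitchinMap (b : Module.Basis (Fin 6) ℝ V) (ρ ρ' : V [⋀^Fin 3]→ₗ[ℝ] ℝ) (v : V) : V :=
  ∑ k, topValue b (wedge (wedge (ρ.curryLeft v) ρ') (covector (b.coord k))) • b k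

/-- The vector dual to the 5-form `η ∧ ρ`. -/
noncomputable def wedgeVector (b : Module.Basis (Fin 6) ℝ V) (η : V [⋀^Fin 2]→ₗ[ℝ] ℝ)
    (ρ : V [⋀^Fin 3]→ₗ[ℝ] ℝ) : V :=
  ∑ k, topValue b (wedge (wedge η ρ) (covector (b.coord k))) • b k

theorem curryLeft_three_eq {W : Type*} [AddCommGroup W] [Module ℝ W] {ρ : V [⋀^Fin 3]→ₗ[ℝ] ℝ}
    {ρ' : W [⋀^Fin 3]→ₗ[ℝ] ℝ} {f : V →ₗ[ℝ] W} (h : ρ = ρ'.compLinearMap f) (v : V) :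
    ρ.curryLeft v = (ρ'.curryLeft (f v)).compLinearMap f := by
  refine form_two_ext fun u w => ?_
  rw [h, curryLeft_three_apply, compLinearMap_three, compLinearMap_two, curryLeft_three_apply]

theorem curryLeft_four_eq {W : Type*} [AddCommGroup W] [Module ℝ W] {τ : V [⋀^Fin 4]→ₗ[ℝ] ℝ}
    {τ' : W [⋀^Fin 4]→ₗ[ℝ] ℝ} {f : V →ₗ[ℝ] W} (h : τ = τ'.compLinearMap f) (v : V) :
    τ.curryLeft v = (τ'.curryLeft (f v)).compLinearMap f := by
  refine form_three_ext fun u w z => ?_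
  rw [h, curryLeft_four_apply, compLinearMap_four, compLinearMap_three, curryLeft_four_apply]

/-- The endomorphism is a density times `J`, so its square is a negative scalar and `hitchinScale`
recovers that scalar. No choice of the sign of `J` enters. -/
theorem hitchinMap_eq (b : Module.Basis (Fin 6) ℝ V) (f : V ≃ₗ[ℝ] (Fin 6 → ℝ))
    {ρ : V [⋀^Fin 3]→ₗ[ℝ] ℝ}
    (hρ : ρ = stdPositiveForm.compLinearMap (f : V →ₗ[ℝ] (Fin 6 → ℝ))) (v : V) :
    hitchinMap b ρ ρ v = (2 * frameDet b f) • f.symm (stdComplex (f v)) := by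
  rw [← b.sum_repr (f.symm (stdComplex (f v))), Finset.smul_sum, hitchinMap]
  refine Finset.sum_congr rfl fun k _ => ?_
  have hk : covector (b.coord k) = (covector (b.coord k ∘ₗ f.symm.toLinearMap)).compLinearMap
      (f : V →ₗ[ℝ] (Fin 6 → ℝ)) := by
    ext v
    simp [covector_apply]
  rw [topValue_eq b f (wedge_eq_compLinearMap (wedge_eq_compLinearMap (curryLeft_three_eq hρ v) hρ) hk),
    LinearEquiv.coe_coe, stdTop_wedge_covector, smul_smul]
  congr 1
  simp only [LinearMap.comp_apply, LinearEquiv.coe_coe, Module.Basis.coord_apply]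
  ring

theorem hitchinMap_hitchinMap (b : Module.Basis (Fin 6) ℝ V) (f : V ≃ₗ[ℝ] (Fin 6 → ℝ))
    {ρ : V [⋀^Fin 3]→ₗ[ℝ] ℝ}
    (hρ : ρ = stdPositiveForm.compLinearMap (f : V →ₗ[ℝ] (Fin 6 → ℝ))) (v : V) :
    hitchinMap b ρ ρ (hitchinMap b ρ ρ v) = -(4 * frameDet b f ^ 2) • v := by
  rw [hitchinMap_eq b f hρ, hitchinMap_eq b f hρ, map_smul, map_smul, map_smul,
    LinearEquiv.apply_symm_apply, isHitchinDual_std.sq, map_neg, LinearEquiv.symm_apply_apply,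
    smul_neg, smul_neg, smul_smul, neg_smul]
  congr 2
  ring

/-- Minus the coordinate `K_{00}` of the square of Hitchin's endomorphism. -/
noncomputable def hitchinScale (b : Module.Basis (Fin 6) ℝ V) (ρ : V [⋀^Fin 3]→ₗ[ℝ] ℝ) : ℝ :=
  -b.coord 0 (hitchinMap b ρ ρ (hitchinMap b ρ ρ (b 0)))

theorem hitchinScale_eq (b : Module.Basis (Fin 6) ℝ V) (f : V ≃ₗ[ℝ] (Fin 6 → ℝ))
    {ρ : V [⋀^Fin 3]→ₗ[ℝ] ℝ}
    (hρ : ρ = stdPositiveForm.compLinearMap (f : V →ₗ[ℝ] (Fin 6 → ℝ))) :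
    hitchinScale b ρ = 4 * frameDet b f ^ 2 := by
  rw [hitchinScale, hitchinMap_hitchinMap b f hρ]
  simp

/-- The value at the basis of the cube of a 2-form. -/
noncomputable def cubeValue (b : Module.Basis (Fin 6) ℝ V) (η : V [⋀^Fin 2]→ₗ[ℝ] ℝ) : ℝ :=
  topValue b (wedge (wedge η η) η)

theorem cubeValue_eq (b : Module.Basis (Fin 6) ℝ V) (f : V ≃ₗ[ℝ] (Fin 6 → ℝ))
    {η : V [⋀^Fin 2]→ₗ[ℝ] ℝ}
    (hω : η = stdKahlerForm.compLinearMap (f : V →ₗ[ℝ] (Fin 6 → ℝ))) :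
    cubeValue b η = 6 * frameDet b f := by
  rw [cubeValue, topValue_eq b f (wedge_cube_compLinearMap hω), stdTop_wedge_stdKahlerForm_cube,
    mul_comm]

theorem cubeValue_smul (b : Module.Basis (Fin 6) ℝ V) (a : ℝ) (η : V [⋀^Fin 2]→ₗ[ℝ] ℝ) :
    cubeValue b (a • η) = a ^ 3 * cubeValue b η := by
  rw [cubeValue, wedge_smul_left, wedge_smul_left, wedge_smul_right, wedge_smul_right, map_smul,
    wedge_smul_left, map_smul, map_smul, cubeValue]
  simp only [smul_eq_mul]
  ring

theorem wedgeVector_add_interior (b : Module.Basis (Fin 6) ℝ V) (a : ℝ) (X : V)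
    (η : V [⋀^Fin 2]→ₗ[ℝ] ℝ) (ρ : V [⋀^Fin 3]→ₗ[ℝ] ℝ) :
    wedgeVector b (a • η + ρ.curryLeft X) ρ = a • wedgeVector b η ρ + hitchinMap b ρ ρ X := by
  simp only [wedgeVector, hitchinMap, wedge_add_left, wedge_smul_left, map_add, map_smul,
    add_smul, smul_assoc, Finset.sum_add_distrib, Finset.smul_sum]

theorem hitchinMap_smul (b : Module.Basis (Fin 6) ℝ V) (ρ ρ' : V [⋀^Fin 3]→ₗ[ℝ] ℝ) (r : ℝ) (v : V) :
    hitchinMap b ρ ρ' (r • v) = r • hitchinMap b ρ ρ' v := by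
  simp only [hitchinMap, map_smul, wedge_smul_left, smul_assoc, Finset.smul_sum]

theorem hitchinMap_add (b : Module.Basis (Fin 6) ℝ V) (ρ ρ' : V [⋀^Fin 3]→ₗ[ℝ] ℝ) (u v : V) :
    hitchinMap b ρ ρ' (u + v) = hitchinMap b ρ ρ' u + hitchinMap b ρ ρ' v := by
  simp only [hitchinMap, map_add, wedge_add_left, add_smul, Finset.sum_add_distrib]

theorem hitchinMap_smul_smul (b : Module.Basis (Fin 6) ℝ V) (ρ : V [⋀^Fin 3]→ₗ[ℝ] ℝ) (r : ℝ) (v : V) :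
    hitchinMap b (r • ρ) (r • ρ) v = r ^ 2 • hitchinMap b ρ ρ v := by
  have h : (r • ρ).curryLeft v = r • ρ.curryLeft v := rfl
  rw [hitchinMap, hitchinMap, Finset.smul_sum]
  refine Finset.sum_congr rfl fun k _ => ?_
  rw [h, wedge_smul_left, wedge_smul_right, wedge_smul_left, wedge_smul_left, map_smul, map_smul,
    smul_smul, ← smul_assoc, pow_two]

theorem hitchinScale_smul (b : Module.Basis (Fin 6) ℝ V) (ρ : V [⋀^Fin 3]→ₗ[ℝ] ℝ) (r : ℝ) :
    hitchinScale b (r • ρ) = r ^ 4 * hitchinScale b ρ := by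
  simp only [hitchinScale, hitchinMap_smul_smul, hitchinMap_smul, map_smul, smul_eq_mul]
  ring

/-- The direction `X / a` of the unit normal `(a, X)` of a `G₂`-pair. -/
noncomputable def normalDir (b : Module.Basis (Fin 6) ℝ V) (ρ : V [⋀^Fin 3]→ₗ[ℝ] ℝ)
    (η : V [⋀^Fin 2]→ₗ[ℝ] ℝ) : V :=
  (hitchinScale b ρ)⁻¹ • hitchinMap b ρ ρ (wedgeVector b η ρ)

/-- The component `a` of the unit normal `(a, X)` of a `G₂`-pair. -/
noncomputable def normalScale (b : Module.Basis (Fin 6) ℝ V) (ρ : V [⋀^Fin 3]→ₗ[ℝ] ℝ)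
    (η : V [⋀^Fin 2]→ₗ[ℝ] ℝ) : ℝ :=
  (9 * hitchinScale b ρ / cubeValue b (η + ρ.curryLeft (normalDir b ρ η)) ^ 2) ^ (1 / 6 : ℝ)

/-- Two conditions of an `SU(3)`-structure determine `(a, X)`: `ω' ∧ ρ = 0` is linear in it and
gives `X / a`, and the normalization of `ω'³` gives `a`. The nonvanishing statements are what
smoothness of the formula requires. -/
theorem normal_formula (b : Module.Basis (Fin 6) ℝ V) {ρ : V [⋀^Fin 3]→ₗ[ℝ] ℝ}
    {η : V [⋀^Fin 2]→ₗ[ℝ] ℝ} {a : ℝ} {X : V} (ha : 0 < a)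
    (h : IsSU3 ρ (a • η + ρ.curryLeft X)) :
    hitchinScale b ρ ≠ 0 ∧ cubeValue b (η + ρ.curryLeft (normalDir b ρ η)) ≠ 0 ∧
      a = normalScale b ρ η ∧ X = a • normalDir b ρ η := by
  obtain ⟨f, hρ, hω⟩ := h.exists_frame
  have hd := frameDet_ne_zero b f
  have hD := hitchinScale_eq b f hρ
  have hD0 : hitchinScale b ρ ≠ 0 := by
    rw [hD]; exact mul_ne_zero (by norm_num) (pow_ne_zero _ hd)
  have hw : a • wedgeVector b η ρ + hitchinMap b ρ ρ X = 0 := by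
    rw [← wedgeVector_add_interior, wedgeVector]
    simp only [h.2.2.1, wedge_zero_left, map_zero, zero_smul, Finset.sum_const_zero]
  have hX : X = a • normalDir b ρ η := by
    -- The equation `a w + K X = 0` is solved by applying `K`, since `K² = -D` with `D` the Hitchin
    -- scale.
    have h1 := congrArg (hitchinMap b ρ ρ) hw
    rw [hitchinMap_add, hitchinMap_smul, hitchinMap_hitchinMap b f hρ, ← hD,
      ← zero_smul ℝ (0 : V), hitchinMap_smul, zero_smul, neg_smul, ← sub_eq_add_neg,
      sub_eq_zero] at h1
    rw [normalDir, smul_comm, h1, smul_smul, inv_mul_cancel₀ hD0, one_smul]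
  have hc : a ^ 3 * cubeValue b (η + ρ.curryLeft (normalDir b ρ η)) = 6 * frameDet b f := by
    have e : a • η + ρ.curryLeft X = a • (η + ρ.curryLeft (normalDir b ρ η)) := by
      rw [smul_add, ← (ρ.curryLeft).map_smul, ← hX]
    have h2 := cubeValue_eq b f hω
    rwa [e, cubeValue_smul] at h2
  have hc0 : cubeValue b (η + ρ.curryLeft (normalDir b ρ η)) ≠ 0 := fun h0 => by
    rw [h0, mul_zero] at hc
    exact mul_ne_zero (by norm_num) hd hc.symm
  refine ⟨hD0, hc0, ?_, hX⟩
  -- With `d = frameDet b f` and `c` the cube value, `a³ c = 6 d` and `D = 4 d²`, so `9 D / c² =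
  -- a⁶`. Squaring removes the sign of `d`, that is, the orientation of `b`; then `a > 0` selects
  -- the root.
  have h6 : 9 * hitchinScale b ρ / cubeValue b (η + ρ.curryLeft (normalDir b ρ η)) ^ 2 =
      a ^ (6 : ℕ) := by
    rw [hD, div_eq_iff (pow_ne_zero 2 hc0), show 9 * (4 * frameDet b f ^ 2) = (6 * frameDet b f) ^ 2 by ring,
      ← hc]
    ring
  rw [normalScale, h6, ← Real.rpow_natCast, ← Real.rpow_mul ha.le]
  norm_num

/-- The coefficient `(u ⌟ v ⌟ τ) ∧ τ` of a 4-form, as a matrix. -/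
noncomputable def squareMatrix (b : Module.Basis (Fin 6) ℝ V) (τ : V [⋀^Fin 4]→ₗ[ℝ] ℝ) :
    Matrix (Fin 6) (Fin 6) ℝ :=
  fun j i => topValue b (wedge ((τ.curryLeft (b i)).curryLeft (b j)) τ)

/-- The coefficients of the 1-form `v ↦ (v ⌟ ρ) ∧ τ`. -/
noncomputable def interiorVector (b : Module.Basis (Fin 6) ℝ V) (ρ : V [⋀^Fin 3]→ₗ[ℝ] ℝ)
    (τ : V [⋀^Fin 4]→ₗ[ℝ] ℝ) : Fin 6 → ℝ :=
  fun j => topValue b (wedge (ρ.curryLeft (b j)) τ)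

/-- The condition `(v ⌟ ρ') ∧ τ = 0` thus becomes a linear system for `X`, with matrix `squareMatrix
b τ`. -/
theorem interiorVector_add_interior (b : Module.Basis (Fin 6) ℝ V) (a : ℝ) (X : V)
    (ρ : V [⋀^Fin 3]→ₗ[ℝ] ℝ) (τ : V [⋀^Fin 4]→ₗ[ℝ] ℝ) :
    interiorVector b (a • ρ + τ.curryLeft X) τ =
      a • interiorVector b ρ τ + (squareMatrix b τ).mulVec (b.repr X) := by
  ext j
  have h1 : (τ.curryLeft X).curryLeft (b j) =
      ∑ i, b.repr X i • (τ.curryLeft (b i)).curryLeft (b j) := by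
    conv_lhs => rw [← b.sum_repr X]
    refine form_two_ext fun u v => ?_
    simp only [map_sum, map_smul, alternating_sum_apply, AlternatingMap.smul_apply,
      curryLeft_three_apply]
  have h2 : (a • ρ + τ.curryLeft X).curryLeft (b j) =
    a • ρ.curryLeft (b j) + (τ.curryLeft X).curryLeft (b j) := rfl
  simp only [interiorVector, Pi.add_apply, Pi.smul_apply, Matrix.mulVec, dotProduct, squareMatrix]
  rw [h2, h1, wedge_add_left, map_add, wedge_smul_left, map_smul, ← wedgeBilin_apply _ τ,
    ← wedgeBilin_apply _ τ, map_sum, LinearMap.sum_apply, map_sum]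
  refine congrArg₂ (· + ·) rfl ?_
  refine Finset.sum_congr rfl fun i _ => ?_
  rw [map_smul, LinearMap.smul_apply, map_smul, smul_eq_mul, mul_comm, wedgeBilin_apply]

/-- The matrix of the standard Kähler form. -/
noncomputable def stdKahlerMatrix : Matrix (Fin 6) (Fin 6) ℝ :=
  fun j i => stdKahlerForm ![Pi.single i 1, Pi.single j 1]

theorem det_stdKahlerMatrix : stdKahlerMatrix.det ≠ 0 := by
  have h : stdKahlerMatrix * (-stdKahlerMatrix) = 1 := by
    ext i j
    simp only [Matrix.mul_apply, stdKahlerMatrix, Matrix.neg_apply, stdKahlerForm_apply,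
      stdComplex_apply]
    fin_cases i <;> fin_cases j <;> simp [Pi.single_apply]
  have := congrArg Matrix.det h
  rw [Matrix.det_mul, Matrix.det_one] at this
  exact left_ne_zero_of_mul_eq_one this

/-- The matrix is `2 d Pᵀ K P`, with `P` the matrix of the frame, `d = det P` and `K` the Kähler
matrix. Its determinant is `2⁶ d⁶ · d² · det K`. -/
theorem det_squareMatrix (b : Module.Basis (Fin 6) ℝ V) (f : V ≃ₗ[ℝ] (Fin 6 → ℝ))
    {τ : V [⋀^Fin 4]→ₗ[ℝ] ℝ}
    (hτ : τ = stdKahlerSquare.compLinearMap (f : V →ₗ[ℝ] (Fin 6 → ℝ))) :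
    (squareMatrix b τ).det = 64 * frameDet b f ^ 8 * stdKahlerMatrix.det := by
  let P : Matrix (Fin 6) (Fin 6) ℝ := fun i j => f (b j) i
  have hP : P.det = frameDet b f := by
    rw [frameDet, Module.Basis.det_apply]
    rfl
  have h : squareMatrix b τ = (2 * frameDet b f) • (P.transpose * stdKahlerMatrix * P) := by
    ext j i
    have h1 : stdKahlerForm ![f (b i), f (b j)] =
        ∑ k, ∑ l, f (b i) k * f (b j) l * stdKahlerForm ![Pi.single k 1, Pi.single l 1] := by
      have hv : ∀ v : Fin 6 → ℝ, v = ∑ k, v k • Pi.single k (1 : ℝ) := fun v => by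
        ext; simp [Pi.single_apply]
      rw [← formTwoLin_apply]
      conv_lhs => rw [hv (f (b i)), hv (f (b j))]
      simp only [map_sum, map_smul, LinearMap.sum_apply, LinearMap.smul_apply, smul_eq_mul,
        Finset.mul_sum, mul_assoc, formTwoLin_apply]
      rw [Finset.sum_comm]
      simp only [mul_left_comm]
    rw [squareMatrix, topValue_eq b f (wedge_eq_compLinearMap
      (curryLeft_three_eq (curryLeft_four_eq hτ (b i)) (b j)) hτ),
      stdTop_wedge_interior_stdKahlerSquare]
    rw [LinearEquiv.coe_coe, h1, Matrix.smul_apply, Matrix.mul_apply, smul_eq_mul]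
    simp only [Matrix.mul_apply, Finset.sum_mul, Finset.mul_sum,
      stdKahlerMatrix, P]
    refine Finset.sum_congr rfl fun k _ => Finset.sum_congr rfl fun l _ => ?_
    change _ = 2 * frameDet b f * (f (b j) l * _ * _)
    ring
  rw [h, Matrix.det_smul, Matrix.det_mul, Matrix.det_mul, Matrix.det_transpose, hP]
  simp only [Fintype.card_fin]
  ring

theorem interiorVector_eq_zero (b : Module.Basis (Fin 6) ℝ V) (f : V ≃ₗ[ℝ] (Fin 6 → ℝ))
    {ρ : V [⋀^Fin 3]→ₗ[ℝ] ℝ} {τ : V [⋀^Fin 4]→ₗ[ℝ] ℝ}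
    (hρ : ρ = stdPositiveForm.compLinearMap (f : V →ₗ[ℝ] (Fin 6 → ℝ)))
    (hτ : τ = stdKahlerSquare.compLinearMap (f : V →ₗ[ℝ] (Fin 6 → ℝ))) :
    interiorVector b ρ τ = 0 := by
  ext j
  rw [interiorVector, topValue_eq b f (wedge_eq_compLinearMap (curryLeft_three_eq hρ (b j)) hτ),
    stdTop_wedge_interior_stdPositiveForm_stdKahlerSquare, mul_zero, Pi.zero_apply]

/-- The direction `X / a` of the normal `(a, X)` of a `G₂`-pair with a 4-form. -/
noncomputable def normalDir' (b : Module.Basis (Fin 6) ℝ V) (ρ : V [⋀^Fin 3]→ₗ[ℝ] ℝ)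
    (τ : V [⋀^Fin 4]→ₗ[ℝ] ℝ) : V :=
  -((squareMatrix b τ).det⁻¹ • ∑ i, (squareMatrix b τ).cramer (interiorVector b ρ τ) i • b i)

/-- The component `a` of the normal `(a, X)` of a `G₂`-pair with a 4-form. -/
noncomputable def normalScale' (b : Module.Basis (Fin 6) ℝ V) (ρ : V [⋀^Fin 3]→ₗ[ℝ] ℝ)
    (τ : V [⋀^Fin 4]→ₗ[ℝ] ℝ) : ℝ :=
  (4 * (squareMatrix b τ).det / stdKahlerMatrix.det /
    hitchinScale b (ρ + τ.curryLeft (normalDir' b ρ τ)) ^ 4) ^ (1 / 16 : ℝ)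

/-- Here `X / a` comes from Cramer's rule. The scale `a` comes from comparing two powers of the
frame determinant, one read off from `τ`, the other from Hitchin's scale of the new 3-form, which is
homogeneous of degree 4. -/
theorem normal_formula' (b : Module.Basis (Fin 6) ℝ V) {ρ : V [⋀^Fin 3]→ₗ[ℝ] ℝ}
    {τ : V [⋀^Fin 4]→ₗ[ℝ] ℝ} {a : ℝ} {X : V} (ha : 0 < a)
    (h : IsSU3' (a • ρ + τ.curryLeft X) τ) :
    (squareMatrix b τ).det ≠ 0 ∧ hitchinScale b (ρ + τ.curryLeft (normalDir' b ρ τ)) ≠ 0 ∧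
      a = normalScale' b ρ τ ∧ X = a • normalDir' b ρ τ := by
  obtain ⟨f, hρ, hτ⟩ := h.exists_frame
  have hd := frameDet_ne_zero b f
  have hκ := det_stdKahlerMatrix
  have hdet := det_squareMatrix b f hτ
  have hdet0 : (squareMatrix b τ).det ≠ 0 := by
    rw [hdet]; exact mul_ne_zero (mul_ne_zero (by norm_num) (pow_ne_zero _ hd)) hκ
  have hX : X = a • normalDir' b ρ τ := by
    have h1 := interiorVector_eq_zero b f hρ hτ
    rw [interiorVector_add_interior] at h1
    have h2 : (squareMatrix b τ).det • ⇑(b.repr X) =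
        -(a • (squareMatrix b τ).cramer (interiorVector b ρ τ)) := by
      rw [← map_smul, ← map_neg, ← eq_neg_of_add_eq_zero_right h1, Matrix.cramer_eq_adjugate_mulVec,
        Matrix.mulVec_mulVec, Matrix.adjugate_mul, Matrix.smul_mulVec, Matrix.one_mulVec]
    rw [normalDir', smul_neg, smul_comm, ← smul_neg, eq_inv_smul_iff₀ hdet0, Finset.smul_sum,
      ← Finset.sum_neg_distrib]
    conv_lhs => rw [← b.sum_repr X]
    rw [Finset.smul_sum]
    refine Finset.sum_congr rfl fun i _ => ?_
    have h3 := congrFun h2 i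
    simp only [Pi.smul_apply, Pi.neg_apply, smul_eq_mul] at h3
    rw [smul_smul, h3, smul_smul, neg_smul]
  have hs : a ^ 4 * hitchinScale b (ρ + τ.curryLeft (normalDir' b ρ τ)) = 4 * frameDet b f ^ 2 := by
    have e : a • ρ + τ.curryLeft X = a • (ρ + τ.curryLeft (normalDir' b ρ τ)) := by
      rw [smul_add, ← (τ.curryLeft).map_smul, ← hX]
    have h2 := hitchinScale_eq b f hρ
    rwa [e, hitchinScale_smul] at h2
  have hs0 : hitchinScale b (ρ + τ.curryLeft (normalDir' b ρ τ)) ≠ 0 := fun h0 => by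
    rw [h0, mul_zero] at hs
    exact mul_ne_zero (by norm_num) (pow_ne_zero _ hd) hs.symm
  refine ⟨hdet0, hs0, ?_, hX⟩
  -- With `s` the Hitchin scale before rescaling, `a⁴ s = 4 d²`, while the determinant is `64 d⁸ det
  -- K`. Since `4 · 64 d⁸ = (4 d²)⁴ = a¹⁶ s⁴`, the quotient is `a¹⁶`.
  have h16 : 4 * (squareMatrix b τ).det / stdKahlerMatrix.det /
      hitchinScale b (ρ + τ.curryLeft (normalDir' b ρ τ)) ^ 4 = a ^ (16 : ℕ) := by
    rw [hdet, div_eq_iff (pow_ne_zero 4 hs0), div_eq_iff hκ]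
    calc 4 * (64 * frameDet b f ^ 8 * stdKahlerMatrix.det)
        = (4 * frameDet b f ^ 2) ^ 4 * stdKahlerMatrix.det := by ring
      _ = _ := by rw [← hs]; ring
  rw [normalScale', h16, ← Real.rpow_natCast, ← Real.rpow_mul ha.le]
  norm_num

end Formula

/-! ### Smoothness of the unit normal -/

section Smoothness

variable {E Z : Type*} [NormedAddCommGroup E] [NormedSpace ℝ E] [FiniteDimensional ℝ E]
  [NormedAddCommGroup Z] [NormedSpace ℝ Z] {m : WithTop ℕ∞} {z : Z}

instance finiteDimensional_continuousAlternatingMap (k : ℕ) :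
    FiniteDimensional ℝ (E [⋀^Fin k]→L[ℝ] ℝ) := by
  let T : (E [⋀^Fin k]→L[ℝ] ℝ) →ₗ[ℝ] MultilinearMap ℝ (fun _ : Fin k => E) ℝ :=
    { toFun := fun α => α.toMultilinearMap
      map_add' := fun _ _ => rfl
      map_smul' := fun _ _ => rfl }
  refine FiniteDimensional.of_injective T fun α β h => ?_
  ext v
  exact congrArg (fun γ : MultilinearMap ℝ (fun _ : Fin k => E) ℝ => γ v) h

/-- In finite dimension a bilinear map is continuous, hence smooth, so the algebraic formulas need
no estimates. -/
theorem ContDiffAt.bilinear {W₁ W₂ W₃ : Type*} [NormedAddCommGroup W₁] [NormedSpace ℝ W₁]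
    [FiniteDimensional ℝ W₁] [NormedAddCommGroup W₂] [NormedSpace ℝ W₂] [FiniteDimensional ℝ W₂]
    [NormedAddCommGroup W₃] [NormedSpace ℝ W₃]
    (B : W₁ →ₗ[ℝ] W₂ →ₗ[ℝ] W₃) {f : Z → W₁} {g : Z → W₂} (hf : ContDiffAt ℝ m f z)
    (hg : ContDiffAt ℝ m g z) : ContDiffAt ℝ m (fun x => B (f x) (g x)) z :=
  (B.toContinuousBilinearMap.contDiff.contDiffAt.comp z hf).clm_apply hg

theorem ContDiffAt.trilinear {W₁ W₂ W₃ W₄ : Type*} [NormedAddCommGroup W₁] [NormedSpace ℝ W₁]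
    [FiniteDimensional ℝ W₁] [NormedAddCommGroup W₂] [NormedSpace ℝ W₂] [FiniteDimensional ℝ W₂]
    [NormedAddCommGroup W₃] [NormedSpace ℝ W₃] [FiniteDimensional ℝ W₃]
    [NormedAddCommGroup W₄] [NormedSpace ℝ W₄]
    (B : W₁ →ₗ[ℝ] W₂ →ₗ[ℝ] W₃ →ₗ[ℝ] W₄) {f : Z → W₁} {g : Z → W₂} {h : Z → W₃}
    (hf : ContDiffAt ℝ m f z) (hg : ContDiffAt ℝ m g z) (hh : ContDiffAt ℝ m h z) :
    ContDiffAt ℝ m (fun x => B (f x) (g x) (h x)) z :=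
  (hf.bilinear (B.compr₂ (LinearMap.toContinuousLinearMap (𝕜 := ℝ) (E := W₃)
    (F' := W₄)).toLinearMap) hg).clm_apply hh

theorem ContDiffAt.matrix_det {n : Type*} [Fintype n] [DecidableEq n] {A : Z → Matrix n n ℝ}
    (hA : ∀ i j, ContDiffAt ℝ m (fun x => A x i j) z) : ContDiffAt ℝ m (fun x => (A x).det) z := by
  simp only [Matrix.det_apply']
  exact ContDiffAt.sum fun g _ => contDiffAt_const.mul (contDiffAt_prod fun i _ => hA _ _)

/-- A continuous exterior form as an algebraic one, linearly. -/
noncomputable def forgetForm (E : Type*) [NormedAddCommGroup E] [NormedSpace ℝ E] (k : ℕ) :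
    (E [⋀^Fin k]→L[ℝ] ℝ) →ₗ[ℝ] (E [⋀^Fin k]→ₗ[ℝ] ℝ) :=
  ContinuousAlternatingMap.toAlternatingMapLinear

theorem ContDiffAt.wedge_form {p q : ℕ} (T : (E [⋀^Fin (p + q)]→ₗ[ℝ] ℝ) →ₗ[ℝ] ℝ)
    {α : Z → E [⋀^Fin p]→L[ℝ] ℝ} {β : Z → E [⋀^Fin q]→L[ℝ] ℝ} (hα : ContDiffAt ℝ m α z)
    (hβ : ContDiffAt ℝ m β z) :
    ContDiffAt ℝ m (fun x => T (wedge (α x).toAlternatingMap (β x).toAlternatingMap)) z :=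
  hα.bilinear (((wedgeBilin E p q).compl₁₂ (forgetForm E p) (forgetForm E q)).compr₂ T) hβ

theorem ContDiffAt.wedge_wedge_form {p q r : ℕ} (T : (E [⋀^Fin (p + q + r)]→ₗ[ℝ] ℝ) →ₗ[ℝ] ℝ)
    {α : Z → E [⋀^Fin p]→L[ℝ] ℝ} {β : Z → E [⋀^Fin q]→L[ℝ] ℝ} {γ : Z → E [⋀^Fin r]→L[ℝ] ℝ}
    (hα : ContDiffAt ℝ m α z) (hβ : ContDiffAt ℝ m β z) (hγ : ContDiffAt ℝ m γ z) :
    ContDiffAt ℝ m (fun x => T (wedge (wedge (α x).toAlternatingMap (β x).toAlternatingMap)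
      (γ x).toAlternatingMap)) z :=
  hα.trilinear (((wedgeBilin E p q).compl₁₂ (forgetForm E p) (forgetForm E q)).compr₂
    (((wedgeBilin E (p + q) r).compr₂ T).compl₂ (forgetForm E r))) hβ hγ

theorem contDiffAt_wedge_cube (T : (E [⋀^Fin 6]→ₗ[ℝ] ℝ) →ₗ[ℝ] ℝ) {α : Z → E [⋀^Fin 2]→L[ℝ] ℝ}
    (hα : ContDiffAt ℝ m α z) :
    ContDiffAt ℝ m (fun x => T (wedge (wedge (α x).toAlternatingMap (α x).toAlternatingMap)
      (α x).toAlternatingMap)) z :=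
  ContDiffAt.wedge_wedge_form (p := 2) (q := 2) (r := 2) T hα hα hα

theorem contDiffAt_wedge_two_four (T : (E [⋀^Fin 6]→ₗ[ℝ] ℝ) →ₗ[ℝ] ℝ)
    {α : Z → E [⋀^Fin 2]→L[ℝ] ℝ} {β : Z → E [⋀^Fin 4]→L[ℝ] ℝ} (hα : ContDiffAt ℝ m α z)
    (hβ : ContDiffAt ℝ m β z) :
    ContDiffAt ℝ m (fun x => T (wedge (α x).toAlternatingMap (β x).toAlternatingMap)) z :=
  ContDiffAt.wedge_form (p := 2) (q := 4) T hα hβ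

theorem contDiffAt_wedge_covector (T : (E [⋀^Fin 6]→ₗ[ℝ] ℝ) →ₗ[ℝ] ℝ)
    {α : Z → E [⋀^Fin 2]→L[ℝ] ℝ} {β : Z → E [⋀^Fin 3]→L[ℝ] ℝ} (hα : ContDiffAt ℝ m α z)
    (hβ : ContDiffAt ℝ m β z) (ℓ : E →ₗ[ℝ] ℝ) :
    ContDiffAt ℝ m (fun x => T (wedge (wedge (α x).toAlternatingMap (β x).toAlternatingMap)
      (covector ℓ))) z := by
  have h := ContDiffAt.wedge_wedge_form (p := 2) (q := 3) (r := 1) T hα hβ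
    (contDiffAt_const (c := ContinuousAlternatingMap.ofSubsingleton ℝ E ℝ (0 : Fin 1)
      ℓ.toContinuousLinearMap))
  exact h

theorem ContDiffAt.interior {k : ℕ} {α : Z → E [⋀^Fin (k + 1)]→L[ℝ] ℝ} {v : Z → E}
    (hα : ContDiffAt ℝ m α z) (hv : ContDiffAt ℝ m v z) :
    ContDiffAt ℝ m (fun x => (α x).curryLeft (v x)) z := by
  let B : (E [⋀^Fin (k + 1)]→L[ℝ] ℝ) →ₗ[ℝ] E →ₗ[ℝ] (E [⋀^Fin k]→L[ℝ] ℝ) :=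
    LinearMap.mk₂ ℝ (fun α v => α.curryLeft v) (fun _ _ _ => rfl) (fun _ _ _ => rfl)
      (fun α u v => map_add _ _ _) (fun r α v => map_smul _ _ _)
  exact hα.bilinear B hv

variable (b : Module.Basis (Fin 6) ℝ E)

theorem contDiffAt_hitchinMap {ρ : Z → E [⋀^Fin 3]→L[ℝ] ℝ} {v : Z → E}
    (hρ : ContDiffAt ℝ m ρ z) (hv : ContDiffAt ℝ m v z) :
    ContDiffAt ℝ m (fun x => hitchinMap b (ρ x).toAlternatingMap (ρ x).toAlternatingMap (v x)) z := by
  unfold hitchinMap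
  generalize topValue b = T
  exact ContDiffAt.sum fun k _ =>
    (contDiffAt_wedge_covector T (hρ.interior hv) hρ (b.coord k)).smul contDiffAt_const

theorem contDiffAt_wedgeVector {η : Z → E [⋀^Fin 2]→L[ℝ] ℝ} {ρ : Z → E [⋀^Fin 3]→L[ℝ] ℝ}
    (hη : ContDiffAt ℝ m η z) (hρ : ContDiffAt ℝ m ρ z) :
    ContDiffAt ℝ m (fun x => wedgeVector b (η x).toAlternatingMap (ρ x).toAlternatingMap) z := by
  unfold wedgeVector
  generalize topValue b = T
  exact ContDiffAt.sum fun k _ =>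
    (contDiffAt_wedge_covector T hη hρ (b.coord k)).smul contDiffAt_const

theorem contDiffAt_hitchinScale {ρ : Z → E [⋀^Fin 3]→L[ℝ] ℝ} (hρ : ContDiffAt ℝ m ρ z) :
    ContDiffAt ℝ m (fun x => hitchinScale b (ρ x).toAlternatingMap) z :=
  ((b.coord 0).toContinuousLinearMap.contDiff.contDiffAt.comp z
    (contDiffAt_hitchinMap b hρ (contDiffAt_hitchinMap b hρ contDiffAt_const))).neg

theorem contDiffAt_cubeValue {η : Z → E [⋀^Fin 2]→L[ℝ] ℝ} (hη : ContDiffAt ℝ m η z) :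
    ContDiffAt ℝ m (fun x => cubeValue b (η x).toAlternatingMap) z := by
  unfold cubeValue
  generalize topValue b = T
  exact contDiffAt_wedge_cube T hη

theorem contDiffAt_normalDir {ρ : Z → E [⋀^Fin 3]→L[ℝ] ℝ} {η : Z → E [⋀^Fin 2]→L[ℝ] ℝ}
    (hρ : ContDiffAt ℝ m ρ z) (hη : ContDiffAt ℝ m η z)
    (h : hitchinScale b (ρ z).toAlternatingMap ≠ 0) :
    ContDiffAt ℝ m (fun x => normalDir b (ρ x).toAlternatingMap (η x).toAlternatingMap) z :=
  ((contDiffAt_hitchinScale b hρ).inv h).smul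
    (contDiffAt_hitchinMap b hρ (contDiffAt_wedgeVector b hη hρ))

/-- A real power is smooth where its base is nonzero, and the two hypotheses ensure this. -/
theorem contDiffAt_normalScale {ρ : Z → E [⋀^Fin 3]→L[ℝ] ℝ} {η : Z → E [⋀^Fin 2]→L[ℝ] ℝ}
    (hρ : ContDiffAt ℝ m ρ z) (hη : ContDiffAt ℝ m η z)
    (h : hitchinScale b (ρ z).toAlternatingMap ≠ 0)
    (h' : cubeValue b ((η z).toAlternatingMap + (ρ z).toAlternatingMap.curryLeft
      (normalDir b (ρ z).toAlternatingMap (η z).toAlternatingMap)) ≠ 0) :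
    ContDiffAt ℝ m (fun x => normalScale b (ρ x).toAlternatingMap (η x).toAlternatingMap) z :=
  ((contDiffAt_const.mul (contDiffAt_hitchinScale b hρ)).div
    ((contDiffAt_cubeValue b (hη.add (hρ.interior (contDiffAt_normalDir b hρ hη h)))).pow 2)
    (pow_ne_zero 2 h')).rpow_const_of_ne
      (div_ne_zero (mul_ne_zero (by norm_num) h) (pow_ne_zero 2 h'))

theorem contDiffAt_squareMatrix {τ : Z → E [⋀^Fin 4]→L[ℝ] ℝ} (hτ : ContDiffAt ℝ m τ z)
    (i j : Fin 6) : ContDiffAt ℝ m (fun x => squareMatrix b (τ x).toAlternatingMap i j) z := by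
  unfold squareMatrix
  have h : ContDiffAt ℝ m (fun x => ((τ x).curryLeft (b j)).curryLeft (b i)) z :=
    (hτ.interior contDiffAt_const).interior contDiffAt_const
  have h2 := fun T => contDiffAt_wedge_two_four T h hτ
  simp only [ContinuousAlternatingMap.toAlternatingMap_curryLeft] at h2
  generalize topValue b = T
  exact h2 T

theorem contDiffAt_interiorVector {ρ : Z → E [⋀^Fin 3]→L[ℝ] ℝ} {τ : Z → E [⋀^Fin 4]→L[ℝ] ℝ}
    (hρ : ContDiffAt ℝ m ρ z) (hτ : ContDiffAt ℝ m τ z) (i : Fin 6) :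
    ContDiffAt ℝ m
      (fun x => interiorVector b (ρ x).toAlternatingMap (τ x).toAlternatingMap i) z := by
  unfold interiorVector
  have h : ContDiffAt ℝ m (fun x => (ρ x).curryLeft (b i)) z := hρ.interior contDiffAt_const
  have h2 := fun T => contDiffAt_wedge_two_four T h hτ
  simp only [ContinuousAlternatingMap.toAlternatingMap_curryLeft] at h2
  generalize topValue b = T
  exact h2 T

theorem contDiffAt_normalDir' {ρ : Z → E [⋀^Fin 3]→L[ℝ] ℝ} {τ : Z → E [⋀^Fin 4]→L[ℝ] ℝ}
    (hρ : ContDiffAt ℝ m ρ z) (hτ : ContDiffAt ℝ m τ z)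
    (h : (squareMatrix b (τ z).toAlternatingMap).det ≠ 0) :
    ContDiffAt ℝ m (fun x => normalDir' b (ρ x).toAlternatingMap (τ x).toAlternatingMap) z := by
  refine (((ContDiffAt.matrix_det (contDiffAt_squareMatrix b hτ)).inv h).smul
    (ContDiffAt.sum fun i _ => ContDiffAt.smul ?_ contDiffAt_const)).neg
  simp only [Matrix.cramer_apply]
  refine ContDiffAt.matrix_det fun j k => ?_
  simp only [Matrix.updateCol_apply]
  split_ifs
  · exact contDiffAt_interiorVector b hρ hτ j
  · exact contDiffAt_squareMatrix b hτ j k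

theorem contDiffAt_normalScale' {ρ : Z → E [⋀^Fin 3]→L[ℝ] ℝ} {τ : Z → E [⋀^Fin 4]→L[ℝ] ℝ}
    (hρ : ContDiffAt ℝ m ρ z) (hτ : ContDiffAt ℝ m τ z)
    (h : (squareMatrix b (τ z).toAlternatingMap).det ≠ 0)
    (h' : hitchinScale b ((ρ z).toAlternatingMap + (τ z).toAlternatingMap.curryLeft
      (normalDir' b (ρ z).toAlternatingMap (τ z).toAlternatingMap)) ≠ 0) :
    ContDiffAt ℝ m (fun x => normalScale' b (ρ x).toAlternatingMap (τ x).toAlternatingMap) z :=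
  ((((contDiffAt_const.mul (ContDiffAt.matrix_det (contDiffAt_squareMatrix b hτ))).div_const _).div
    ((contDiffAt_hitchinScale b (hρ.add (hτ.interior (contDiffAt_normalDir' b hρ hτ h)))).pow 4)
    (pow_ne_zero 4 h'))).rpow_const_of_ne
      (div_ne_zero (div_ne_zero (mul_ne_zero (by norm_num) h) det_stdKahlerMatrix)
        (pow_ne_zero 4 h'))

end Smoothness

/-! ### Families of maps which are smooth uniformly on compact sets -/

section JointSmoothness

open Filter Set Topology

variable {T : Type*} [TopologicalSpace T] {E : Type} [NormedAddCommGroup E] [NormedSpace ℝ E]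

/-- A family `f` of maps on the open set `U`, depending on a parameter in a topological space, all
of whose derivatives up to order `j` exist and are continuous in the parameter and the variable. -/
def JointlyContDiffOn (U : Set E) : ℕ → ∀ {W : Type} [NormedAddCommGroup W] [NormedSpace ℝ W],
    (T → E → W) → Prop
  | 0, _, _, _, f => ContinuousOn (Function.uncurry f) (univ ×ˢ U)
  | j + 1, _, _, _, f => ContinuousOn (Function.uncurry f) (univ ×ˢ U) ∧
      (∀ t, DifferentiableOn ℝ (f t) U) ∧
      JointlyContDiffOn U j (fun t y => fderivWithin ℝ (f t) U y)

variable {U : Set E} {W W' : Type} [NormedAddCommGroup W] [NormedSpace ℝ W]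
  [NormedAddCommGroup W'] [NormedSpace ℝ W'] {j : ℕ}

theorem JointlyContDiffOn.continuousOn {f : T → E → W} (h : JointlyContDiffOn U j f) :
    ContinuousOn (Function.uncurry f) (univ ×ˢ U) := by
  cases j with
  | zero => exact h
  | succ j => exact h.1

theorem JointlyContDiffOn.of_succ {f : T → E → W} (h : JointlyContDiffOn U (j + 1) f) :
    JointlyContDiffOn U j f := by
  induction j generalizing W with
  | zero => exact h.1
  | succ j ih => exact ⟨h.1, h.2.1, ih h.2.2⟩

theorem JointlyContDiffOn.congr {f g : T → E → W} (h : JointlyContDiffOn U j f)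
    (hfg : ∀ t, ∀ y ∈ U, g t y = f t y) : JointlyContDiffOn U j g := by
  induction j generalizing W with
  | zero => exact ContinuousOn.congr h fun p hp => hfg _ _ hp.2
  | succ j ih =>
    exact ⟨h.1.congr fun p hp => hfg _ _ hp.2, fun t => (h.2.1 t).congr (hfg t),
      ih h.2.2 fun t y hy => fderivWithin_congr (hfg t) (hfg t y hy)⟩

theorem jointlyContDiffOn_const {c : T → W} (hc : Continuous c) :
    JointlyContDiffOn U j (fun t (_ : E) => c t) := by
  induction j generalizing W with
  | zero => exact (hc.comp continuous_fst).continuousOn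
  | succ j ih =>
    refine ⟨(hc.comp continuous_fst).continuousOn, fun t => differentiableOn_const _, ?_⟩
    simp only [fderivWithin_fun_const]
    exact ih (c := fun _ => (0 : E →L[ℝ] W)) continuous_const

theorem JointlyContDiffOn.clm_comp (hU : IsOpen U) {f : T → E → W} (h : JointlyContDiffOn U j f)
    (L : W →L[ℝ] W') : JointlyContDiffOn U j (fun t y => L (f t y)) := by
  induction j generalizing W W' with
  | zero => exact L.continuous.comp_continuousOn h
  | succ j ih =>
    refine ⟨L.continuous.comp_continuousOn h.1,
      fun t => L.differentiable.comp_differentiableOn (h.2.1 t), ?_⟩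
    refine (ih h.2.2 (ContinuousLinearMap.compL ℝ E W W' L)).congr fun t y hy => ?_
    exact (L.hasFDerivAt.comp_hasFDerivWithinAt y
      (h.2.1 t y hy).hasFDerivWithinAt).fderivWithin (hU.uniqueDiffOn y hy)

theorem JointlyContDiffOn.prodMk (hU : IsOpen U) {f : T → E → W} {g : T → E → W'}
    (hf : JointlyContDiffOn U j f) (hg : JointlyContDiffOn U j g) :
    JointlyContDiffOn U j (fun t y => (f t y, g t y)) := by
  induction j generalizing W W' with
  | zero => exact ContinuousOn.prodMk hf hg
  | succ j ih =>
    refine ⟨ContinuousOn.prodMk hf.1 hg.1, fun t => (hf.2.1 t).prodMk (hg.2.1 t), ?_⟩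
    refine ((ih hf.2.2 hg.2.2).clm_comp hU
      (ContinuousLinearMap.prodₗᵢ ℝ (𝕜 := ℝ) (E := E) (F := W) (G := W')
        ).toContinuousLinearEquiv.toContinuousLinearMap).congr fun t y hy => ?_
    exact ((hf.2.1 t y hy).hasFDerivWithinAt.prodMk
      (hg.2.1 t y hy).hasFDerivWithinAt).fderivWithin (hU.uniqueDiffOn y hy)

/-- By the chain rule the derivative of `Φ ∘ f` is `Ψ (f, Df)` with `Ψ (w, L) = DΦ(w) ∘ L`, again
smooth at the relevant points. The pair `(f, Df)` has one order less, so induction applies to `Ψ`.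
-/
theorem JointlyContDiffOn.comp_contDiffAt (hU : IsOpen U) {f : T → E → W}
    (h : JointlyContDiffOn U j f) {Φ : W → W'}
    (hΦ : ∀ t, ∀ y ∈ U, ContDiffAt ℝ ∞ Φ (f t y)) :
    JointlyContDiffOn U j (fun t y => Φ (f t y)) := by
  have hc : ContinuousOn (Function.uncurry fun t y => Φ (f t y)) (univ ×ˢ U) := fun p hp =>
    ContinuousAt.comp_continuousWithinAt (f := Function.uncurry f) (hΦ p.1 p.2 hp.2).continuousAt
      (h.continuousOn p hp)
  induction j generalizing W W' with
  | zero => exact hc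
  | succ j ih =>
    have hd : ∀ t, ∀ y ∈ U, DifferentiableAt ℝ Φ (f t y) := fun t y hy =>
      (hΦ t y hy).differentiableAt (by simp)
    refine ⟨hc, fun t y hy => (hd t y hy).comp_differentiableWithinAt y (h.2.1 t y hy), ?_⟩
    have hpair := h.of_succ.prodMk hU h.2.2
    have hΨ : ∀ t, ∀ y ∈ U, ContDiffAt ℝ ∞
        (fun q : W × (E →L[ℝ] W) => (fderiv ℝ Φ q.1).comp q.2)
        (f t y, fderivWithin ℝ (f t) U y) := fun t y hy => by
      have h1 : ContDiffAt ℝ ∞ (fderiv ℝ Φ) (f t y) := (hΦ t y hy).fderiv_right (by simp)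
      have h2 : ContDiffAt ℝ ∞ (fun q : W × (E →L[ℝ] W) => fderiv ℝ Φ q.1)
          (f t y, fderivWithin ℝ (f t) U y) := ContDiffAt.comp (f := Prod.fst) (f t y, fderivWithin ℝ (f t) U y) h1 contDiffAt_fst
      exact h2.clm_comp contDiffAt_snd
    refine (ih hpair hΨ fun p hp => ContinuousAt.comp_continuousWithinAt
      (f := Function.uncurry fun t y => (f t y, fderivWithin ℝ (f t) U y))
      (hΨ p.1 p.2 hp.2).continuousAt (hpair.continuousOn p hp)).congr fun t y hy => ?_
    exact ((hd t y hy).hasFDerivAt.comp_hasFDerivWithinAt y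
      (h.2.1 t y hy).hasFDerivWithinAt).fderivWithin (hU.uniqueDiffOn y hy)

theorem continuousOn_iteratedFDerivWithin_zero {f : T → E → W} :
    ContinuousOn (fun p : T × E => iteratedFDerivWithin ℝ 0 (f p.1) U p.2) (univ ×ˢ U) ↔
      ContinuousOn (Function.uncurry f) (univ ×ˢ U) := by
  simp only [iteratedFDerivWithin_zero_eq_comp]
  exact (continuousMultilinearCurryFin0 ℝ E W).symm.toHomeomorph.comp_continuousOn_iff _ _

theorem continuousOn_iteratedFDerivWithin_succ (hU : IsOpen U) (f : T → E → W) (i : ℕ) :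
    ContinuousOn (fun p : T × E => iteratedFDerivWithin ℝ (i + 1) (f p.1) U p.2) (univ ×ˢ U) ↔
      ContinuousOn (fun p : T × E =>
        iteratedFDerivWithin ℝ i (fun y => fderivWithin ℝ (f p.1) U y) U p.2) (univ ×ˢ U) := by
  rw [← (continuousMultilinearCurryRightEquiv' ℝ i E W).symm.toHomeomorph.comp_continuousOn_iff]
  refine continuousOn_congr fun p hp => ?_
  rw [iteratedFDerivWithin_succ_eq_comp_right hU.uniqueDiffOn hp.2]
  rfl

/-- The recursive notion suits induction, the iterated derivatives suit the `C^∞` topology; they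
differ only by currying isometries. -/
theorem jointlyContDiffOn_iff (hU : IsOpen U) {f : T → E → W}
    (hf : ∀ t, ContDiffOn ℝ ∞ (f t) U) : JointlyContDiffOn U j f ↔
      ∀ i ≤ j, ContinuousOn (fun p : T × E => iteratedFDerivWithin ℝ i (f p.1) U p.2)
        (univ ×ˢ U) := by
  induction j generalizing W with
  | zero =>
    refine continuousOn_iteratedFDerivWithin_zero.symm.trans
      ⟨fun h i hi => ?_, fun h => h 0 le_rfl⟩
    obtain rfl := Nat.le_zero.mp hi
    exact h
  | succ j ih =>
    have key := ih (f := fun t y => fderivWithin ℝ (f t) U y) fun t =>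
      (hf t).fderivWithin hU.uniqueDiffOn (by simp)
    constructor
    · rintro ⟨h1, -, h3⟩ i hi
      rcases i with _ | i
      · exact continuousOn_iteratedFDerivWithin_zero.mpr h1
      · exact (continuousOn_iteratedFDerivWithin_succ hU f i).mpr (key.mp h3 i (by omega))
    · intro h
      exact ⟨continuousOn_iteratedFDerivWithin_zero.mp (h 0 (by omega)),
        fun t => (hf t).differentiableOn (by simp), key.mpr fun i hi =>
          (continuousOn_iteratedFDerivWithin_succ hU f i).mp (h (i + 1) (by omega))⟩

/-- The exponential law for the compact-open topology. In one direction each point of `U` has a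
compact neighbourhood in `U`, on which uniform closeness and continuity of `h t` combine; in the
other, compactness makes joint continuity uniform on `K`. -/
theorem continuous_uniformOnFun_iff [LocallyCompactSpace E] (hU : IsOpen U) {h : T → E → W}
    (hh : ∀ t, ContinuousOn (h t) U) :
    Continuous (fun t => UniformOnFun.ofFun {K : Set E | IsCompact K ∧ K ⊆ U} (h t)) ↔
      ContinuousOn (fun p : T × E => h p.1 p.2) (univ ×ˢ U) := by
  simp only [continuous_iff_continuousAt, ContinuousAt,
    UniformOnFun.tendsto_iff_tendstoUniformlyOn]
  constructor
  · rintro H ⟨t, y⟩ ⟨-, hy⟩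
    obtain ⟨K, hK, hyK, hKU⟩ := exists_compact_subset hU hy
    have h1 := H t K ⟨hK, hKU⟩
    refine ContinuousAt.continuousWithinAt ?_
    rw [Metric.continuousAt_iff']
    intro ε hε
    rw [Metric.tendstoUniformlyOn_iff] at h1
    have h2 := h1 (ε / 2) (by positivity)
    have h3 : ∀ᶠ y' in 𝓝 y, dist (h t y') (h t y) < ε / 2 :=
      Metric.continuousAt_iff'.mp ((hh t).continuousAt (hU.mem_nhds hy)) _ (by positivity)
    have h4 : ∀ᶠ y' in 𝓝 y, y' ∈ K := mem_interior_iff_mem_nhds.mp hyK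
    rw [nhds_prod_eq]
    filter_upwards [h2.prod_mk (h3.and h4)] with p hp
    have h5 := hp.1 p.2 hp.2.2
    have h6 := dist_triangle (h p.1 p.2) (h t p.2) (h t y)
    rw [dist_comm] at h5
    have h7 := hp.2.1
    change dist (h p.1 p.2) (h t p.2) < ε / 2 at h5
    linarith
  · rintro H t K ⟨hK, hKU⟩
    intro u hu
    obtain ⟨v, hv, hvu⟩ := hK.mem_uniformity_of_prod (f := h) (s := univ) (q := t)
      (H.mono (prod_mono_right hKU)) (mem_univ _) (symm_le_uniformity hu)
    rw [nhdsWithin_univ] at hv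
    filter_upwards [hv] with t' ht' y hy
    exact hvu t' ht' y hy

end JointSmoothness

/-! ### Natural operators on forms and the `C^∞` topology -/

section Natural

open Filter Set Topology

/-- The model space of the manifold. -/
local notation "E6" => EuclideanSpace ℝ (Fin 6)

/-- An operator `Φ` on pairs of forms on `ℝ⁶`, depending on a real parameter, which is smooth on the
pairs in `G` and natural under linear isomorphisms. -/
structure IsNaturalOperator {W : Type} [NormedAddCommGroup W] [NormedSpace ℝ W] {k₁ k₂ : ℕ}
    (G : Set ((E6 [⋀^Fin k₁]→L[ℝ] ℝ) × (E6 [⋀^Fin k₂]→L[ℝ] ℝ)))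
    (act : (E6 ≃L[ℝ] E6) → W → W)
    (Φ : ℝ × ((E6 [⋀^Fin k₁]→L[ℝ] ℝ) × (E6 [⋀^Fin k₂]→L[ℝ] ℝ)) → W) : Prop where
  smooth : ∀ s, ∀ q ∈ G, ContDiffAt ℝ ∞ Φ (s, q)
  natural : ∀ s, ∀ q ∈ G, ∀ A : E6 ≃L[ℝ] E6,
    (q.1.compContinuousLinearMap (A : E6 →L[ℝ] E6),
      q.2.compContinuousLinearMap (A : E6 →L[ℝ] E6)) ∈ G ∧
    Φ (s, q.1.compContinuousLinearMap (A : E6 →L[ℝ] E6),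
      q.2.compContinuousLinearMap (A : E6 →L[ℝ] E6)) = act A (Φ (s, q))

variable {M : Type*} [TopologicalSpace M] [ChartedSpace E6 M]

theorem continuous_smoothForm_iff {T : Type*} [TopologicalSpace T] {k : ℕ}
    {g : T → SmoothForm M k} : Continuous g ↔ ∀ e ∈ atlas E6 M, ∀ j : ℕ,
      JointlyContDiffOn e.target j (fun t y => localRep (g t).toFun e y) := by
  have h : ∀ e ∈ atlas E6 M, ∀ j : ℕ, Continuous (fun t =>
      UniformOnFun.ofFun {K : Set E6 | IsCompact K ∧ K ⊆ e.target}
          (iteratedFDerivWithin ℝ j (localRep (g t).toFun e) e.target)) ↔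
      ContinuousOn (fun p : T × E6 => iteratedFDerivWithin ℝ j (localRep (g p.1).toFun e) e.target p.2)
        (univ ×ˢ e.target) := fun e he j =>
    continuous_uniformOnFun_iff e.open_target fun t =>
      ((g t).smooth e he).continuousOn_iteratedFDerivWithin (by exact_mod_cast le_top)
        e.open_target.uniqueDiffOn
  simp only [continuous_iInf_rng, continuous_induced_rng, Function.comp_def]
  refine forall₂_congr fun e he => ⟨fun H j => ?_, fun H j => ?_⟩
  · exact (jointlyContDiffOn_iff e.open_target fun t => (g t).smooth e he).mpr
      fun i _ => (h e he i).mp (H i)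
  · exact (h e he j).mpr ((jointlyContDiffOn_iff e.open_target fun t => (g t).smooth e he).mp
      (H j) j le_rfl)

variable [IsManifold (𝓡 6) ∞ M]

theorem exists_mfderiv_symm {e : OpenPartialHomeomorph M E6} (he : e ∈ atlas E6 M) {y : E6}
    (hy : y ∈ e.target) : ∃ A : E6 ≃L[ℝ] E6,
      (A : E6 →L[ℝ] E6) = mfderiv (𝓡 6) (𝓡 6) e.symm y ∧
      (A.symm : E6 →L[ℝ] E6) = mfderiv (𝓡 6) (𝓡 6) e (e.symm y) := by
  have h : e.MDifferentiable (𝓡 6) (𝓡 6) := mdifferentiable_of_mem_atlas he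
  exact ⟨h.symm.mfderiv hy, rfl, rfl⟩

variable {k₁ k₂ k : ℕ} {G : Set ((E6 [⋀^Fin k₁]→L[ℝ] ℝ) × (E6 [⋀^Fin k₂]→L[ℝ] ℝ))}
  {Φ : ℝ × ((E6 [⋀^Fin k₁]→L[ℝ] ℝ) × (E6 [⋀^Fin k₂]→L[ℝ] ℝ)) → (E6 [⋀^Fin k]→L[ℝ] ℝ)}

/-- The derivative of a chart is a linear isomorphism, so naturality lets the operator be computed
on the local representations. -/
theorem IsNaturalOperator.localRep_eq
    (hΦ : IsNaturalOperator G (fun A α => α.compContinuousLinearMap (A : E6 →L[ℝ] E6)) Φ)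
    {e : OpenPartialHomeomorph M E6} (he : e ∈ atlas E6 M) (s : ℝ) (α : SmoothForm M k₁)
    (β : SmoothForm M k₂) (hG : ∀ x, (α.toFun x, β.toFun x) ∈ G) {y : E6} (hy : y ∈ e.target) :
    (localRep α.toFun e y, localRep β.toFun e y) ∈ G ∧
    localRep (fun x => Φ (s, α.toFun x, β.toFun x)) e y =
      Φ (s, localRep α.toFun e y, localRep β.toFun e y) := by
  obtain ⟨A, hA, -⟩ := exists_mfderiv_symm he hy
  have h := hΦ.natural s _ (hG (e.symm y)) A
  rw [hA] at h
  exact ⟨h.1, h.2.symm⟩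

/-- The form obtained by applying a natural operator to a pair of forms. -/
noncomputable def IsNaturalOperator.form
    (hΦ : IsNaturalOperator G (fun A α => α.compContinuousLinearMap (A : E6 →L[ℝ] E6)) Φ)
    (s : ℝ) (α : SmoothForm M k₁) (β : SmoothForm M k₂) (hG : ∀ x, (α.toFun x, β.toFun x) ∈ G) :
    SmoothForm M k where
  toFun x := Φ (s, α.toFun x, β.toFun x)
  smooth e he := by
    refine ContDiffOn.congr (f := fun y => Φ (s, localRep α.toFun e y, localRep β.toFun e y))
      (fun y hy => ?_) fun y hy => (hΦ.localRep_eq he s α β hG hy).2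
    exact (hΦ.smooth s _ (hΦ.localRep_eq he s α β hG hy).1).comp_contDiffWithinAt y
      (contDiffWithinAt_const.prodMk ((α.smooth e he y hy).prodMk (β.smooth e he y hy)))

theorem IsNaturalOperator.continuous_form
    (hΦ : IsNaturalOperator G (fun A α => α.compContinuousLinearMap (A : E6 →L[ℝ] E6)) Φ)
    {T : Type*} [TopologicalSpace T] {s : T → ℝ} {α : T → SmoothForm M k₁} {β : T → SmoothForm M k₂}
    (hG : ∀ t x, ((α t).toFun x, (β t).toFun x) ∈ G) (hs : Continuous s) (hα : Continuous α)
    (hβ : Continuous β) : Continuous fun t => hΦ.form (s t) (α t) (β t) (hG t) := by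
  rw [continuous_smoothForm_iff] at hα hβ ⊢
  intro e he j
  have h := ((jointlyContDiffOn_const hs).prodMk e.open_target
    ((hα e he j).prodMk e.open_target (hβ e he j))).comp_contDiffAt e.open_target (Φ := Φ)
    fun t y hy => hΦ.smooth _ _ (hΦ.localRep_eq he (s t) (α t) (β t) (hG t) hy).1
  exact h.congr fun t y hy => (hΦ.localRep_eq he (s t) (α t) (β t) (hG t) hy).2

theorem IsNaturalOperator.contMDiffAt_chart {W : Type} [NormedAddCommGroup W] [NormedSpace ℝ W]
    {act : (E6 ≃L[ℝ] E6) → W → W} {Φ : ℝ × ((E6 [⋀^Fin k₁]→L[ℝ] ℝ) × (E6 [⋀^Fin k₂]→L[ℝ] ℝ)) → W}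
    (hΦ : IsNaturalOperator G act Φ) (α : SmoothForm M k₁) (β : SmoothForm M k₂)
    (hG : ∀ x, (α.toFun x, β.toFun x) ∈ G) (s : ℝ) (x : M) :
    ContMDiffAt (𝓘(ℝ, ℝ).prod (𝓡 6)) 𝓘(ℝ, W) ∞
      (fun q : ℝ × M => Φ (q.1, localRep α.toFun (chartAt E6 x) (chartAt E6 x q.2),
        localRep β.toFun (chartAt E6 x) (chartAt E6 x q.2))) (s, x) := by
  have he := chart_mem_atlas E6 x
  have hx := mem_chart_target E6 x
  have hx' := mem_chart_source E6 x
  generalize chartAt E6 x = e at *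
  have hG' : (localRep α.toFun e (e x), localRep β.toFun e (e x)) ∈ G := by
    obtain ⟨A, hA, -⟩ := exists_mfderiv_symm he hx
    have h := (hΦ.natural s _ (hG (e.symm (e x))) A).1
    rw [hA] at h
    exact h
  have hα := (α.smooth e he).contDiffAt (e.open_target.mem_nhds hx)
  have hβ := (β.smooth e he).contDiffAt (e.open_target.mem_nhds hx)
  have h1 : ContDiffAt ℝ ∞ (fun p : ℝ × E6 => Φ (p.1, localRep α.toFun e p.2,
      localRep β.toFun e p.2)) (s, e x) :=
    ContDiffAt.comp (g := Φ) (f := fun p : ℝ × E6 => (p.1, localRep α.toFun e p.2,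
      localRep β.toFun e p.2)) (s, e x) (hΦ.smooth s _ hG') (contDiffAt_fst.prodMk
      ((ContDiffAt.comp (f := Prod.snd) (s, e x) hα contDiffAt_snd).prodMk
        (ContDiffAt.comp (f := Prod.snd) (s, e x) hβ contDiffAt_snd)))
  have h2 : ContMDiffAt (𝓡 6) (𝓡 6) ∞ e x :=
    contMDiffAt_of_mem_maximalAtlas (IsManifold.subset_maximalAtlas he) hx'
  have h3 : ContMDiffAt (𝓘(ℝ, ℝ).prod (𝓡 6)) 𝓘(ℝ, ℝ × E6) ∞ (fun q : ℝ × M => (q.1, e q.2)) (s, x) :=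
    contMDiffAt_fst.prodMk_space (ContMDiffAt.comp (s, x) h2 contMDiffAt_snd)
  exact ContMDiffAt.comp (f := fun q : ℝ × M => (q.1, e q.2)) (s, x) h1.contMDiffAt h3

theorem IsNaturalOperator.apply_chart {W : Type} [NormedAddCommGroup W] [NormedSpace ℝ W]
    {act : (E6 ≃L[ℝ] E6) → W → W} {Φ : ℝ × ((E6 [⋀^Fin k₁]→L[ℝ] ℝ) × (E6 [⋀^Fin k₂]→L[ℝ] ℝ)) → W}
    (hΦ : IsNaturalOperator G act Φ) (α : SmoothForm M k₁) (β : SmoothForm M k₂)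
    (hG : ∀ x, (α.toFun x, β.toFun x) ∈ G) {e : OpenPartialHomeomorph M E6} (he : e ∈ atlas E6 M)
    (s : ℝ) {x : M} (hx : x ∈ e.source) :
    ∃ A : E6 ≃L[ℝ] E6, (A.symm : E6 →L[ℝ] E6) = mfderiv (𝓡 6) (𝓡 6) e x ∧
      Φ (s, localRep α.toFun e (e x), localRep β.toFun e (e x)) =
        act A (Φ (s, α.toFun x, β.toFun x)) := by
  obtain ⟨y, hy, rfl⟩ : ∃ y ∈ e.target, e.symm y = x := ⟨e x, e.map_source hx, e.left_inv hx⟩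
  obtain ⟨A, hA, hA'⟩ := exists_mfderiv_symm he hy
  have h := (hΦ.natural s _ (hG (e.symm y)) A).2
  rw [hA] at h
  rw [e.right_inv hy]
  exact ⟨A, hA', h⟩

theorem IsNaturalOperator.contMDiff_function {a : ℝ × ((E6 [⋀^Fin k₁]→L[ℝ] ℝ) ×
      (E6 [⋀^Fin k₂]→L[ℝ] ℝ)) → ℝ}
    (ha : IsNaturalOperator G (fun _ r => r) a) (α : SmoothForm M k₁) (β : SmoothForm M k₂)
    (hG : ∀ x, (α.toFun x, β.toFun x) ∈ G) :
    ContMDiff (𝓘(ℝ, ℝ).prod (𝓡 6)) 𝓘(ℝ, ℝ) ∞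
      (fun q : ℝ × M => a (q.1, α.toFun q.2, β.toFun q.2)) := by
  rintro ⟨s, x⟩
  refine (ha.contMDiffAt_chart α β hG s x).congr_of_eventuallyEq ?_
  filter_upwards [continuousAt_snd.preimage_mem_nhds
    ((chartAt E6 x).open_source.mem_nhds (mem_chart_source E6 x))] with q hq
  obtain ⟨A, -, h⟩ := ha.apply_chart α β hG (chart_mem_atlas E6 x) q.1 hq
  exact h.symm

theorem IsNaturalOperator.contMDiff_section {X : ℝ × ((E6 [⋀^Fin k₁]→L[ℝ] ℝ) ×
      (E6 [⋀^Fin k₂]→L[ℝ] ℝ)) → E6}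
    (hX : IsNaturalOperator G (fun A v => A.symm v) X) (α : SmoothForm M k₁) (β : SmoothForm M k₂)
    (hG : ∀ x, (α.toFun x, β.toFun x) ∈ G) :
    ContMDiff (𝓘(ℝ, ℝ).prod (𝓡 6)) (𝓡 6).tangent ∞
      (fun q : ℝ × M => (⟨q.2, X (q.1, α.toFun q.2, β.toFun q.2)⟩ : TangentBundle (𝓡 6) M)) := by
  rintro ⟨s, x⟩
  rw [Bundle.contMDiffAt_totalSpace]
  refine ⟨contMDiffAt_snd, ?_⟩
  refine (hX.contMDiffAt_chart α β hG s x).congr_of_eventuallyEq ?_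
  filter_upwards [continuousAt_snd.preimage_mem_nhds
    ((chartAt E6 x).open_source.mem_nhds (mem_chart_source E6 x))] with q hq
  obtain ⟨A, hA, h⟩ := hX.apply_chart α β hG (chart_mem_atlas E6 x) q.1 hq
  rw [h]
  -- The tangent bundle is trivialized by the derivative of the chart, which is the map `A.symm` by
  -- which a natural vector transforms.
  have h2 : (trivializationAt E6 (TangentSpace (𝓡 6)) x).continuousLinearMapAt ℝ q.2 =
      mfderiv (𝓡 6) (𝓡 6) (chartAt E6 x) q.2 :=
    TangentBundle.continuousLinearMapAt_trivializationAt hq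
  have h3 : ∀ v : TangentSpace (𝓡 6) q.2,
      (trivializationAt E6 (TangentSpace (𝓡 6)) x (⟨q.2, v⟩ : TangentBundle (𝓡 6) M)).2 =
        mfderiv (𝓡 6) (𝓡 6) (chartAt E6 x) q.2 v := fun v => by
    rw [← h2]
    exact (Bundle.Trivialization.continuousLinearMapAt_apply_of_mem (R := ℝ) _ hq v).symm
  exact (h3 _).trans (DFunLike.congr_fun hA _).symm

end Natural

/-! ### The normal vector as a natural operator -/

section NormalVector

variable {V W : Type*} [AddCommGroup V] [Module ℝ V] [AddCommGroup W] [Module ℝ W]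
  {ρ : V [⋀^Fin 3]→ₗ[ℝ] ℝ} {η : V [⋀^Fin 2]→ₗ[ℝ] ℝ} {τ : V [⋀^Fin 4]→ₗ[ℝ] ℝ}

theorem IsSU3.compLinearMap (h : IsSU3 ρ η) (A : W ≃ₗ[ℝ] V) :
    IsSU3 (ρ.compLinearMap (A : W →ₗ[ℝ] V)) (η.compLinearMap (A : W →ₗ[ℝ] V)) := by
  obtain ⟨f, rfl, rfl⟩ := h.exists_frame
  exact isSU3_of_frame (A.trans f) rfl rfl

theorem IsSU3'.compLinearMap (h : IsSU3' ρ τ) (A : W ≃ₗ[ℝ] V) :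
    IsSU3' (ρ.compLinearMap (A : W →ₗ[ℝ] V)) (τ.compLinearMap (A : W →ₗ[ℝ] V)) := by
  obtain ⟨f, rfl, rfl⟩ := h.exists_frame
  exact isSU3'_of_frame (A.trans f) rfl rfl

theorem IsG2Form3.cylForm3_compLinearMap (h : IsG2Form3 (cylForm3 ρ η)) (A : W ≃ₗ[ℝ] V) :
    IsG2Form3 (cylForm3 (ρ.compLinearMap (A : W →ₗ[ℝ] V)) (η.compLinearMap (A : W →ₗ[ℝ] V))) := by
  convert h.compLinearMap ((LinearEquiv.refl ℝ ℝ).prodCongr A)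
  refine form_three_ext fun p q r => ?_
  simp only [cylForm3_apply, compLinearMap_three, compLinearMap_two]
  rfl

theorem IsG2Form4.cylForm4_compLinearMap (h : IsG2Form4 (cylForm4 ρ τ)) (A : W ≃ₗ[ℝ] V) :
    IsG2Form4 (cylForm4 (ρ.compLinearMap (A : W →ₗ[ℝ] V)) (τ.compLinearMap (A : W →ₗ[ℝ] V))) := by
  convert h.compLinearMap ((LinearEquiv.refl ℝ ℝ).prodCongr A)
  refine form_four_ext fun p q r s => ?_
  simp only [cylForm4_apply, compLinearMap_four, compLinearMap_three]
  rfl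

/-- The unit normal of `{0} × V` for the `G₂` form `cylForm3 ρ η`. -/
noncomputable def normalVector (b : Module.Basis (Fin 6) ℝ V) (ρ : V [⋀^Fin 3]→ₗ[ℝ] ℝ)
    (η : V [⋀^Fin 2]→ₗ[ℝ] ℝ) : ℝ × V :=
  (normalScale b ρ η, normalScale b ρ η • normalDir b ρ η)

/-- The analogue of `normalVector` for the form `cylForm4 ρ τ`. -/
noncomputable def normalVector' (b : Module.Basis (Fin 6) ℝ V) (ρ : V [⋀^Fin 3]→ₗ[ℝ] ℝ)
    (τ : V [⋀^Fin 4]→ₗ[ℝ] ℝ) : ℝ × V :=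
  (normalScale' b ρ τ, normalScale' b ρ τ • normalDir' b ρ τ)

/-- The characterization behind every later property: a vector with positive `dt`-component that
produces an `SU(3)`-structure is the one given by the formula, whatever the basis. -/
theorem eq_normalVector (b : Module.Basis (Fin 6) ℝ V) {n : ℝ × V} (hn : 0 < n.1)
    (h : IsSU3 ρ (n.1 • η + ρ.curryLeft n.2)) : n = normalVector b ρ η := by
  obtain ⟨-, -, h1, h2⟩ := normal_formula b hn h
  exact Prod.ext h1 (h2.trans (congrArg (· • _) h1))

theorem eq_normalVector' (b : Module.Basis (Fin 6) ℝ V) {n : ℝ × V} (hn : 0 < n.1)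
    (h : IsSU3' (n.1 • ρ + τ.curryLeft n.2) τ) : n = normalVector' b ρ τ := by
  obtain ⟨-, -, h1, h2⟩ := normal_formula' b hn h
  exact Prod.ext h1 (h2.trans (congrArg (· • _) h1))

theorem IsG2Form3.normalVector_spec (b : Module.Basis (Fin 6) ℝ V)
    (h : IsG2Form3 (cylForm3 ρ η)) :
    0 < (normalVector b ρ η).1 ∧
      IsSU3 ρ ((normalVector b ρ η).1 • η + ρ.curryLeft (normalVector b ρ η).2) ∧
      g2Metric (cylForm3 ρ η) (normalVector b ρ η) (normalVector b ρ η) = 1 ∧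
      (∀ v, g2Metric (cylForm3 ρ η) (normalVector b ρ η) (0, v) = 0) ∧
      ∃ J : V →ₗ[ℝ] V, (∀ v, J (J v) = -v) ∧
        ∀ v, g2Cross (cylForm3 ρ η) (normalVector b ρ η) (0, v) = (0, J v) := by
  obtain ⟨n, hn, hSU, h⟩ := h.exists_normal
  rw [← eq_normalVector b hn hSU]
  exact ⟨hn, hSU, h⟩

theorem IsG2Form4.normalVector'_spec (b : Module.Basis (Fin 6) ℝ V)
    (h : IsG2Form4 (cylForm4 ρ τ)) :
    0 < (normalVector' b ρ τ).1 ∧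
      IsSU3' ((normalVector' b ρ τ).1 • ρ + τ.curryLeft (normalVector' b ρ τ).2) τ := by
  obtain ⟨n, hn, hSU⟩ := h.exists_normal
  rw [← eq_normalVector' b hn hSU]
  exact ⟨hn, hSU⟩

/-- `∂_t` itself satisfies the characterization; this makes the retraction fix `SU(3)`-structures.
-/
theorem IsSU3.normalVector_eq (b : Module.Basis (Fin 6) ℝ V) (h : IsSU3 ρ η) :
    normalVector b ρ η = (1, 0) :=
  (eq_normalVector b (n := (1, 0)) one_pos (by simpa using h)).symm

theorem IsSU3'.normalVector'_eq (b : Module.Basis (Fin 6) ℝ V) (h : IsSU3' ρ τ) :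
    normalVector' b ρ τ = (1, 0) :=
  (eq_normalVector' b (n := (1, 0)) one_pos (by simpa using h)).symm

/-- Naturality follows from uniqueness, since the pulled-back vector again produces an
`SU(3)`-structure. The formula itself is not used. -/
theorem IsG2Form3.normalVector_compLinearMap (b : Module.Basis (Fin 6) ℝ V)
    (b' : Module.Basis (Fin 6) ℝ W) (h : IsG2Form3 (cylForm3 ρ η)) (A : W ≃ₗ[ℝ] V) :
    normalVector b' (ρ.compLinearMap (A : W →ₗ[ℝ] V)) (η.compLinearMap (A : W →ₗ[ℝ] V)) =
      ((normalVector b ρ η).1, A.symm (normalVector b ρ η).2) := by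
  obtain ⟨hn, hSU, -⟩ := h.normalVector_spec b
  refine (eq_normalVector b' (n := (_, _)) hn ?_).symm
  convert hSU.compLinearMap A
  refine form_two_ext fun u v => ?_
  simp

theorem IsG2Form4.normalVector'_compLinearMap (b : Module.Basis (Fin 6) ℝ V)
    (b' : Module.Basis (Fin 6) ℝ W) (h : IsG2Form4 (cylForm4 ρ τ)) (A : W ≃ₗ[ℝ] V) :
    normalVector' b' (ρ.compLinearMap (A : W →ₗ[ℝ] V)) (τ.compLinearMap (A : W →ₗ[ℝ] V)) =
      ((normalVector' b ρ τ).1, A.symm (normalVector' b ρ τ).2) := by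
  obtain ⟨hn, hSU⟩ := h.normalVector'_spec b
  refine (eq_normalVector' b' (n := (_, _)) hn ?_).symm
  convert hSU.compLinearMap A
  refine form_three_ext fun u v w => ?_
  simp

/-- The forms `(1 - s) η + s (a η + X ⌟ ρ)`, `0 ≤ s ≤ 1`, define `G₂`-pairs. -/
theorem IsG2Form3.segment (b : Module.Basis (Fin 6) ℝ V) (h : IsG2Form3 (cylForm3 ρ η)) {s : ℝ}
    (hs : s ∈ I) : IsG2Form3 (cylForm3 ρ ((1 - s) • η +
      s • ((normalVector b ρ η).1 • η + ρ.curryLeft (normalVector b ρ η).2))) := by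
  obtain ⟨hn, -⟩ := h.normalVector_spec b
  generalize normalVector b ρ η = n at *
  -- The `dt`-component of `(1 - s) ∂_t + s n`. Its nonvanishing makes the shear sending `∂_t` to
  -- this vector invertible, and the pullback by the shear is the form in question.
  have ha : (1 - s) + s * n.1 ≠ 0 := by
    obtain ⟨h0, h1⟩ := hs
    rcases h0.eq_or_lt with rfl | h0
    · simp
    · have := mul_pos h0 hn
      linarith
  convert h.compLinearMap (shearEquiv _ ha (s • n.2))
  refine Eq.trans ?_ (cylForm3_shear ρ η _ _).symm
  rw [map_smul]
  congr 1
  module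

theorem IsG2Form4.segment (b : Module.Basis (Fin 6) ℝ V) (h : IsG2Form4 (cylForm4 ρ τ)) {s : ℝ}
    (hs : s ∈ I) : IsG2Form4 (cylForm4 ((1 - s) • ρ +
      s • ((normalVector' b ρ τ).1 • ρ + τ.curryLeft (normalVector' b ρ τ).2)) τ) := by
  obtain ⟨hn, -⟩ := h.normalVector'_spec b
  generalize normalVector' b ρ τ = n at *
  have ha : (1 - s) + s * n.1 ≠ 0 := by
    obtain ⟨h0, h1⟩ := hs
    rcases h0.eq_or_lt with rfl | h0
    · simp
    · have := mul_pos h0 hn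
      linarith
  convert h.compLinearMap (shearEquiv _ ha (s • n.2))
  refine Eq.trans ?_ (cylForm4_shear ρ τ _ _).symm
  rw [map_smul]
  congr 1
  module

end NormalVector

/-! ### The segment to the normal as a smooth natural operator -/

section NaturalOperators

local notation "E6" => EuclideanSpace ℝ (Fin 6)

/-- The standard basis of `ℝ⁶`. -/
noncomputable def stdBasis : Module.Basis (Fin 6) ℝ E6 :=
  (EuclideanSpace.basisFun (Fin 6) ℝ).toBasis

/-- The `G₂`-pairs of constant forms. -/
def linearG2Pairs : Set ((E6 [⋀^Fin 3]→L[ℝ] ℝ) × (E6 [⋀^Fin 2]→L[ℝ] ℝ)) :=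
  {q | IsG2Form3 (cylForm3 q.1.toAlternatingMap q.2.toAlternatingMap)}

/-- The `G₂`-pairs of constant forms, in the version with 4-forms. -/
def linearG2Pairs' : Set ((E6 [⋀^Fin 3]→L[ℝ] ℝ) × (E6 [⋀^Fin 4]→L[ℝ] ℝ)) :=
  {q | IsG2Form4 (cylForm4 q.1.toAlternatingMap q.2.toAlternatingMap)}

/-- The unit normal of a pair of constant forms. -/
noncomputable def pairNormal (q : (E6 [⋀^Fin 3]→L[ℝ] ℝ) × (E6 [⋀^Fin 2]→L[ℝ] ℝ)) : ℝ × E6 :=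
  normalVector stdBasis q.1.toAlternatingMap q.2.toAlternatingMap

/-- The analogue of `pairNormal` in the version with 4-forms. -/
noncomputable def pairNormal' (q : (E6 [⋀^Fin 3]→L[ℝ] ℝ) × (E6 [⋀^Fin 4]→L[ℝ] ℝ)) : ℝ × E6 :=
  normalVector' stdBasis q.1.toAlternatingMap q.2.toAlternatingMap

/-- The family `(1 - s) η + s (a η + X ⌟ ρ)`, `(a, X)` the unit normal. -/
noncomputable def segmentOperator (p : ℝ × ((E6 [⋀^Fin 3]→L[ℝ] ℝ) × (E6 [⋀^Fin 2]→L[ℝ] ℝ))) :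
    E6 [⋀^Fin 2]→L[ℝ] ℝ :=
  (1 - p.1) • p.2.2 + p.1 • ((pairNormal p.2).1 • p.2.2 + p.2.1.curryLeft (pairNormal p.2).2)

/-- The family `(1 - s) ρ + s (a ρ + X ⌟ τ)`. -/
noncomputable def segmentOperator' (p : ℝ × ((E6 [⋀^Fin 3]→L[ℝ] ℝ) × (E6 [⋀^Fin 4]→L[ℝ] ℝ))) :
    E6 [⋀^Fin 3]→L[ℝ] ℝ :=
  (1 - p.1) • p.2.1 + p.1 • ((pairNormal' p.2).1 • p.2.1 + p.2.2.curryLeft (pairNormal' p.2).2)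

/-- The segment `(1 - s) (1, 0) + s n` from `∂_t` to the unit normal `n`. -/
noncomputable def segmentNormal (p : ℝ × ((E6 [⋀^Fin 3]→L[ℝ] ℝ) × (E6 [⋀^Fin 2]→L[ℝ] ℝ))) :
    ℝ × E6 :=
  ((1 - p.1) + p.1 * (pairNormal p.2).1, p.1 • (pairNormal p.2).2)

theorem contDiffAt_pairNormal {q : (E6 [⋀^Fin 3]→L[ℝ] ℝ) × (E6 [⋀^Fin 2]→L[ℝ] ℝ)}
    (hq : q ∈ linearG2Pairs) : ContDiffAt ℝ ∞ pairNormal q := by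
  obtain ⟨hn, hSU, -⟩ := IsG2Form3.normalVector_spec stdBasis hq
  obtain ⟨h1, h2, -⟩ := normal_formula stdBasis hn hSU
  have ha := contDiffAt_normalScale stdBasis (m := ∞) (contDiffAt_fst (p := q))
    (contDiffAt_snd (p := q)) h1 h2
  exact ha.prodMk (ha.smul (contDiffAt_normalDir stdBasis contDiffAt_fst contDiffAt_snd h1))

theorem contDiffAt_pairNormal' {q : (E6 [⋀^Fin 3]→L[ℝ] ℝ) × (E6 [⋀^Fin 4]→L[ℝ] ℝ)}
    (hq : q ∈ linearG2Pairs') : ContDiffAt ℝ ∞ pairNormal' q := by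
  obtain ⟨hn, hSU⟩ := IsG2Form4.normalVector'_spec stdBasis hq
  obtain ⟨h1, h2, -⟩ := normal_formula' stdBasis hn hSU
  have ha := contDiffAt_normalScale' stdBasis (m := ∞) (contDiffAt_fst (p := q))
    (contDiffAt_snd (p := q)) h1 h2
  exact ha.prodMk (ha.smul (contDiffAt_normalDir' stdBasis contDiffAt_fst contDiffAt_snd h1))

theorem pairNormal_comp {q : (E6 [⋀^Fin 3]→L[ℝ] ℝ) × (E6 [⋀^Fin 2]→L[ℝ] ℝ)}
    (hq : q ∈ linearG2Pairs) (A : E6 ≃L[ℝ] E6) :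
    pairNormal (q.1.compContinuousLinearMap (A : E6 →L[ℝ] E6),
      q.2.compContinuousLinearMap (A : E6 →L[ℝ] E6)) =
      ((pairNormal q).1, A.symm (pairNormal q).2) :=
  IsG2Form3.normalVector_compLinearMap stdBasis stdBasis hq A.toLinearEquiv

theorem pairNormal'_comp {q : (E6 [⋀^Fin 3]→L[ℝ] ℝ) × (E6 [⋀^Fin 4]→L[ℝ] ℝ)}
    (hq : q ∈ linearG2Pairs') (A : E6 ≃L[ℝ] E6) :
    pairNormal' (q.1.compContinuousLinearMap (A : E6 →L[ℝ] E6),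
      q.2.compContinuousLinearMap (A : E6 →L[ℝ] E6)) =
      ((pairNormal' q).1, A.symm (pairNormal' q).2) :=
  IsG2Form4.normalVector'_compLinearMap stdBasis stdBasis hq A.toLinearEquiv

theorem linearG2Pairs_comp {q : (E6 [⋀^Fin 3]→L[ℝ] ℝ) × (E6 [⋀^Fin 2]→L[ℝ] ℝ)}
    (hq : q ∈ linearG2Pairs) (A : E6 ≃L[ℝ] E6) :
    (q.1.compContinuousLinearMap (A : E6 →L[ℝ] E6),
      q.2.compContinuousLinearMap (A : E6 →L[ℝ] E6)) ∈ linearG2Pairs :=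
  IsG2Form3.cylForm3_compLinearMap hq A.toLinearEquiv

theorem linearG2Pairs'_comp {q : (E6 [⋀^Fin 3]→L[ℝ] ℝ) × (E6 [⋀^Fin 4]→L[ℝ] ℝ)}
    (hq : q ∈ linearG2Pairs') (A : E6 ≃L[ℝ] E6) :
    (q.1.compContinuousLinearMap (A : E6 →L[ℝ] E6),
      q.2.compContinuousLinearMap (A : E6 →L[ℝ] E6)) ∈ linearG2Pairs' :=
  IsG2Form4.cylForm4_compLinearMap hq A.toLinearEquiv

theorem isNaturalOperator_segmentOperator : IsNaturalOperator linearG2Pairs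
    (fun A α => α.compContinuousLinearMap (A : E6 →L[ℝ] E6)) segmentOperator where
  smooth s q hq := by
    have h := ContDiffAt.comp (g := pairNormal) (f := Prod.snd) (s, q) (contDiffAt_pairNormal hq)
      contDiffAt_snd
    have h1 : ContDiffAt ℝ ∞ (fun p : ℝ × _ => p.2.1) (s, q) := contDiffAt_snd.fst
    have h2 : ContDiffAt ℝ ∞ (fun p : ℝ × _ => p.2.2) (s, q) := contDiffAt_snd.snd
    exact ((contDiffAt_const.sub contDiffAt_fst).smul h2).add
      (contDiffAt_fst.smul ((h.fst.smul h2).add (h1.interior h.snd)))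
  natural s q hq A := by
    refine ⟨linearG2Pairs_comp hq A, ?_⟩
    rw [segmentOperator, pairNormal_comp hq]
    ext v
    simp [segmentOperator]

theorem isNaturalOperator_segmentOperator' : IsNaturalOperator linearG2Pairs'
    (fun A α => α.compContinuousLinearMap (A : E6 →L[ℝ] E6)) segmentOperator' where
  smooth s q hq := by
    have h := ContDiffAt.comp (g := pairNormal') (f := Prod.snd) (s, q) (contDiffAt_pairNormal' hq)
      contDiffAt_snd
    have h1 : ContDiffAt ℝ ∞ (fun p : ℝ × _ => p.2.1) (s, q) := contDiffAt_snd.fst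
    have h2 : ContDiffAt ℝ ∞ (fun p : ℝ × _ => p.2.2) (s, q) := contDiffAt_snd.snd
    exact ((contDiffAt_const.sub contDiffAt_fst).smul h1).add
      (contDiffAt_fst.smul ((h.fst.smul h1).add (h2.interior h.snd)))
  natural s q hq A := by
    refine ⟨linearG2Pairs'_comp hq A, ?_⟩
    rw [segmentOperator', pairNormal'_comp hq]
    ext v
    simp [segmentOperator']

theorem isNaturalOperator_segmentNormal_fst : IsNaturalOperator linearG2Pairs (fun _ r => r)
    (fun p => (segmentNormal p).1) where
  smooth s q hq := by
    have h := ContDiffAt.comp (g := pairNormal) (f := Prod.snd) (s, q) (contDiffAt_pairNormal hq)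
      contDiffAt_snd
    exact (contDiffAt_const.sub contDiffAt_fst).add (contDiffAt_fst.mul h.fst)
  natural s q hq A := ⟨linearG2Pairs_comp hq A, by
    simp only [segmentNormal, pairNormal_comp hq]⟩

theorem isNaturalOperator_segmentNormal_snd : IsNaturalOperator linearG2Pairs (fun A v => A.symm v)
    (fun p => (segmentNormal p).2) where
  smooth s q hq := by
    have h := ContDiffAt.comp (g := pairNormal) (f := Prod.snd) (s, q) (contDiffAt_pairNormal hq)
      contDiffAt_snd
    exact contDiffAt_fst.smul h.snd
  natural s q hq A := ⟨linearG2Pairs_comp hq A, by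
    simp only [segmentNormal, pairNormal_comp hq, map_smul]⟩

end NaturalOperators

/-! ### The deformation retractions -/

section Retraction

variable {M : Type*} [TopologicalSpace M] [ChartedSpace (EuclideanSpace ℝ (Fin 6)) M]

theorem SmoothForm.ext_toFun {k : ℕ} {α β : SmoothForm M k} (h : ∀ x, α.toFun x = β.toFun x) :
    α = β := by
  cases α
  cases β
  congr
  exact funext h

theorem isG2Form3_at (ρ : SmoothForm M 3) (η : SmoothForm M 2) (x : M) :
    IsG2Form3 (cylForm3 (ρ.at x) (η.at x)) ↔ (ρ.toFun x, η.toFun x) ∈ linearG2Pairs := Iff.rfl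

theorem isG2Form4_at (ρ : SmoothForm M 3) (τ : SmoothForm M 4) (x : M) :
    IsG2Form4 (cylForm4 (ρ.at x) (τ.at x)) ↔ (ρ.toFun x, τ.toFun x) ∈ linearG2Pairs' := Iff.rfl

/-- A pair of constant forms which is an `SU(3)`-structure. -/
def IsLinearSU3 (ρ : (EuclideanSpace ℝ (Fin 6)) [⋀^Fin 3]→L[ℝ] ℝ)
    (η : (EuclideanSpace ℝ (Fin 6)) [⋀^Fin 2]→L[ℝ] ℝ) : Prop :=
  IsSU3 ρ.toAlternatingMap η.toAlternatingMap

/-- A pair of constant forms which is an `SU(3)`-structure, in the version with 4-forms. -/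
def IsLinearSU3' (ρ : (EuclideanSpace ℝ (Fin 6)) [⋀^Fin 3]→L[ℝ] ℝ)
    (τ : (EuclideanSpace ℝ (Fin 6)) [⋀^Fin 4]→L[ℝ] ℝ) : Prop :=
  IsSU3' ρ.toAlternatingMap τ.toAlternatingMap

theorem isSU3_at (ρ : SmoothForm M 3) (η : SmoothForm M 2) (x : M) :
    IsSU3 (ρ.at x) (η.at x) ↔ IsLinearSU3 (ρ.toFun x) (η.toFun x) := Iff.rfl

theorem isSU3'_at (ρ : SmoothForm M 3) (τ : SmoothForm M 4) (x : M) :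
    IsSU3' (ρ.at x) (τ.at x) ↔ IsLinearSU3' (ρ.toFun x) (τ.toFun x) := Iff.rfl

/-- The forms do not depend on `t`, so the condition at `t = 0` suffices. -/
theorem mem_linearG2Pairs (p : G2Pairs M) (x : M) :
    (p.1.1.toFun x, p.1.2.toFun x) ∈ linearG2Pairs := p.2 (0, x)

theorem mem_linearG2Pairs' (p : G2Pairs' M) (x : M) :
    (p.1.1.toFun x, p.1.2.toFun x) ∈ linearG2Pairs' := p.2 (0, x)

variable [IsManifold (𝓡 6) ∞ M]

/-- The 2-forms of the retraction of `G2Pairs` onto `SU3Pairs`. -/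
noncomputable def retractionForm (p : G2Pairs M) (s : I) : SmoothForm M 2 :=
  isNaturalOperator_segmentOperator.form s p.1.1 p.1.2 (mem_linearG2Pairs p)

/-- The 3-forms of the retraction of `G2Pairs'` onto `SU3Pairs'`. -/
noncomputable def retractionForm' (q : G2Pairs' M × I) : SmoothForm M 3 :=
  isNaturalOperator_segmentOperator'.form q.2 q.1.1.1 q.1.1.2 (mem_linearG2Pairs' q.1)

theorem retractionForm_toFun (p : G2Pairs M) (s : I) (x : M) :
    (retractionForm p s).toFun x = segmentOperator (s, p.1.1.toFun x, p.1.2.toFun x) := rfl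

theorem retractionForm'_toFun (q : G2Pairs' M × I) (x : M) :
    (retractionForm' q).toFun x = segmentOperator' (q.2, q.1.1.1.toFun x, q.1.1.2.toFun x) := rfl

theorem continuous_retractionForm :
    Continuous fun q : G2Pairs M × I => retractionForm q.1 q.2 := by
  have h : Continuous fun q : G2Pairs M × I => q.1.1 := continuous_subtype_val.comp continuous_fst
  exact isNaturalOperator_segmentOperator.continuous_form
    (fun q : G2Pairs M × I => mem_linearG2Pairs q.1) (continuous_subtype_val.comp continuous_snd)
    h.fst h.snd

theorem continuous_retractionForm' : Continuous (retractionForm' (M := M)) := by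
  have h : Continuous fun q : G2Pairs' M × I => q.1.1 := continuous_subtype_val.comp continuous_fst
  exact isNaturalOperator_segmentOperator'.continuous_form
    (fun q : G2Pairs' M × I => mem_linearG2Pairs' q.1) (continuous_subtype_val.comp continuous_snd)
    h.fst h.snd

theorem segmentOperator_mem {s : ℝ} (hs : s ∈ I) {q} (hq : q ∈ linearG2Pairs) :
    (q.1, segmentOperator (s, q)) ∈ linearG2Pairs := IsG2Form3.segment stdBasis hq hs

theorem segmentOperator'_mem {s : ℝ} (hs : s ∈ I) {q} (hq : q ∈ linearG2Pairs') :
    (segmentOperator' (s, q), q.2) ∈ linearG2Pairs' := IsG2Form4.segment stdBasis hq hs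

/-- The retraction of `G2Pairs` onto `SU3Pairs`. -/
noncomputable def retraction : C(G2Pairs M × I, G2Pairs M) where
  toFun q := ⟨(q.1.1.1, retractionForm q.1 q.2), fun y => (isG2Form3_at _ _ _).mpr
    (segmentOperator_mem q.2.2 (mem_linearG2Pairs q.1 y.2))⟩
  continuous_toFun := by
    have h : Continuous fun q : G2Pairs M × I => q.1.1 := continuous_subtype_val.comp continuous_fst
    exact (h.fst.prodMk continuous_retractionForm).subtype_mk _

/-- The retraction of `G2Pairs'` onto `SU3Pairs'`. -/
noncomputable def retraction' : C(G2Pairs' M × I, G2Pairs' M) where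
  toFun q := ⟨(retractionForm' q, q.1.1.2), fun y => (isG2Form4_at _ _ _).mpr
    (segmentOperator'_mem q.2.2 (mem_linearG2Pairs' q.1 y.2))⟩
  continuous_toFun := by
    have h : Continuous fun q : G2Pairs' M × I => q.1.1 := continuous_subtype_val.comp continuous_fst
    exact (continuous_retractionForm'.prodMk h.snd).subtype_mk _

theorem segmentOperator_zero (q) : segmentOperator (0, q) = q.2 := by
  simp [segmentOperator]

theorem segmentOperator'_zero (q) : segmentOperator' (0, q) = q.1 := by
  simp [segmentOperator']

theorem segmentOperator_eq_self (s : ℝ) {q} (h : pairNormal q = (1, 0)) :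
    segmentOperator (s, q) = q.2 := by
  simp only [segmentOperator, h, one_smul, map_zero, add_zero]
  module

theorem segmentOperator'_eq_self (s : ℝ) {q} (h : pairNormal' q = (1, 0)) :
    segmentOperator' (s, q) = q.1 := by
  simp only [segmentOperator', h, one_smul, map_zero, add_zero]
  module

theorem isLinearSU3_segmentOperator {s : ℝ} (hs : s = 1) {q} (hq : q ∈ linearG2Pairs) :
    IsLinearSU3 q.1 (segmentOperator (s, q)) := by
  subst hs
  have h := (IsG2Form3.normalVector_spec stdBasis hq).2.1
  have e : (segmentOperator (1, q)).toAlternatingMap = (pairNormal q).1 • q.2.toAlternatingMap +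
      q.1.toAlternatingMap.curryLeft (pairNormal q).2 := by
    simp only [segmentOperator, sub_self, zero_smul, one_smul, zero_add]
    rfl
  rw [IsLinearSU3, e]
  exact h

theorem isLinearSU3'_segmentOperator' {s : ℝ} (hs : s = 1) {q} (hq : q ∈ linearG2Pairs') :
    IsLinearSU3' (segmentOperator' (s, q)) q.2 := by
  subst hs
  have h := (IsG2Form4.normalVector'_spec stdBasis hq).2
  have e : (segmentOperator' (1, q)).toAlternatingMap = (pairNormal' q).1 • q.1.toAlternatingMap +
      q.2.toAlternatingMap.curryLeft (pairNormal' q).2 := by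
    simp only [segmentOperator', sub_self, zero_smul, one_smul, zero_add]
    rfl
  rw [IsLinearSU3', e]
  exact h

theorem isLinearSU3_of_eq {ρ : (EuclideanSpace ℝ (Fin 6)) [⋀^Fin 3]→L[ℝ] ℝ}
    {η η' : (EuclideanSpace ℝ (Fin 6)) [⋀^Fin 2]→L[ℝ] ℝ} {s : ℝ} (hs : s = 1)
    (h : (ρ, η) ∈ linearG2Pairs) (e : η' = segmentOperator (s, ρ, η)) : IsLinearSU3 ρ η' := by
  rw [e]
  generalize hq : (ρ, η) = q at *
  obtain rfl : q.1 = ρ := by rw [← hq]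
  exact isLinearSU3_segmentOperator hs h

theorem IsLinearSU3.pairNormal_eq {q : ((EuclideanSpace ℝ (Fin 6)) [⋀^Fin 3]→L[ℝ] ℝ) × _}
    (h : IsLinearSU3 q.1 q.2) : pairNormal q = (1, 0) := IsSU3.normalVector_eq stdBasis h

theorem IsLinearSU3'.pairNormal'_eq {q : ((EuclideanSpace ℝ (Fin 6)) [⋀^Fin 3]→L[ℝ] ℝ) × _}
    (h : IsLinearSU3' q.1 q.2) : pairNormal' q = (1, 0) := IsSU3'.normalVector'_eq stdBasis h

theorem mem_SU3Pairs {ρ : SmoothForm M 3} {η : SmoothForm M 2}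
    (h : ∀ x, IsLinearSU3 (ρ.toFun x) (η.toFun x)) : (ρ, η) ∈ SU3Pairs M :=
  fun x => (isSU3_at ρ η x).mpr (h x)

theorem isLinearSU3_retractionForm (p : G2Pairs M) {s : I} (hs : (s : ℝ) = 1) (x : M) :
    IsLinearSU3 (p.1.1.toFun x) ((retractionForm p s).toFun x) :=
  isLinearSU3_of_eq hs (mem_linearG2Pairs p x) (retractionForm_toFun p s x)

theorem retraction_one_mem (p : G2Pairs M) : (retraction (p, 1)).1 ∈ SU3Pairs M :=
  mem_SU3Pairs (isLinearSU3_retractionForm p Set.Icc.coe_one)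

theorem retraction_eq_self (p : G2Pairs M) (s : I) (hp : p.1 ∈ SU3Pairs M) :
    retraction (p, s) = p :=
  Subtype.ext (Prod.ext rfl (SmoothForm.ext_toFun fun x => (retractionForm_toFun _ _ _).trans
    (segmentOperator_eq_self s (IsLinearSU3.pairNormal_eq ((isSU3_at _ _ _).mp (hp x))))))

theorem isDeformationRetraction_retraction :
    IsDeformationRetraction (SU3Pairs M) (G2Pairs M) retraction where
  subset _ hp y := (hp y.2).isG2Form3
  zero _ := Subtype.ext (Prod.ext rfl (SmoothForm.ext_toFun fun _ =>
    (retractionForm_toFun _ _ _).trans (segmentOperator_zero _)))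
  one_mem := retraction_one_mem
  fixed := retraction_eq_self

theorem isDeformationRetraction_retraction' :
    IsDeformationRetraction (SU3Pairs' M) (G2Pairs' M) retraction' where
  subset _ hp y := (hp y.2).isG2Form4
  zero _ := Subtype.ext (Prod.ext (SmoothForm.ext_toFun fun _ =>
    (retractionForm'_toFun _ _).trans (segmentOperator'_zero _)) rfl)
  one_mem p x := (isSU3'_at _ _ _).mpr (isLinearSU3'_segmentOperator' rfl (mem_linearG2Pairs' p x))
  fixed _ s hp := Subtype.ext (Prod.ext (SmoothForm.ext_toFun fun x =>
    (retractionForm'_toFun _ _).trans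
      (segmentOperator'_eq_self s (IsLinearSU3'.pairNormal'_eq ((isSU3'_at _ _ _).mp (hp x))))) rfl)

/-- The vector fields `(1 - s) ∂_t + s n` from `∂_t` to the unit normal `n`. -/
noncomputable def normalFamily (p : G2Pairs M) (s : ℝ) (x : M) : ℝ × TangentSpace (𝓡 6) x :=
  segmentNormal (s, p.1.1.toFun x, p.1.2.toFun x)

theorem segmentNormal_zero (q) : segmentNormal (0, q) = (1, 0) := by
  simp [segmentNormal]

theorem segmentNormal_one (q) : segmentNormal (1, q) = pairNormal q := by
  simp [segmentNormal]

theorem segmentNormal_fst_pos (s : I) {q} (hq : q ∈ linearG2Pairs) :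
    0 < (segmentNormal (s, q)).1 := by
  have hn : 0 < (pairNormal q).1 := (IsG2Form3.normalVector_spec stdBasis hq).1
  change 0 < (1 - (s : ℝ)) + s * _
  obtain ⟨s, h0, h1⟩ := s
  rcases h0.eq_or_lt with rfl | h0
  · simp
  · exact add_pos_of_nonneg_of_pos (sub_nonneg.mpr h1) (mul_pos h0 hn)

theorem normalFamily_zero (p : G2Pairs M) (x : M) : normalFamily p 0 x = (1, 0) :=
  segmentNormal_zero _

theorem normalFamily_one (p : G2Pairs M) (x : M) :
    normalFamily p 1 x = pairNormal (p.1.1.toFun x, p.1.2.toFun x) :=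
  segmentNormal_one _

theorem normalFamily_fst_pos (p : G2Pairs M) (s : I) (x : M) : 0 < (normalFamily p s x).1 :=
  segmentNormal_fst_pos s (mem_linearG2Pairs p x)

theorem unit_normalFamily (p : G2Pairs M) (x : M) :
    g2Metric (cylForm3 (p.1.1.at x) (p.1.2.at x)) (normalFamily p 1 x) (normalFamily p 1 x) = 1 := by
  rw [normalFamily_one]
  exact (IsG2Form3.normalVector_spec stdBasis (mem_linearG2Pairs p x)).2.2.1

theorem normal_normalFamily (p : G2Pairs M) (x : M) (v : TangentSpace (𝓡 6) x) :
    g2Metric (cylForm3 (p.1.1.at x) (p.1.2.at x)) (normalFamily p 1 x) (0, v) = 0 := by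
  rw [normalFamily_one]
  exact (IsG2Form3.normalVector_spec stdBasis (mem_linearG2Pairs p x)).2.2.2.1 v

theorem contMDiff_normalFamily_fst (p : G2Pairs M) : ContMDiff (𝓘(ℝ, ℝ).prod (𝓡 6)) 𝓘(ℝ, ℝ) ∞
    (fun q : ℝ × M => (normalFamily p q.1 q.2).1) :=
  isNaturalOperator_segmentNormal_fst.contMDiff_function _ _ (mem_linearG2Pairs p)

theorem contMDiff_normalFamily_snd (p : G2Pairs M) :
    ContMDiff (𝓘(ℝ, ℝ).prod (𝓡 6)) (𝓡 6).tangent ∞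
      (fun q : ℝ × M => (⟨q.2, (normalFamily p q.1 q.2).2⟩ : TangentBundle (𝓡 6) M)) :=
  isNaturalOperator_segmentNormal_snd.contMDiff_section _ _ (mem_linearG2Pairs p)

theorem isNormalIsotopy_normalFamily (p : G2Pairs M) :
    IsNormalIsotopy (fun x => cylForm3 (p.1.1.at x) (p.1.2.at x)) (normalFamily p) where
  smooth_fst := contMDiff_normalFamily_fst p
  smooth_snd := contMDiff_normalFamily_snd p
  ne_zero s x h := (normalFamily_fst_pos p s x).ne' (congrArg Prod.fst h)
  zero := normalFamily_zero p
  unit := unit_normalFamily p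
  normal := normal_normalFamily p

/-- Contraction is linear in the vector, so the segment of 2-forms is the contraction of `φ` with
the segment of vectors. This puts the retraction in the form `ω_s(u, v) = g_φ(u, -n_s × v)`. -/
theorem segmentOperator_apply (s : ℝ) (q) (u v : EuclideanSpace ℝ (Fin 6)) :
    segmentOperator (s, q) ![u, v] = (segmentNormal (s, q)).1 * q.2 ![u, v] +
      q.1 ![(segmentNormal (s, q)).2, u, v] := by
  have h : q.1 ![s • (pairNormal q).2, u, v] = s * q.1 ![(pairNormal q).2, u, v] :=
    congrArg (fun α : (EuclideanSpace ℝ (Fin 6)) [⋀^Fin 2]→L[ℝ] ℝ => α ![u, v])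
      (map_smul q.1.curryLeft s (pairNormal q).2)
  simp only [segmentNormal, h]
  simp only [segmentOperator, ContinuousAlternatingMap.add_apply,
    ContinuousAlternatingMap.smul_apply, smul_eq_mul,
    ContinuousAlternatingMap.curryLeft_apply_apply]
  ring

theorem g2Metric_g2Cross_at {ρ : SmoothForm M 3} {η : SmoothForm M 2} {x : M}
    (h : IsG2Form3 (cylForm3 (ρ.at x) (η.at x)))
    {ρ' : (EuclideanSpace ℝ (Fin 6)) [⋀^Fin 3]→L[ℝ] ℝ} (hρ : ρ.toFun x = ρ')
    {η' : (EuclideanSpace ℝ (Fin 6)) [⋀^Fin 2]→L[ℝ] ℝ} (hη : η.toFun x = η')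
    (m : ℝ × EuclideanSpace ℝ (Fin 6)) (u v : EuclideanSpace ℝ (Fin 6)) :
    g2Metric (cylForm3 (ρ.at x) (η.at x)) (0, u)
      (-g2Cross (cylForm3 (ρ.at x) (η.at x)) m (0, v)) = m.1 * η' ![u, v] + ρ' ![m.2, u, v] := by
  subst hρ hη
  exact g2Metric_g2Cross _ _ h m u v

theorem retractionForm_apply (p : G2Pairs M) (s : I) (x : M) (u v : EuclideanSpace ℝ (Fin 6)) :
    (retractionForm p s).at x ![u, v] = g2Metric (cylForm3 (p.1.1.at x) (p.1.2.at x)) (0, u)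
      (-g2Cross (cylForm3 (p.1.1.at x) (p.1.2.at x)) (normalFamily p s x) (0, v)) :=
  (segmentOperator_apply s _ u v).trans (g2Metric_g2Cross_at (p.2 (0, x)) rfl rfl _ u v).symm

end Retraction

theorem mainTheorem12 (M : Type*) [TopologicalSpace M]
    [ChartedSpace (EuclideanSpace ℝ (Fin 6)) M] [IsManifold (𝓡 6) ∞ M]
    [T2Space M] [SecondCountableTopology M] :
    (∃ F : C(G2Pairs M × I, G2Pairs M),
      IsDeformationRetraction (SU3Pairs M) (G2Pairs M) F ∧
      ∀ p : G2Pairs M,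
        (∀ s : I, (F (p, s)).1.1 = p.1.1) ∧
        ∃ n : ℝ → ∀ x : M, ℝ × TangentSpace (𝓡 6) x,
          IsNormalIsotopy (fun x => cylForm3 (p.1.1.at x) (p.1.2.at x)) n ∧
          (∀ x : M, ∃ J : TangentSpace (𝓡 6) x →ₗ[ℝ] TangentSpace (𝓡 6) x,
            (∀ v, J (J v) = -v) ∧
            ∀ v, g2Cross (cylForm3 (p.1.1.at x) (p.1.2.at x)) (n 1 x) (0, v) = (0, J v)) ∧
          ∀ (s : I) (x : M) (u v : TangentSpace (𝓡 6) x),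
            (F (p, s)).1.2.at x ![u, v] =
              g2Metric (cylForm3 (p.1.1.at x) (p.1.2.at x)) (0, u)
                (-g2Cross (cylForm3 (p.1.1.at x) (p.1.2.at x)) (n s x) (0, v))) ∧
    ∃ F : C(G2Pairs' M × I, G2Pairs' M),
      IsDeformationRetraction (SU3Pairs' M) (G2Pairs' M) F := by
  refine ⟨⟨retraction, isDeformationRetraction_retraction, fun p => ⟨fun s => rfl,
    normalFamily p, isNormalIsotopy_normalFamily p, fun x => ?_, fun s x u v => ?_⟩⟩,
    retraction', isDeformationRetraction_retraction'⟩
  · rw [normalFamily_one]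
    exact (IsG2Form3.normalVector_spec stdBasis (mem_linearG2Pairs p x)).2.2.2.2
  · exact retractionForm_apply p s x u v
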